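/- **Theorem (Gårding's inequality for SG $M$-elliptic operators).** Let $\Lambda\in C^\infty(\mathbb R^n)$ be a positive weight function with polynomial growth: there are constants $0<\mu_0\le\mu_1$ and $0<C_0\le C_1$ with $C_0(1+|\xi|)^{\mu_0}\le\Lambda(\xi)\le C_1(1+|\xi|)^{\mu_1}$ for all $\xi$, and a real $\mu\ge\mu_1$ such that for all multi-indices $\alpha,\gamma$ with $\gamma_j\in\{0,1\}$ there is $C_{\alpha,\gamma}>0$ with $|\xi^\gamma\partial^{\alpha+\gamma}\Lambda(\xi)|\le C_{\alpha,\gamma}\Lambda(\xi)^{1-|\alpha|/\mu}$ for all $\xi$. Let $\rho\in(0,1/\mu]$. For $k_1,k_2\in\mathbb R$, let $S^{k_1,k_2}_{\rho,\Lambda}$ be the set of $\sigma\in C^\infty(\mathbb R^n\times\mathbb R^n)$ (complex-valued) such that for all multi-indices $\alpha,\beta$ there is $C_{\alpha,\beta}>0$ with $$|\partial_x^\alpha\partial_\xi^\beta\sigma(x,\xi)|\le C_{\alpha,\beta}\,\Lambda(x)^{k_2-\rho|\alpha|}\,\Lambda(\xi)^{k_1-\rho|\beta|},\qquad x,\xi\in\mathbb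 R^n,$$ and let $M^{k_1,k_2}_{\rho,\Lambda}$ be the set of $\sigma\in C^\infty(\mathbb R^n\times\mathbb R^n)$ such that $\xi^\gamma\partial_\xi^\gamma\sigma\in S^{k_1,k_2}_{\rho,\Lambda}$ for all multi-indices $\gamma$ with $\gamma_j\in\{0,1\}$. For a symbol $\sigma$ and a Schwartz function $\varphi$ put $$(T_\sigma\varphi)(x)=(2\pi)^{-n/2}\int_{\mathbb R^n}e^{ix\cdot\xi}\sigma(x,\xi)\hat\varphi(\xi)\,d\xi,\qquad \hat\varphi(\xi)=(2\pi)^{-n/2}\int_{\mathbb R^n}e^{-ix\cdot\xi}\varphi(x)\,dx,$$ let $(f,g)=\int_{\mathbb R^n}f\,\overline g\,dx$, and for $t_1,t_2\in\mathbb R$ let $\|\varphi\|_{t_1,t_2,2,\Lambda}=\|T_{\omega}\varphi\|_{L^2(\mathbb R^n)}$, where $\omega(x,\xi)=\Lambda(x)^{t_2}\Lambda(\xi)^{t_1}$. Let $m_1,m_2\in\mathbb R$ and let $\sigma\in M^{2m_1,2m_2}_{\rho,\Lambda}$ be strongly SG $M$-elliptic, that is, there are $C,R>0$ with $$\operatorname{Re}\sigma(x,\xi)\ge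 C\,\Lambda(x)^{2m_2}\Lambda(\xi)^{2m_1}\qquad\text{whenever } |x|^2+|\xi|^2\ge R^2 .$$ Then there is a constant $C'>0$, and for all real $s_1\le\rho/2$ and $s_2\ge\rho/2$ there is a constant $C_{s_1,s_2}>0$, such that $$\operatorname{Re}(T_\sigma\varphi,\varphi)\ \ge\ C'\,\|\varphi\|^2_{m_1,m_2,2,\Lambda}-C_{s_1,s_2}\,\|\varphi\|^2_{m_1-s_1,\,m_2-s_2,2,\Lambda}\qquad\text{for all }\varphi\in\mathcal S(\mathbb R^n).$$ -/

import Mathlib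

open MeasureTheory
open scoped ContDiff ENNReal

/-- The partial derivative `∂_j f` of a function on `ℝⁿ`. -/
noncomputable def partialDeriv {n : ℕ} {F : Type*} [NormedAddCommGroup F] [NormedSpace ℝ F]
    (j : Fin n) (f : EuclideanSpace ℝ (Fin n) → F) : EuclideanSpace ℝ (Fin n) → F :=
  fun x => fderiv ℝ f x (EuclideanSpace.single j 1)

/-- The multi-index derivative `∂^α f = ∂_1^{α_1} ⋯ ∂_n^{α_n} f`. -/
noncomputable def multiDeriv {n : ℕ} {F : Type*} [NormedAddCommGroup F] [NormedSpace ℝ F]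
    (α : Fin n → ℕ) (f : EuclideanSpace ℝ (Fin n) → F) : EuclideanSpace ℝ (Fin n) → F :=
  (List.finRange n).foldr (fun j g => (partialDeriv j)^[α j] g) f

/-- The monomial `ξ^γ = ξ_1^{γ_1} ⋯ ξ_n^{γ_n}`. -/
noncomputable def multiPow {n : ℕ} (ξ : EuclideanSpace ℝ (Fin n)) (γ : Fin n → ℕ) : ℝ :=
  ∏ j, ξ j ^ γ j

/-- `Λ` is a (positive, smooth) weight function with polynomial growth on `ℝⁿ`, whose derivatives
are controlled with the constant `μ`, where `μ` is at least the upper growth exponent. -/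
structure IsWeight {n : ℕ} (Λ : EuclideanSpace ℝ (Fin n) → ℝ) (μ : ℝ) : Prop where
  contDiff : ContDiff ℝ ∞ Λ
  pos : ∀ ξ, 0 < Λ ξ
  growth : ∃ μ₀ μ₁ C₀ C₁ : ℝ, 0 < μ₀ ∧ μ₀ ≤ μ₁ ∧ μ₁ ≤ μ ∧ 0 < C₀ ∧ C₀ ≤ C₁ ∧
    ∀ ξ, C₀ * (1 + ‖ξ‖) ^ μ₀ ≤ Λ ξ ∧ Λ ξ ≤ C₁ * (1 + ‖ξ‖) ^ μ₁
  deriv_le : ∀ α γ : Fin n → ℕ, (∀ j, γ j = 0 ∨ γ j = 1) → ∃ C : ℝ, 0 < C ∧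
    ∀ ξ, |multiPow ξ γ * multiDeriv (α + γ) Λ ξ| ≤ C * Λ ξ ^ (1 - (1 / μ) * (∑ j, α j : ℕ))

/-- The class `S^{m₁,m₂}_{ρ,Λ}`: smooth `σ(x,ξ)` with
`|∂_x^α ∂_ξ^β σ(x,ξ)| ≤ C_{α,β} Λ(x)^{m₂-ρ|α|} Λ(ξ)^{m₁-ρ|β|}`. -/
structure IsSGSymbolS {n : ℕ} (Λ : EuclideanSpace ℝ (Fin n) → ℝ) (ρ m₁ m₂ : ℝ)
    (σ : EuclideanSpace ℝ (Fin n) → EuclideanSpace ℝ (Fin n) → ℂ) : Prop where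
  contDiff : ContDiff ℝ ∞ (Function.uncurry σ)
  deriv_le : ∀ α β : Fin n → ℕ, ∃ C : ℝ, 0 < C ∧ ∀ x ξ,
    ‖multiDeriv α (fun y => multiDeriv β (σ y) ξ) x‖ ≤
      C * Λ x ^ (m₂ - ρ * (∑ j, α j : ℕ)) * Λ ξ ^ (m₁ - ρ * (∑ j, β j : ℕ))

/-- The class `M^{m₁,m₂}_{ρ,Λ}`: smooth `σ` such that `ξ^γ ∂_ξ^γ σ` lies in `S^{m₁,m₂}_{ρ,Λ}` for
all multi-indices `γ` with entries in `{0, 1}` (in particular, for `γ = 0`, `σ` itself does). -/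
structure IsSGSymbolM {n : ℕ} (Λ : EuclideanSpace ℝ (Fin n) → ℝ) (ρ m₁ m₂ : ℝ)
    (σ : EuclideanSpace ℝ (Fin n) → EuclideanSpace ℝ (Fin n) → ℂ) : Prop where
  contDiff : ContDiff ℝ ∞ (Function.uncurry σ)
  mem_S : ∀ γ : Fin n → ℕ, (∀ j, γ j = 0 ∨ γ j = 1) →
    IsSGSymbolS Λ ρ m₁ m₂ (fun x ξ => (multiPow ξ γ : ℂ) * multiDeriv γ (σ x) ξ)

/-- Strong SG `M`-ellipticity of a symbol of order `(m₁, m₂)`. -/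
def IsStronglySGElliptic {n : ℕ} (Λ : EuclideanSpace ℝ (Fin n) → ℝ) (m₁ m₂ : ℝ)
    (σ : EuclideanSpace ℝ (Fin n) → EuclideanSpace ℝ (Fin n) → ℂ) : Prop :=
  ∃ C R : ℝ, 0 < C ∧ 0 < R ∧ ∀ x ξ, R ^ 2 ≤ ‖x‖ ^ 2 + ‖ξ‖ ^ 2 →
    C * Λ x ^ m₂ * Λ ξ ^ m₁ ≤ (σ x ξ).re

/-- The Fourier transform `φ̂(ξ) = (2π)^{-n/2} ∫ e^{-i x·ξ} φ(x) dx`. -/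
noncomputable def fourierHat {n : ℕ} (φ : EuclideanSpace ℝ (Fin n) → ℂ)
    (ξ : EuclideanSpace ℝ (Fin n)) : ℂ :=
  (((2 * Real.pi) ^ (-(n : ℝ) / 2) : ℝ) : ℂ) *
    ∫ x, Complex.exp (-(Complex.I * (inner ℝ x ξ : ℝ))) * φ x

/-- The pseudo-differential operator
`(T_σ φ)(x) = (2π)^{-n/2} ∫ e^{i x·ξ} σ(x,ξ) φ̂(ξ) dξ`. -/
noncomputable def pseudoDiffOp {n : ℕ}
    (σ : EuclideanSpace ℝ (Fin n) → EuclideanSpace ℝ (Fin n) → ℂ)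
    (φ : EuclideanSpace ℝ (Fin n) → ℂ) (x : EuclideanSpace ℝ (Fin n)) : ℂ :=
  (((2 * Real.pi) ^ (-(n : ℝ) / 2) : ℝ) : ℂ) *
    ∫ ξ, Complex.exp (Complex.I * (inner ℝ x ξ : ℝ)) * σ x ξ * fourierHat φ ξ

/-- The symbol `σ_{m₁,m₂}(x,ξ) = Λ(x)^{-m₂} Λ(ξ)^{-m₁}` of the operator `J_{m₁,m₂}`. -/
noncomputable def besselSymbol {n : ℕ} (Λ : EuclideanSpace ℝ (Fin n) → ℝ) (m₁ m₂ : ℝ) :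
    EuclideanSpace ℝ (Fin n) → EuclideanSpace ℝ (Fin n) → ℂ :=
  fun x ξ => ((Λ x ^ (-m₂) * Λ ξ ^ (-m₁) : ℝ) : ℂ)

/-- The weighted Sobolev norm `‖φ‖_{s₁,s₂,p,Λ} = ‖J_{-s₁,-s₂} φ‖_{L^p}`. -/
noncomputable def sobolevNorm {n : ℕ} (Λ : EuclideanSpace ℝ (Fin n) → ℝ) (s₁ s₂ : ℝ) (p : ℝ≥0∞)
    (φ : EuclideanSpace ℝ (Fin n) → ℂ) : ℝ :=
  (eLpNorm (pseudoDiffOp (besselSymbol Λ (-s₁) (-s₂)) φ) p volume).toReal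

/-- The `L²` pairing `(f, g) = ∫ f(x) \overline{g(x)} dx`. -/
noncomputable def pairing {n : ℕ} (f g : EuclideanSpace ℝ (Fin n) → ℂ) : ℂ :=
  ∫ x, f x * starRingEnd ℂ (g x)

/-! Write ω = Λ(x)^{m₂} Λ(ξ)^{m₁} and θ = ω² Λ(x)^{-ρ} Λ(ξ)^{-ρ}. Strong ellipticity can fail only
on a bounded part of phase space, where ω² is at most a multiple of θ. So for suitable c and κ the
function f = Re σ - c ω² + κ θ is at least c ω² everywhere (`WeightBounds.exists_elliptic_shift`).
Its square root b is then a symbol of order (m₁, m₂) (`SGFamily.rpow_of_elliptic`), and ‖T_b φ‖² ≥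
0. Expanding b² = f gives the inequality for s₁ = s₂ = ρ/2, provided three exchanges cost only
‖φ‖²_{m₁-ρ/2, m₂-ρ/2}: ‖T_b φ‖² for (T_{b²} φ, φ), ‖T_ω φ‖² for (T_{ω²} φ, φ), and the form of the
conjugate of σ for the conjugate of the form of σ. The form of θ is of that size already
(`WeightBounds.garding_cutoff`, `WeightBounds.garding_half`).

All three exchanges are one deformation. Up to normalization, the form with amplitude c(x,ξ) d(x, ξ
+ t(η-ξ)) and phase e^{ix·(ξ-η)} is (T_{cd} φ, φ) at t = 0 and (T_c φ, T_{conj d} φ) at t = 1. Its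
t-derivative carries Σ_j (η_j - ξ_j) ∂_{ξ_j} d. Against the phase, η_j - ξ_j acts as i ∂_{x_j}, so
integration by parts leaves ∂_{x_j}(c ∂_{ξ_j} d), which has gained ρ in x and ρ in ξ
(`hasDerivAt_integral_freqForm`, `WeightBounds.norm_integral_deformAmp_sub_le`). No asymptotic
expansion is needed: it is enough that one derivative in x_j, one in ξ_j, or one in each gains, and
this is what `SGFamily` records.

The resulting forms are bounded by a Calderón–Vaillancourt argument
(`WeightBounds.norm_integral_freqForm_le`). The form is averaged over translates of a bump in
position. For each translate, integration by parts in x gives decay in ξ - η and hence a Schur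
bound, while integration by parts in ξ and η gives decay of φ away from the bump. The translates are
summed using the temperance of Λ. A dilated cutoff χ(εx) keeps every integral absolutely convergent;
all bounds are uniform in ε, which then tends to 0.

Passing to other s₁ ≤ ρ/2 ≤ s₂ uses monotonicity of the norms in the frequency order and an
ε-interpolation between powers of Λ(x). -/

/-! ### Uniform derivative bounds for parametrized families -/

section SymBoundBasics

variable {T T' V V' F G : Type*} [NormedAddCommGroup V] [NormedSpace ℝ V]
  [NormedAddCommGroup V'] [NormedSpace ℝ V'] [NormedAddCommGroup F] [NormedSpace ℝ F]
  [NormedAddCommGroup G] [NormedSpace ℝ G]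

/-- The functions `f t` are smooth, and their derivatives of order at most `N` are bounded by
multiples of the weight `M t`, uniformly in the parameter `t`. -/
def SymBound (N : ℕ∞) (M : T → V → ℝ) (f : T → V → F) : Prop :=
  (∀ t, ContDiff ℝ ∞ (f t)) ∧ ∀ k : ℕ, (k : ℕ∞) ≤ N → ∃ C : ℝ, 0 ≤ C ∧
    ∀ t z, ‖iteratedFDeriv ℝ k (f t) z‖ ≤ C * M t z

namespace SymBound

variable {N : ℕ∞} {M M' : T → V → ℝ} {f g : T → V → F}

theorem contDiff (h : SymBound N M f) (t : T) : ContDiff ℝ ∞ (f t) := h.1 t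

theorem differentiable (h : SymBound N M f) (t : T) : Differentiable ℝ (f t) :=
  (h.1 t).differentiable (by simp)

theorem continuous (h : SymBound N M f) (t : T) : Continuous (f t) := (h.1 t).continuous

theorem norm_le (h : SymBound N M f) : ∃ C : ℝ, 0 ≤ C ∧ ∀ t z, ‖f t z‖ ≤ C * M t z := by
  simpa using h.2 0 (by simp)

theorem of_le {N' : ℕ∞} (h : SymBound N M f) (hN : N' ≤ N) : SymBound N' M f :=
  ⟨h.1, fun k hk => h.2 k (hk.trans hN)⟩

theorem top_of_forall (h : ∀ k : ℕ, SymBound k M f) : SymBound ⊤ M f :=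
  ⟨(h 0).1, fun k _ => (h k).2 k le_rfl⟩

theorem mono (h : SymBound N M f) {B : ℝ} (hB : 0 ≤ B) (hM : ∀ t z, M t z ≤ B * M' t z) :
    SymBound N M' f := by
  refine ⟨h.1, fun k hk => ?_⟩
  obtain ⟨C, hC, hb⟩ := h.2 k hk
  refine ⟨C * B, by positivity, fun t z => (hb t z).trans ?_⟩
  rw [mul_assoc]
  gcongr
  exact hM t z

theorem congr (h : SymBound N M f) (hfg : ∀ t z, g t z = f t z) : SymBound N M g := by
  rwa [show g = f from funext fun t => funext fun z => hfg t z]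

theorem congr_weight (h : SymBound N M f) (hM : ∀ t z, M' t z = M t z) : SymBound N M' f := by
  rwa [show M' = M from funext fun t => funext fun z => hM t z]

theorem reparam (h : SymBound N M f) (τ : T' → T) :
    SymBound N (fun t => M (τ t)) (fun t => f (τ t)) :=
  ⟨fun _ => h.1 _, fun k hk => (h.2 k hk).imp fun _ hC => ⟨hC.1, fun _ z => hC.2 _ z⟩⟩

theorem add (hf : SymBound N M f) (hg : SymBound N M g) :
    SymBound N M (fun t z => f t z + g t z) := by
  refine ⟨fun t => (hf.1 t).add (hg.1 t), fun k hk => ?_⟩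
  obtain ⟨C, hC, hb⟩ := hf.2 k hk
  obtain ⟨C', hC', hb'⟩ := hg.2 k hk
  refine ⟨C + C', by positivity, fun t z => ?_⟩
  change ‖iteratedFDeriv ℝ k (f t + g t) z‖ ≤ _
  rw [iteratedFDeriv_add_apply ((hf.1 t).of_le (mod_cast le_top)).contDiffAt
    ((hg.1 t).of_le (mod_cast le_top)).contDiffAt, add_mul]
  exact (norm_add_le _ _).trans (add_le_add (hb t z) (hb' t z))

theorem zero : SymBound N M (fun _ _ => (0 : F)) := by
  refine ⟨fun t => contDiff_const, fun k hk => ⟨0, le_rfl, fun t z => ?_⟩⟩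
  have : iteratedFDeriv ℝ k (fun _ : V => (0 : F)) = 0 := iteratedFDeriv_fun_zero
  simp [this]

theorem const (c : F) : SymBound N (fun (_ : T) (_ : V) => 1) (fun _ _ => c) := by
  refine ⟨fun t => contDiff_const, fun k hk => ⟨‖c‖, by positivity, fun t z => ?_⟩⟩
  rcases Nat.eq_zero_or_pos k with rfl | hk
  · simp
  · rw [iteratedFDeriv_const_of_ne hk.ne']
    simp

theorem clm_comp (L : F →L[ℝ] G) (h : SymBound N M f) :
    SymBound N M (fun t z => L (f t z)) := by
  refine ⟨fun t => L.contDiff.comp (h.1 t), fun k hk => ?_⟩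
  obtain ⟨C, hC, hb⟩ := h.2 k hk
  refine ⟨‖L‖ * C, by positivity, fun t z => ?_⟩
  refine (L.norm_iteratedFDeriv_comp_left (h.1 t).contDiffAt (n := k) (mod_cast le_top)).trans ?_
  rw [mul_assoc]
  gcongr
  exact hb t z

theorem neg (h : SymBound N M f) : SymBound N M (fun t z => -f t z) :=
  h.clm_comp (-ContinuousLinearMap.id ℝ F)

theorem sub (hf : SymBound N M f) (hg : SymBound N M g) :
    SymBound N M (fun t z => f t z - g t z) := by
  simpa only [sub_eq_add_neg] using hf.add hg.neg

theorem sum {ι : Type*} (s : Finset ι) {f : ι → T → V → F}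
    (h : ∀ i ∈ s, SymBound N M (f i)) : SymBound N M (fun t z => ∑ i ∈ s, f i t z) := by
  classical
  induction s using Finset.induction_on with
  | empty => simpa using zero
  | insert a s ha ih =>
    simp only [Finset.sum_insert ha]
    exact (h a (by simp)).add (ih fun i hi => h i (by simp [hi]))

theorem bilin (B : F →L[ℝ] G →L[ℝ] G) (hB : ‖B‖ ≤ 1) {g : T → V → G} (hf : SymBound N M f)
    (hg : SymBound N M' g) :
    SymBound N (fun t z => M t z * M' t z) (fun t z => B (f t z) (g t z)) := by
  refine ⟨fun t => B.isBoundedBilinearMap.contDiff.comp ((hf.1 t).prodMk (hg.1 t)), fun k hk => ?_⟩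
  choose! C hC hb using hf.2
  choose! C' hC' hb' using hg.2
  have hle : ∀ i ∈ Finset.range (k + 1), (i : ℕ∞) ≤ N ∧ ((k - i : ℕ) : ℕ∞) ≤ N := fun i hi =>
    ⟨le_trans (mod_cast Finset.mem_range_succ_iff.1 hi) hk,
      le_trans (mod_cast Nat.sub_le _ _) hk⟩
  refine ⟨∑ i ∈ Finset.range (k + 1), (k.choose i : ℝ) * C i * C' (k - i),
    Finset.sum_nonneg fun i hi => ?_, fun t z => ?_⟩
  · have := hC i (hle i hi).1
    have := hC' (k - i) (hle i hi).2
    positivity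
  · refine (B.norm_iteratedFDeriv_le_of_bilinear_of_le_one (hf.1 t) (hg.1 t) z
      (n := k) (mod_cast le_top) hB).trans ?_
    rw [Finset.sum_mul]
    refine Finset.sum_le_sum fun i hi => ?_
    have h1 := hb i (hle i hi).1 t z
    have h2 := hb' (k - i) (hle i hi).2 t z
    calc _ ≤ (k.choose i : ℝ) * (C i * M t z) * (C' (k - i) * M' t z) := by
          have := (norm_nonneg _).trans h1
          gcongr
      _ = _ := by ring

theorem mul {𝕜 : Type*} [RCLike 𝕜] {f g : T → V → 𝕜} (hf : SymBound N M f)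
    (hg : SymBound N M' g) :
    SymBound N (fun t z => M t z * M' t z) (fun t z => f t z * g t z) :=
  hf.bilin (ContinuousLinearMap.mul ℝ 𝕜) (ContinuousLinearMap.opNorm_mul_le _ _) hg

theorem smul {f : T → V → ℝ} {g : T → V → G} (hf : SymBound N M f) (hg : SymBound N M' g) :
    SymBound N (fun t z => M t z * M' t z) (fun t z => f t z • g t z) :=
  hf.bilin (ContinuousLinearMap.lsmul ℝ ℝ) ContinuousLinearMap.opNorm_lsmul_le hg

theorem const_mul {𝕜 : Type*} [RCLike 𝕜] {f : T → V → 𝕜} (c : 𝕜) (h : SymBound N M f) :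
    SymBound N M (fun t z => c * f t z) :=
  h.clm_comp (ContinuousLinearMap.mul ℝ 𝕜 c)

theorem ofReal {f : T → V → ℝ} (h : SymBound N M f) : SymBound N M (fun t z => (f t z : ℂ)) :=
  h.clm_comp Complex.ofRealCLM

theorem conj {f : T → V → ℂ} (h : SymBound N M f) :
    SymBound N M (fun t z => starRingEnd ℂ (f t z)) :=
  h.clm_comp (Complex.conjCLE : ℂ →L[ℝ] ℂ)

/-- Translations leave derivatives unchanged and the linear part enters only through its norm, so
only `L t` has to be bounded in the parameter. Unbounded translations `a t` are needed for
localization at arbitrary points. -/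
theorem comp_affine {f : T → V → F} (h : SymBound N M f) (L : T → V' →L[ℝ] V) (a : T → V)
    {B : ℝ} (hB : ∀ t, ‖L t‖ ≤ B) :
    SymBound N (fun t z => M t (L t z + a t)) (fun t z => f t (L t z + a t)) := by
  refine ⟨fun t => (h.1 t).comp ((L t).contDiff.add contDiff_const), fun k hk => ?_⟩
  obtain ⟨C, hC, hb⟩ := h.2 k hk
  refine ⟨C * (max B 0) ^ k, by positivity, fun t z => ?_⟩
  have h1 : ContDiff ℝ ∞ (fun z => f t (z + a t)) := (h.1 t).comp (contDiff_id.add contDiff_const)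
  have h2 := (L t).iteratedFDeriv_comp_right h1 z (i := k) (mod_cast le_top)
  change ‖iteratedFDeriv ℝ k ((fun z => f t (z + a t)) ∘ (L t)) z‖ ≤ _
  rw [h2]
  refine (ContinuousMultilinearMap.norm_compContinuousLinearMap_le _ _).trans ?_
  rw [iteratedFDeriv_comp_add_right, Finset.prod_const, Finset.card_univ, Fintype.card_fin]
  have h4 : ‖L t‖ ≤ max B 0 := (hB t).trans (le_max_left _ _)
  calc _ ≤ (C * M t (L t z + a t)) * (max B 0) ^ k :=
        mul_le_mul (hb t _) (pow_le_pow_left₀ (norm_nonneg _) h4 k) (by positivity)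
          ((norm_nonneg _).trans (hb t _))
    _ = _ := by ring

theorem comp_clm {f : T → V → F} (h : SymBound N M f) (L : V' →L[ℝ] V) :
    SymBound N (fun t z => M t (L z)) (fun t z => f t (L z)) := by
  simpa using h.comp_affine (fun _ => L) (fun _ => 0) (fun _ => le_rfl)

theorem fderiv (h : SymBound (N + 1) M f) : SymBound N M (fun t z => fderiv ℝ (f t) z) := by
  refine ⟨fun t => ((h.1 t).fderiv_right (m := ∞) (by simp)), fun k hk => ?_⟩
  obtain ⟨C, hC, hb⟩ := h.2 (k + 1) (by push_cast; gcongr)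
  refine ⟨C, hC, fun t z => ?_⟩
  rw [norm_iteratedFDeriv_fderiv]
  exact hb t z

theorem dir (h : SymBound ⊤ M f) (v : V) : SymBound ⊤ M (fun t z => _root_.fderiv ℝ (f t) z v) :=
  (SymBound.fderiv (N := ⊤) h).clm_comp (ContinuousLinearMap.apply ℝ F v)

theorem of_fderiv (hs : ∀ t, ContDiff ℝ ∞ (f t))
    (h0 : ∃ C : ℝ, 0 ≤ C ∧ ∀ t z, ‖f t z‖ ≤ C * M t z)
    (h : SymBound N M (fun t z => _root_.fderiv ℝ (f t) z)) : SymBound (N + 1) M f := by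
  refine ⟨hs, fun k hk => ?_⟩
  rcases k with _ | k
  · simpa using h0
  · obtain ⟨C, hC, hb⟩ := h.2 k (by
      push_cast at hk
      exact (ENat.add_le_add_iff_right (by simp)).1 hk)
    refine ⟨C, hC, fun t z => ?_⟩
    rw [← norm_iteratedFDeriv_fderiv]
    exact hb t z

theorem fderiv_of_dir {ι : Type*} [Fintype ι] (b : Module.Basis ι ℝ V) [FiniteDimensional ℝ V]
    (h : ∀ i, SymBound N M (fun t z => _root_.fderiv ℝ (f t) z (b i))) :
    SymBound N M (fun t z => _root_.fderiv ℝ (f t) z) := by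
  have h1 : SymBound N M (fun t z => ∑ i, ContinuousLinearMap.smulRightL ℝ V F
      (LinearMap.toContinuousLinearMap (b.coord i)) (_root_.fderiv ℝ (f t) z (b i))) :=
    sum _ fun i _ => (h i).clm_comp _
  refine h1.congr fun t z => ?_
  ext v
  simp only [ContinuousLinearMap.smulRightL_apply_apply, _root_.sum_apply,
    ContinuousLinearMap.smulRight_apply, LinearMap.coe_toContinuousLinearMap',
    Module.Basis.coord_apply]
  conv_lhs => rw [← b.sum_repr v, map_sum]
  simp only [map_smul]

/-- When the derivatives of f are bounded by f itself, the identity D(f^s) = s f^{s-1} Df raises the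
order by one, with weight f^{s-1} · f = f^s. The induction therefore runs over all exponents at
once. -/
theorem rpow {f : T → V → ℝ} (hpos : ∀ t z, 0 < f t z) (h : SymBound ⊤ f f) (s : ℝ) :
    SymBound ⊤ (fun t z => f t z ^ s) (fun t z => f t z ^ s) := by
  refine top_of_forall fun k => ?_
  have hs : ∀ (s : ℝ) t, ContDiff ℝ ∞ (fun z => f t z ^ s) := fun s t =>
    (h.1 t).rpow_const_of_ne fun z => (hpos t z).ne'
  have h0 : ∀ s : ℝ, ∃ C : ℝ, 0 ≤ C ∧ ∀ t z, ‖f t z ^ s‖ ≤ C * f t z ^ s := fun s =>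
    ⟨1, zero_le_one, fun t z => by
      rw [one_mul, Real.norm_of_nonneg (Real.rpow_nonneg (hpos t z).le _)]⟩
  induction k generalizing s with
  | zero =>
    refine ⟨hs s, fun k hk => ?_⟩
    obtain rfl : k = 0 := by simpa using hk
    simpa using h0 s
  | succ k ih =>
    push_cast
    refine of_fderiv (hs s) (h0 s) ?_
    have h1 := (((ih (s - 1)).const_mul s).smul
      ((SymBound.fderiv (N := ⊤) h).of_le (N' := k) le_top))
    refine (h1.congr fun t z => ?_).congr_weight fun t z => ?_
    · have := ((h.differentiable t z).hasFDerivAt.rpow_const (p := s) (Or.inl (hpos t z).ne'))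
      exact this.fderiv
    · rw [Real.rpow_sub_one (hpos t z).ne', div_mul_cancel₀ _ (hpos t z).ne']

end SymBound
end SymBoundBasics

/-! ### Commuting directional derivatives and multi-indices -/

section DirDeriv

variable {n : ℕ} {V V' F : Type*} [NormedAddCommGroup V] [NormedSpace ℝ V]
  [NormedAddCommGroup V'] [NormedSpace ℝ V'] [NormedAddCommGroup F] [NormedSpace ℝ F]

/-- The derivative of `f` in the direction `v`. -/
noncomputable def dirDeriv (v : V) (f : V → F) : V → F := fun z => fderiv ℝ f z v

/-- The iterated directional derivative along a family of directions. -/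
noncomputable def multiDirDeriv (e : Fin n → V) (α : Fin n → ℕ) (f : V → F) : V → F :=
  (List.finRange n).foldr (fun j g => (dirDeriv (e j))^[α j] g) f

theorem ContDiff.dirDeriv {f : V → F} (h : ContDiff ℝ ∞ f) (v : V) :
    ContDiff ℝ ∞ (dirDeriv v f) :=
  (h.fderiv_right (m := ∞) (by simp)).clm_apply contDiff_const

theorem ContDiff.dirDeriv_iterate {f : V → F} (h : ContDiff ℝ ∞ f) (v : V) (k : ℕ) :
    ContDiff ℝ ∞ ((_root_.dirDeriv v)^[k] f) := by
  induction k with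
  | zero => exact h
  | succ k ih => rw [Function.iterate_succ_apply']; exact ih.dirDeriv v

theorem ContDiff.foldr_dirDeriv {f : V → F} (h : ContDiff ℝ ∞ f) (e : Fin n → V) (α : Fin n → ℕ)
    (l : List (Fin n)) :
    ContDiff ℝ ∞ (l.foldr (fun j g => (_root_.dirDeriv (e j))^[α j] g) f) := by
  induction l with
  | nil => exact h
  | cons j l ih => exact ih.dirDeriv_iterate _ _

theorem ContDiff.multiDirDeriv {f : V → F} (h : ContDiff ℝ ∞ f) (e : Fin n → V)
    (α : Fin n → ℕ) : ContDiff ℝ ∞ (multiDirDeriv e α f) := h.foldr_dirDeriv e α _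

theorem dirDeriv_comm {f : V → F} (h : ContDiff ℝ ∞ f) (v w : V) :
    dirDeriv v (dirDeriv w f) = dirDeriv w (dirDeriv v f) := by
  have hd : Differentiable ℝ (fderiv ℝ f) :=
    (h.fderiv_right (m := ∞) (by simp)).differentiable (by simp)
  have key : ∀ v w : V, ∀ z, dirDeriv v (dirDeriv w f) z = fderiv ℝ (fderiv ℝ f) z v w := by
    intro v w z
    unfold dirDeriv
    rw [fderiv_clm_apply (hd z) (differentiableAt_const _)]
    simp
  funext z
  rw [key, key]
  exact ((contDiff_infty.1 h 2).contDiffAt.isSymmSndFDerivAt (by simp)).eq v w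

theorem dirDeriv_iterate_comm {f : V → F} (h : ContDiff ℝ ∞ f) (v w : V) (k : ℕ) :
    dirDeriv v ((dirDeriv w)^[k] f) = (dirDeriv w)^[k] (dirDeriv v f) := by
  induction k with
  | zero => rfl
  | succ k ih =>
    rw [Function.iterate_succ_apply', Function.iterate_succ_apply',
      dirDeriv_comm (h.dirDeriv_iterate w k), ih]

theorem foldr_dirDeriv_comm {f : V → F} (h : ContDiff ℝ ∞ f) (v : V) (e : Fin n → V)
    (α : Fin n → ℕ) (l : List (Fin n)) :
    dirDeriv v (l.foldr (fun j g => (dirDeriv (e j))^[α j] g) f) =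
      l.foldr (fun j g => (dirDeriv (e j))^[α j] g) (dirDeriv v f) := by
  induction l with
  | nil => rfl
  | cons j l ih =>
    simp only [List.foldr_cons]
    rw [dirDeriv_iterate_comm (h.foldr_dirDeriv e α l), ih]

theorem dirDeriv_multiDirDeriv {f : V → F} (h : ContDiff ℝ ∞ f) (v : V) (e : Fin n → V)
    (α : Fin n → ℕ) : dirDeriv v (multiDirDeriv e α f) = multiDirDeriv e α (dirDeriv v f) :=
  foldr_dirDeriv_comm h v e α _

/-- Since directional derivatives of smooth functions commute, the additional derivative can be
moved innermost. This lets inductions replace f by one of its first derivatives. -/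
theorem multiDirDeriv_add_single {f : V → F} (h : ContDiff ℝ ∞ f) (e : Fin n → V)
    (α : Fin n → ℕ) (i : Fin n) :
    multiDirDeriv e (α + Pi.single i 1) f = multiDirDeriv e α (dirDeriv (e i) f) := by
  have hne : ∀ l : List (Fin n), i ∉ l →
      l.foldr (fun j g => (dirDeriv (e j))^[(α + Pi.single i 1 : Fin n → ℕ) j] g) f =
      l.foldr (fun j g => (dirDeriv (e j))^[α j] g) f := by
    intro l hl
    induction l with
    | nil => rfl
    | cons j l ih =>
      simp only [List.mem_cons, not_or] at hl
      simp only [List.foldr_cons]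
      rw [ih hl.2]
      simp [Ne.symm hl.1]
  have key : ∀ l : List (Fin n), l.Nodup → i ∈ l →
      l.foldr (fun j g => (dirDeriv (e j))^[(α + Pi.single i 1 : Fin n → ℕ) j] g) f =
      l.foldr (fun j g => (dirDeriv (e j))^[α j] g) (dirDeriv (e i) f) := by
    intro l hl hi
    induction l with
    | nil => simp at hi
    | cons j l ih =>
      rw [List.nodup_cons] at hl
      simp only [List.foldr_cons]
      by_cases hij : i = j
      · subst hij
        rw [hne l hl.1, ← foldr_dirDeriv_comm h]
        simp
      · rw [ih hl.2 (by simpa [hij] using hi)]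
        simp [Ne.symm hij]
  exact key _ (List.nodup_finRange n) (List.mem_finRange i)

theorem dirDeriv_comp_affine {f : V → F} (h : Differentiable ℝ f) (L : V' →L[ℝ] V) (a : V)
    (v : V') : dirDeriv v (fun z => f (L z + a)) = fun z => dirDeriv (L v) f (L z + a) := by
  funext z
  have h1 : HasFDerivAt (fun z => L z + a) L z := L.hasFDerivAt.add_const a
  have := (h (L z + a)).hasFDerivAt.comp z h1
  simp only [dirDeriv]
  rw [show (fun z => f (L z + a)) = f ∘ (fun z => L z + a) from rfl, this.fderiv]
  rfl

theorem multiDirDeriv_comp_affine {f : V → F} (h : ContDiff ℝ ∞ f) (L : V' →L[ℝ] V) (a : V)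
    (e : Fin n → V') (α : Fin n → ℕ) :
    multiDirDeriv e α (fun z => f (L z + a)) =
      fun z => multiDirDeriv (fun j => L (e j)) α f (L z + a) := by
  have hit : ∀ (j : Fin n) (k : ℕ) (g : V → F), ContDiff ℝ ∞ g →
      (dirDeriv (e j))^[k] (fun z => g (L z + a)) =
        fun z => (dirDeriv (L (e j)))^[k] g (L z + a) := by
    intro j k g hg
    induction k with
    | zero => rfl
    | succ k ih =>
      simp only [Function.iterate_succ_apply']
      rw [ih, dirDeriv_comp_affine ((hg.dirDeriv_iterate _ k).differentiable (by simp))]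
  unfold multiDirDeriv
  induction List.finRange n with
  | nil => rfl
  | cons j l ih =>
    simp only [List.foldr_cons]
    rw [ih, hit j _ _ (h.foldr_dirDeriv _ _ _)]

theorem multiDeriv_eq_multiDirDeriv (α : Fin n → ℕ) (f : EuclideanSpace ℝ (Fin n) → F) :
    multiDeriv α f = multiDirDeriv (fun j => EuclideanSpace.single j (1 : ℝ)) α f := rfl

theorem multiDirDeriv_zero (e : Fin n → V) (f : V → F) : multiDirDeriv e 0 f = f := by
  unfold multiDirDeriv
  induction List.finRange n with
  | nil => rfl
  | cons j l ih => simp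

end DirDeriv

/-! ### Weight functions: powers, gain of derivatives, temperance -/

/-- The properties of a weight function that the calculus with gain `ρ` rests on. -/
structure WeightBounds {n : ℕ} (Λ : EuclideanSpace ℝ (Fin n) → ℝ) (ρ : ℝ) : Prop where
  rho_pos : 0 < ρ
  pos : ∀ x, 0 < Λ x
  lower : ∃ c : ℝ, 0 < c ∧ ∀ x, c ≤ Λ x
  symBound : SymBound ⊤ (fun _ : Unit => Λ) (fun _ => Λ)
  symBound_dir : ∀ j, SymBound ⊤ (fun (_ : Unit) x => Λ x ^ (1 - ρ))
    (fun _ => dirDeriv (EuclideanSpace.single j (1 : ℝ)) Λ)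

theorem rpow_le_const_mul_rpow {c a b : ℝ} (hc : 0 < c) (hab : a ≤ b) :
    ∃ C : ℝ, 0 < C ∧ ∀ t, c ≤ t → t ^ a ≤ C * t ^ b := by
  refine ⟨c ^ (a - b), by positivity, fun t ht => ?_⟩
  have ht0 : 0 < t := hc.trans_le ht
  have h1 : t ^ (a - b) ≤ c ^ (a - b) := Real.rpow_le_rpow_of_nonpos hc ht (by linarith)
  calc t ^ a = t ^ (a - b) * t ^ b := by rw [← Real.rpow_add ht0]; ring_nf
    _ ≤ _ := by gcongr

section IsWeightToBounds

variable {n : ℕ} {Λ : EuclideanSpace ℝ (Fin n) → ℝ} {μ ρ : ℝ}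

/-- Each coordinate derivative of s obeys the same hypothesis with m lowered by ν. The induction on
the order then forgets this gain, which is allowed because Λ is bounded below. -/
theorem symBound_of_multiDirDeriv_le {ν c : ℝ} (hν : 0 ≤ ν) (hc : 0 < c) (hΛ : ∀ x, c ≤ Λ x)
    (k : ℕ) (m : ℝ) (s : EuclideanSpace ℝ (Fin n) → ℝ) (hs : ContDiff ℝ ∞ s)
    (h : ∀ α : Fin n → ℕ, ∃ C : ℝ, 0 < C ∧ ∀ x,
      |multiDirDeriv (fun j => EuclideanSpace.single j (1 : ℝ)) α s x| ≤
        C * Λ x ^ (m - ν * (∑ j, α j : ℕ))) :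
    SymBound k (fun (_ : Unit) x => Λ x ^ m) (fun _ => s) := by
  have h0 : ∃ C : ℝ, 0 ≤ C ∧ ∀ (_ : Unit) x, ‖s x‖ ≤ C * Λ x ^ m := by
    obtain ⟨C, hC, hb⟩ := h 0
    exact ⟨C, hC.le, fun _ x => by simpa [multiDirDeriv_zero] using hb x⟩
  induction k generalizing m s with
  | zero =>
    refine ⟨fun _ => hs, fun k hk => ?_⟩
    obtain rfl : k = 0 := by simpa using hk
    simpa using h0
  | succ k ih =>
    push_cast
    refine SymBound.of_fderiv (fun _ => hs) h0 ?_
    refine SymBound.fderiv_of_dir (EuclideanSpace.basisFun (Fin n) ℝ).toBasis fun i => ?_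
    obtain ⟨B, hB, hB'⟩ := rpow_le_const_mul_rpow (a := m - ν) (b := m) hc (by linarith)
    have h' : ∀ α : Fin n → ℕ, ∃ C : ℝ, 0 < C ∧ ∀ x,
        |multiDirDeriv (fun j => EuclideanSpace.single j (1 : ℝ)) α
          (dirDeriv (EuclideanSpace.single i 1) s) x| ≤
          C * Λ x ^ (m - ν - ν * (∑ j, α j : ℕ)) := by
      intro α
      obtain ⟨C, hC, hb⟩ := h (α + Pi.single i 1)
      refine ⟨C, hC, fun x => ?_⟩
      have := hb x
      rw [multiDirDeriv_add_single hs] at this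
      refine this.trans (le_of_eq ?_)
      congr 2
      simp [Finset.sum_add_distrib]
      ring
    have h0' : ∃ C : ℝ, 0 ≤ C ∧ ∀ (_ : Unit) x,
        ‖dirDeriv (EuclideanSpace.single i 1) s x‖ ≤ C * Λ x ^ (m - ν) := by
      obtain ⟨C, hC, hb⟩ := h' 0
      exact ⟨C, hC.le, fun _ x => by simpa [multiDirDeriv_zero] using hb x⟩
    have := (ih (m - ν) _ (hs.dirDeriv _) h' h0').mono hB.le
      (M' := fun _ x => Λ x ^ m) fun _ x => hB' _ (hΛ x)
    simp only [OrthonormalBasis.coe_toBasis, EuclideanSpace.basisFun_apply]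
    exact this

theorem IsWeight.weightBounds (hΛ : IsWeight Λ μ) (hρ : 0 < ρ) (hρμ : ρ ≤ 1 / μ) :
    WeightBounds Λ ρ := by
  obtain ⟨μ₀, μ₁, C₀, C₁, hμ₀, h01, h1μ, hC₀, -, hgr⟩ := hΛ.growth
  have hlow : ∀ x, C₀ ≤ Λ x := fun x => by
    refine le_trans ?_ (hgr x).1
    exact le_mul_of_one_le_right hC₀.le
      (Real.one_le_rpow (by linarith [norm_nonneg x]) hμ₀.le)
  have hd : ∀ α : Fin n → ℕ, ∃ C : ℝ, 0 < C ∧ ∀ x,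
      |multiDirDeriv (fun j => EuclideanSpace.single j (1 : ℝ)) α Λ x| ≤
        C * Λ x ^ (1 - 1 / μ * (∑ j, α j : ℕ)) := by
    intro α
    obtain ⟨C, hC, hb⟩ := hΛ.deriv_le α 0 (by simp)
    refine ⟨C, hC, fun x => ?_⟩
    have := hb x
    rwa [show multiPow x 0 = 1 by simp [multiPow], one_mul, add_zero] at this
  have hν : 0 ≤ 1 / μ := hρ.le.trans hρμ
  refine ⟨hρ, hΛ.pos, ⟨C₀, hC₀, hlow⟩, ?_, fun i => ?_⟩
  · refine SymBound.top_of_forall fun k => ?_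
    simpa using symBound_of_multiDirDeriv_le hν hC₀ hlow k 1 Λ hΛ.contDiff hd
  · refine SymBound.top_of_forall fun k => ?_
    obtain ⟨B, hB, hB'⟩ := rpow_le_const_mul_rpow (a := 1 - 1 / μ) (b := 1 - ρ) hC₀ (by linarith)
    refine (symBound_of_multiDirDeriv_le hν hC₀ hlow k (1 - 1 / μ) _
      (hΛ.contDiff.dirDeriv (EuclideanSpace.single i 1)) fun α => ?_).mono hB.le
      fun _ x => hB' _ (hlow x)
    obtain ⟨C, hC, hb⟩ := hd (α + Pi.single i 1)
    refine ⟨C, hC, fun x => ?_⟩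
    have := hb x
    rw [multiDirDeriv_add_single hΛ.contDiff] at this
    refine this.trans (le_of_eq ?_)
    congr 2
    simp [Finset.sum_add_distrib]
    ring

end IsWeightToBounds

namespace WeightBounds

variable {n : ℕ} {Λ : EuclideanSpace ℝ (Fin n) → ℝ} {ρ : ℝ}

theorem rpow_le (hΛ : WeightBounds Λ ρ) {a b : ℝ} (hab : a ≤ b) :
    ∃ C : ℝ, 0 < C ∧ ∀ x, Λ x ^ a ≤ C * Λ x ^ b := by
  obtain ⟨c, hc, hlow⟩ := hΛ.lower
  obtain ⟨C, hC, h⟩ := rpow_le_const_mul_rpow hc hab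
  exact ⟨C, hC, fun x => h _ (hlow x)⟩

theorem rpow_pos (hΛ : WeightBounds Λ ρ) (s : ℝ) (x) : 0 < Λ x ^ s := Real.rpow_pos_of_pos (hΛ.pos x) s

theorem contDiff (hΛ : WeightBounds Λ ρ) : ContDiff ℝ ∞ Λ := hΛ.symBound.contDiff ()

theorem contDiff_rpow (hΛ : WeightBounds Λ ρ) (s : ℝ) : ContDiff ℝ ∞ (fun x => Λ x ^ s) :=
  hΛ.contDiff.rpow_const_of_ne fun x => (hΛ.pos x).ne'

theorem symBound_rpow (hΛ : WeightBounds Λ ρ) {T : Type*} (s : ℝ) :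
    SymBound ⊤ (fun (_ : T) x => Λ x ^ s) (fun (_ : T) x => Λ x ^ s) :=
  (SymBound.rpow (fun _ => hΛ.pos) hΛ.symBound s).reparam fun _ => ()

/-- The chain rule gives s Λ^{s-1} ∂_jΛ, and ∂_jΛ has order 1 - ρ together with all its derivatives.
-/
theorem symBound_dir_rpow (hΛ : WeightBounds Λ ρ) {T : Type*} (s : ℝ) (j : Fin n) :
    SymBound ⊤ (fun (_ : T) x => Λ x ^ (s - ρ))
      (fun _ => dirDeriv (EuclideanSpace.single j (1 : ℝ)) (fun x => Λ x ^ s)) := by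
  refine ((((hΛ.symBound_rpow (T := T) (s - 1)).const_mul s).mul
    (hΛ.symBound_dir j |>.reparam fun _ => ())).congr fun t x => ?_).congr_weight fun t x => ?_
  · have := (hΛ.symBound.differentiable () x).hasFDerivAt.rpow_const (p := s)
      (Or.inl (hΛ.pos x).ne')
    simp only [dirDeriv, this.fderiv]
    simp
  · rw [← Real.rpow_add (hΛ.pos x)]
    ring_nf

/-- The first derivatives of Λ^ρ have order ρ - ρ = 0, so Λ^ρ is Lipschitz. The positive lower bound
of Λ turns the additive estimate into a multiplicative one. -/
theorem temperate_rho (hΛ : WeightBounds Λ ρ) :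
    ∃ C : ℝ, 0 < C ∧ ∀ x y, Λ x ^ ρ ≤ C * (Λ y ^ ρ * (1 + ‖x - y‖)) := by
  have h1 : SymBound ⊤ (fun (_ : Unit) _ => (1 : ℝ))
      (fun _ => fderiv ℝ (fun x => Λ x ^ ρ)) := by
    refine SymBound.fderiv_of_dir (EuclideanSpace.basisFun (Fin n) ℝ).toBasis fun i => ?_
    simp only [OrthonormalBasis.coe_toBasis, EuclideanSpace.basisFun_apply]
    have := hΛ.symBound_dir_rpow (T := Unit) ρ i
    simp only [sub_self, Real.rpow_zero] at this
    exact this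
  obtain ⟨B, hB, hb⟩ := h1.norm_le
  obtain ⟨c, hc, hlow⟩ := hΛ.lower
  have hcρ : 0 < c ^ ρ := by positivity
  refine ⟨1 + B / c ^ ρ, by positivity, fun x y => ?_⟩
  have h2 : ‖Λ x ^ ρ - Λ y ^ ρ‖ ≤ B * ‖x - y‖ := by
    refine Convex.norm_image_sub_le_of_norm_fderiv_le (𝕜 := ℝ) (s := Set.univ)
      (f := fun x => Λ x ^ ρ)
      (fun z _ => ((hΛ.contDiff_rpow ρ).differentiable (by simp)) z)
      (fun z _ => by simpa using hb () z) convex_univ (Set.mem_univ _) (Set.mem_univ _)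
  have h3 := (Real.norm_eq_abs _ ▸ h2)
  have h4 := (abs_le.1 h3).2
  have h5 : c ^ ρ ≤ Λ y ^ ρ := by
    have := hΛ.rho_pos.le
    gcongr
    exact hlow y
  have h6 : B ≤ B / c ^ ρ * Λ y ^ ρ := by
    rw [div_mul_eq_mul_div, le_div_iff₀ hcρ]
    gcongr
  have h7 : B * ‖x - y‖ ≤ B / c ^ ρ * Λ y ^ ρ * ‖x - y‖ := by gcongr
  have h8 : 0 ≤ Λ y ^ ρ * ‖x - y‖ := mul_nonneg (hΛ.rpow_pos _ _).le (norm_nonneg _)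
  have h9 : 0 ≤ B / c ^ ρ * Λ y ^ ρ := hB.trans h6
  nlinarith

/-- For s ≥ 0 this is the Lipschitz comparison of Λ^ρ raised to the power s/ρ. For s ≤ 0 the roles
of x and y are exchanged and reciprocals taken. -/
theorem temperate (hΛ : WeightBounds Λ ρ) (s : ℝ) :
    ∃ (C : ℝ) (K : ℕ), 0 < C ∧ ∀ x y, Λ x ^ s ≤ C * (Λ y ^ s * (1 + ‖x - y‖) ^ K) := by
  obtain ⟨C, hC, h⟩ := hΛ.temperate_rho
  have hρ := hΛ.rho_pos
  have key : ∀ r : ℝ, 0 ≤ r → ∀ x y, (Λ x ^ ρ) ^ r ≤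
      C ^ r * ((Λ y ^ ρ) ^ r * (1 + ‖x - y‖) ^ ⌈r⌉₊) := by
    intro r hr x y
    have h1 : (1 : ℝ) ≤ 1 + ‖x - y‖ := by linarith [norm_nonneg (x - y)]
    calc (Λ x ^ ρ) ^ r ≤ (C * (Λ y ^ ρ * (1 + ‖x - y‖))) ^ r :=
          Real.rpow_le_rpow (hΛ.rpow_pos _ _).le (h x y) hr
      _ = C ^ r * ((Λ y ^ ρ) ^ r * (1 + ‖x - y‖) ^ r) := by
          have := (hΛ.rpow_pos ρ y).le
          rw [Real.mul_rpow hC.le (by positivity), Real.mul_rpow this (by positivity)]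
      _ ≤ _ := by
          have := (hΛ.rpow_pos ρ y).le
          gcongr
          rw [← Real.rpow_natCast]
          exact Real.rpow_le_rpow_of_exponent_le h1 (Nat.le_ceil r)
  rcases le_total 0 s with hs | hs
  · refine ⟨C ^ (s / ρ), ⌈s / ρ⌉₊, by positivity, fun x y => ?_⟩
    have := key (s / ρ) (by positivity) x y
    rwa [← Real.rpow_mul (hΛ.pos x).le, ← Real.rpow_mul (hΛ.pos y).le,
      mul_div_cancel₀ _ hρ.ne'] at this
  · refine ⟨C ^ (-s / ρ), ⌈-s / ρ⌉₊, by positivity, fun x y => ?_⟩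
    have := key (-s / ρ) (div_nonneg (by linarith) hρ.le) y x
    rw [← Real.rpow_mul (hΛ.pos x).le, ← Real.rpow_mul (hΛ.pos y).le,
      mul_div_cancel₀ _ hρ.ne', norm_sub_rev] at this
    have hx := hΛ.rpow_pos s x
    have hy := hΛ.rpow_pos s y
    rw [Real.rpow_neg (hΛ.pos x).le, Real.rpow_neg (hΛ.pos y).le, inv_le_iff_one_le_mul₀ hy] at this
    generalize C ^ (-s / ρ) = A at *
    generalize (1 + ‖x - y‖) ^ ⌈-s / ρ⌉₊ = B at *
    calc Λ x ^ s = Λ x ^ s * 1 := (mul_one _).symm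
      _ ≤ Λ x ^ s * (A * ((Λ x ^ s)⁻¹ * B) * Λ y ^ s) := by gcongr
      _ = _ := by field_simp

theorem growth (hΛ : WeightBounds Λ ρ) (s : ℝ) :
    ∃ (C : ℝ) (K : ℕ), 0 < C ∧ ∀ x, Λ x ^ s ≤ C * (1 + ‖x‖) ^ K := by
  obtain ⟨C, K, hC, h⟩ := hΛ.temperate s
  have := hΛ.rpow_pos s 0
  refine ⟨C * Λ 0 ^ s, K, by positivity, fun x => ?_⟩
  simpa [mul_assoc] using h x 0

theorem growth_rho (hΛ : WeightBounds Λ ρ) :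
    ∃ C : ℝ, 0 < C ∧ ∀ x, Λ x ^ ρ ≤ C * (1 + ‖x‖) := by
  obtain ⟨C, hC, h⟩ := hΛ.temperate_rho
  have := hΛ.rpow_pos ρ 0
  refine ⟨C * Λ 0 ^ ρ, by positivity, fun x => ?_⟩
  simpa [mul_assoc] using h x 0

theorem hasTemperateGrowth_rpow (hΛ : WeightBounds Λ ρ) (s : ℝ) :
    (fun x => Λ x ^ s).HasTemperateGrowth := by
  refine ⟨hΛ.contDiff_rpow s, fun k => ?_⟩
  obtain ⟨C, K, hC, h⟩ := hΛ.growth s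
  obtain ⟨C', hC', h'⟩ := (hΛ.symBound_rpow (T := Unit) s).2 k le_top
  refine ⟨K, C' * C, fun x => (h' () x).trans ?_⟩
  rw [mul_assoc]
  gcongr
  exact h x

end WeightBounds

/-! ### SG symbols on phase space -/

section SGClass

variable {n : ℕ} {T F : Type*} [NormedAddCommGroup F] [NormedSpace ℝ F]

/-- The unit vector in the direction of the position variable `x_j` in phase space. -/
noncomputable def posDir (j : Fin n) : EuclideanSpace ℝ (Fin n) × EuclideanSpace ℝ (Fin n) :=
  (EuclideanSpace.single j 1, 0)

/-- The unit vector in the direction of the frequency variable `ξ_j` in phase space. -/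
noncomputable def freqDir (j : Fin n) : EuclideanSpace ℝ (Fin n) × EuclideanSpace ℝ (Fin n) :=
  (0, EuclideanSpace.single j 1)

/-- The weight `Λ(x)^{m₂} Λ(ξ)^{m₁}` on phase space. -/
noncomputable def phaseWeight (Λ : EuclideanSpace ℝ (Fin n) → ℝ) (m₁ m₂ : ℝ)
    (z : EuclideanSpace ℝ (Fin n) × EuclideanSpace ℝ (Fin n)) : ℝ :=
  Λ z.1 ^ m₂ * Λ z.2 ^ m₁

/-- A bounded family of symbols of order `(m₁, m₂)`: every derivative obeys the bound of the order,
and one derivative in `x`, one in `ξ`, or one in each improves the order by `ρ`. -/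
structure SGFamily (Λ : EuclideanSpace ℝ (Fin n) → ℝ) (ρ m₁ m₂ : ℝ)
    (f : T → EuclideanSpace ℝ (Fin n) × EuclideanSpace ℝ (Fin n) → F) : Prop where
  base : SymBound ⊤ (fun _ => phaseWeight Λ m₁ m₂) f
  pos : ∀ j, SymBound ⊤ (fun _ => phaseWeight Λ m₁ (m₂ - ρ)) (fun t => dirDeriv (posDir j) (f t))
  freq : ∀ j, SymBound ⊤ (fun _ => phaseWeight Λ (m₁ - ρ) m₂) (fun t => dirDeriv (freqDir j) (f t))
  mixed : ∀ j, SymBound ⊤ (fun _ => phaseWeight Λ (m₁ - ρ) (m₂ - ρ))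
    (fun t => dirDeriv (posDir j) (dirDeriv (freqDir j) (f t)))

variable {Λ : EuclideanSpace ℝ (Fin n) → ℝ} {ρ m₁ m₂ : ℝ}

theorem phaseWeight_pos (hΛ : WeightBounds Λ ρ) (m₁ m₂ : ℝ) (z) : 0 < phaseWeight Λ m₁ m₂ z :=
  mul_pos (hΛ.rpow_pos _ _) (hΛ.rpow_pos _ _)

theorem phaseWeight_mul (hΛ : WeightBounds Λ ρ) (m₁ m₂ k₁ k₂ : ℝ) (z) :
    phaseWeight Λ m₁ m₂ z * phaseWeight Λ k₁ k₂ z = phaseWeight Λ (m₁ + k₁) (m₂ + k₂) z := by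
  simp only [phaseWeight, Real.rpow_add (hΛ.pos _)]
  ring

theorem phaseWeight_rpow (hΛ : WeightBounds Λ ρ) (m₁ m₂ s : ℝ) (z) :
    phaseWeight Λ m₁ m₂ z ^ s = phaseWeight Λ (m₁ * s) (m₂ * s) z := by
  simp only [phaseWeight]
  rw [Real.mul_rpow (hΛ.rpow_pos _ _).le (hΛ.rpow_pos _ _).le, Real.rpow_mul (hΛ.pos _).le,
    Real.rpow_mul (hΛ.pos _).le]

theorem phaseWeight_le (hΛ : WeightBounds Λ ρ) {m₁ m₂ k₁ k₂ : ℝ} (h₁ : m₁ ≤ k₁) (h₂ : m₂ ≤ k₂) :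
    ∃ C : ℝ, 0 < C ∧ ∀ z, phaseWeight Λ m₁ m₂ z ≤ C * phaseWeight Λ k₁ k₂ z := by
  obtain ⟨C, hC, h⟩ := hΛ.rpow_le h₁
  obtain ⟨C', hC', h'⟩ := hΛ.rpow_le h₂
  refine ⟨C' * C, by positivity, fun z => ?_⟩
  have := (hΛ.rpow_pos m₁ z.2).le
  have := (hΛ.rpow_pos k₂ z.1).le
  calc phaseWeight Λ m₁ m₂ z ≤ (C' * Λ z.1 ^ k₂) * (C * Λ z.2 ^ k₁) := by
        unfold phaseWeight
        gcongr
        · exact h' _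
        · exact h _
    _ = _ := by unfold phaseWeight; ring

/-- The symbol estimates of all orders. -/
def SGEstimates (Λ : EuclideanSpace ℝ (Fin n) → ℝ) (ρ m₁ m₂ : ℝ)
    (s : EuclideanSpace ℝ (Fin n) × EuclideanSpace ℝ (Fin n) → F) : Prop :=
  ContDiff ℝ ∞ s ∧ ∀ α β : Fin n → ℕ, ∃ C : ℝ, 0 < C ∧ ∀ z,
    ‖multiDirDeriv posDir α (multiDirDeriv freqDir β s) z‖ ≤
      C * phaseWeight Λ (m₁ - ρ * (∑ j, β j : ℕ)) (m₂ - ρ * (∑ j, α j : ℕ)) z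

/-- The slices y ↦ (y, ξ) and ξ ↦ (x, ξ) are affine, so partial derivatives on slices are
directional derivatives on phase space. -/
theorem IsSGSymbolS.sgEstimates
    {σ : EuclideanSpace ℝ (Fin n) → EuclideanSpace ℝ (Fin n) → ℂ}
    (h : IsSGSymbolS Λ ρ m₁ m₂ σ) : SGEstimates Λ ρ m₁ m₂ (Function.uncurry σ) := by
  refine ⟨h.contDiff, fun α β => ?_⟩
  obtain ⟨C, hC, hb⟩ := h.deriv_le α β
  refine ⟨C, hC, fun z => ?_⟩
  have h1 : ∀ y ξ, multiDeriv β (σ y) ξ =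
      multiDirDeriv freqDir β (Function.uncurry σ) (y, ξ) := by
    intro y ξ
    have := multiDirDeriv_comp_affine h.contDiff
      (ContinuousLinearMap.inr ℝ (EuclideanSpace ℝ (Fin n)) (EuclideanSpace ℝ (Fin n))) (y, 0)
      (fun j => EuclideanSpace.single j (1 : ℝ)) β
    have h2 := congrFun this ξ
    simp only [ContinuousLinearMap.inr_apply, Prod.mk_add_mk, zero_add, add_zero,
      Function.uncurry_apply_pair] at h2
    exact h2
  have h2 : ∀ y ξ, multiDeriv α (fun y => multiDeriv β (σ y) ξ) y =
      multiDirDeriv posDir α (multiDirDeriv freqDir β (Function.uncurry σ)) (y, ξ) := by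
    intro y ξ
    have := multiDirDeriv_comp_affine (h.contDiff.multiDirDeriv freqDir β)
      (ContinuousLinearMap.inl ℝ (EuclideanSpace ℝ (Fin n)) (EuclideanSpace ℝ (Fin n))) (0, ξ)
      (fun j => EuclideanSpace.single j (1 : ℝ)) α
    simp only [h1]
    have h3 := congrFun this y
    simp only [ContinuousLinearMap.inl_apply, Prod.mk_add_mk, zero_add, add_zero] at h3
    exact h3
  rw [← h2 z.1 z.2]
  refine (hb z.1 z.2).trans (le_of_eq ?_)
  unfold phaseWeight
  ring

namespace SGEstimates

variable {s : EuclideanSpace ℝ (Fin n) × EuclideanSpace ℝ (Fin n) → F}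

theorem pos (h : SGEstimates Λ ρ m₁ m₂ s) (i : Fin n) :
    SGEstimates Λ ρ m₁ (m₂ - ρ) (dirDeriv (posDir i) s) := by
  refine ⟨h.1.dirDeriv _, fun α β => ?_⟩
  obtain ⟨C, hC, hb⟩ := h.2 (α + Pi.single i 1) β
  refine ⟨C, hC, fun z => ?_⟩
  have := hb z
  rw [multiDirDeriv_add_single (h.1.multiDirDeriv _ _), dirDeriv_multiDirDeriv h.1] at this
  refine this.trans (le_of_eq ?_)
  congr 2
  simp [Finset.sum_add_distrib]
  ring

theorem freq (h : SGEstimates Λ ρ m₁ m₂ s) (i : Fin n) :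
    SGEstimates Λ ρ (m₁ - ρ) m₂ (dirDeriv (freqDir i) s) := by
  refine ⟨h.1.dirDeriv _, fun α β => ?_⟩
  obtain ⟨C, hC, hb⟩ := h.2 α (β + Pi.single i 1)
  refine ⟨C, hC, fun z => ?_⟩
  have := hb z
  rw [multiDirDeriv_add_single h.1] at this
  refine this.trans (le_of_eq ?_)
  congr 2
  simp [Finset.sum_add_distrib]
  ring

theorem norm_le (h : SGEstimates Λ ρ m₁ m₂ s) :
    ∃ C : ℝ, 0 ≤ C ∧ ∀ (_ : T) z, ‖s z‖ ≤ C * phaseWeight Λ m₁ m₂ z := by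
  obtain ⟨C, hC, hb⟩ := h.2 0 0
  exact ⟨C, hC.le, fun _ z => by simpa [multiDirDeriv_zero] using hb z⟩

theorem symBound (hΛ : WeightBounds Λ ρ) (h : SGEstimates Λ ρ m₁ m₂ s) :
    SymBound ⊤ (fun _ : T => phaseWeight Λ m₁ m₂) (fun _ => s) := by
  refine SymBound.top_of_forall fun k => ?_
  induction k generalizing m₁ m₂ s with
  | zero =>
    refine ⟨fun _ => h.1, fun k hk => ?_⟩
    obtain rfl : k = 0 := by simpa using hk
    simpa using h.norm_le
  | succ k ih =>
    push_cast
    have hρ := hΛ.rho_pos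
    refine SymBound.of_fderiv (fun _ => h.1) h.norm_le ?_
    refine SymBound.fderiv_of_dir ((EuclideanSpace.basisFun (Fin n) ℝ).toBasis.prod
      (EuclideanSpace.basisFun (Fin n) ℝ).toBasis) fun i => ?_
    rcases i with i | i
    · obtain ⟨B, hB, hb⟩ := phaseWeight_le hΛ (le_refl m₁) (show m₂ - ρ ≤ m₂ by linarith)
      have := (ih (h.pos i)).mono hB.le (M' := fun _ => phaseWeight Λ m₁ m₂) fun _ z => hb z
      simp only [Module.Basis.prod_apply, OrthonormalBasis.coe_toBasis, Sum.elim_inl,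
        EuclideanSpace.basisFun_apply, Function.comp_apply, LinearMap.inl_apply]
      exact this
    · obtain ⟨B, hB, hb⟩ := phaseWeight_le hΛ (show m₁ - ρ ≤ m₁ by linarith) (le_refl m₂)
      have := (ih (h.freq i)).mono hB.le (M' := fun _ => phaseWeight Λ m₁ m₂) fun _ z => hb z
      simp only [Module.Basis.prod_apply, OrthonormalBasis.coe_toBasis, Sum.elim_inr,
        EuclideanSpace.basisFun_apply, Function.comp_apply, LinearMap.inr_apply]
      exact this

/-- A first derivative of a symbol is again a symbol, of order lowered by ρ in its variable; each of
the four bounds is the base bound for one such derivative. -/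
theorem sgFamily (hΛ : WeightBounds Λ ρ) (h : SGEstimates Λ ρ m₁ m₂ s) :
    SGFamily Λ ρ m₁ m₂ (fun _ : T => s) :=
  ⟨h.symBound hΛ, fun j => (h.pos j).symBound hΛ, fun j => (h.freq j).symBound hΛ,
    fun j => ((h.freq j).pos j).symBound hΛ⟩

end SGEstimates

theorem dirDeriv_comp_fst {V W : Type*} [NormedAddCommGroup V] [NormedSpace ℝ V]
    [NormedAddCommGroup W] [NormedSpace ℝ W] {f : V → F} (hf : Differentiable ℝ f) (v : V × W) :
    dirDeriv v (fun z : V × W => f z.1) = fun z => dirDeriv v.1 f z.1 := by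
  simpa using dirDeriv_comp_affine hf (ContinuousLinearMap.fst ℝ V W) 0 v

theorem dirDeriv_comp_snd {V W : Type*} [NormedAddCommGroup V] [NormedSpace ℝ V]
    [NormedAddCommGroup W] [NormedSpace ℝ W] {f : W → F} (hf : Differentiable ℝ f) (v : V × W) :
    dirDeriv v (fun z : V × W => f z.2) = fun z => dirDeriv v.2 f z.2 := by
  simpa using dirDeriv_comp_affine hf (ContinuousLinearMap.snd ℝ V W) 0 v

theorem dirDeriv_mul {V 𝕜 : Type*} [NormedAddCommGroup V] [NormedSpace ℝ V] [RCLike 𝕜]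
    {f g : V → 𝕜} (hf : Differentiable ℝ f) (hg : Differentiable ℝ g) (v : V) :
    dirDeriv v (fun z => f z * g z) = fun z => dirDeriv v f z * g z + f z * dirDeriv v g z := by
  funext z
  simp only [dirDeriv]
  rw [fderiv_fun_mul (hf z) (hg z)]
  simp
  ring

theorem dirDeriv_clm_comp {V G : Type*} [NormedAddCommGroup V] [NormedSpace ℝ V]
    [NormedAddCommGroup G] [NormedSpace ℝ G] {f : V → F} (hf : Differentiable ℝ f)
    (L : F →L[ℝ] G) (v : V) : dirDeriv v (fun z => L (f z)) = fun z => L (dirDeriv v f z) := by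
  funext z
  simp only [dirDeriv]
  have := L.hasFDerivAt.comp z (hf z).hasFDerivAt
  rw [show (fun z => L (f z)) = L ∘ f from rfl, this.fderiv]
  rfl

theorem dirDeriv_add {V : Type*} [NormedAddCommGroup V] [NormedSpace ℝ V] {f g : V → F}
    (hf : Differentiable ℝ f) (hg : Differentiable ℝ g) (v : V) :
    dirDeriv v (fun z => f z + g z) = fun z => dirDeriv v f z + dirDeriv v g z := by
  funext z
  simp only [dirDeriv]
  rw [fderiv_fun_add (hf z) (hg z)]
  simp

theorem dirDeriv_rpow {V : Type*} [NormedAddCommGroup V] [NormedSpace ℝ V] {f : V → ℝ}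
    (hf : Differentiable ℝ f) (hpos : ∀ z, 0 < f z) (s : ℝ) (v : V) :
    dirDeriv v (fun z => f z ^ s) = fun z => s * f z ^ (s - 1) * dirDeriv v f z := by
  funext z
  have := (hf z).hasFDerivAt.rpow_const (p := s) (Or.inl (hpos z).ne')
  simp only [dirDeriv, this.fderiv]
  simp

namespace SGFamily

variable {f g : T → EuclideanSpace ℝ (Fin n) × EuclideanSpace ℝ (Fin n) → F}

theorem clm_comp {G : Type*} [NormedAddCommGroup G] [NormedSpace ℝ G] (L : F →L[ℝ] G)
    (h : SGFamily Λ ρ m₁ m₂ f) : SGFamily Λ ρ m₁ m₂ (fun t z => L (f t z)) := by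
  have hd : ∀ t v, dirDeriv v (fun z => L (f t z)) = fun z => L (dirDeriv v (f t) z) := fun t v =>
    dirDeriv_clm_comp (h.base.differentiable t) L v
  refine ⟨h.base.clm_comp L, fun j => ?_, fun j => ?_, fun j => ?_⟩
  · simpa only [hd] using (h.pos j).clm_comp L
  · simpa only [hd] using (h.freq j).clm_comp L
  · simpa only [hd, dirDeriv_clm_comp ((h.freq j).differentiable _) L] using (h.mixed j).clm_comp L

theorem add (hf : SGFamily Λ ρ m₁ m₂ f) (hg : SGFamily Λ ρ m₁ m₂ g) :
    SGFamily Λ ρ m₁ m₂ (fun t z => f t z + g t z) := by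
  have hd : ∀ t v, dirDeriv v (fun z => f t z + g t z) =
      fun z => dirDeriv v (f t) z + dirDeriv v (g t) z := fun t v =>
    dirDeriv_add (hf.base.differentiable t) (hg.base.differentiable t) v
  refine ⟨hf.base.add hg.base, fun j => ?_, fun j => ?_, fun j => ?_⟩
  · simpa only [hd] using (hf.pos j).add (hg.pos j)
  · simpa only [hd] using (hf.freq j).add (hg.freq j)
  · simpa only [hd, dirDeriv_add ((hf.freq j).differentiable _) ((hg.freq j).differentiable _)]
      using (hf.mixed j).add (hg.mixed j)

theorem mono (hΛ : WeightBounds Λ ρ) {k₁ k₂ : ℝ} (h₁ : m₁ ≤ k₁) (h₂ : m₂ ≤ k₂)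
    (h : SGFamily Λ ρ m₁ m₂ f) : SGFamily Λ ρ k₁ k₂ f := by
  obtain ⟨C₁, hC₁, hb₁⟩ := phaseWeight_le hΛ h₁ h₂
  obtain ⟨C₂, hC₂, hb₂⟩ := phaseWeight_le hΛ h₁ (sub_le_sub_right h₂ ρ)
  obtain ⟨C₃, hC₃, hb₃⟩ := phaseWeight_le hΛ (sub_le_sub_right h₁ ρ) h₂
  obtain ⟨C₄, hC₄, hb₄⟩ := phaseWeight_le hΛ (sub_le_sub_right h₁ ρ) (sub_le_sub_right h₂ ρ)
  exact ⟨h.base.mono hC₁.le fun _ => hb₁, fun j => (h.pos j).mono hC₂.le fun _ => hb₂,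
    fun j => (h.freq j).mono hC₃.le fun _ => hb₃, fun j => (h.mixed j).mono hC₄.le fun _ => hb₄⟩

theorem phaseWeight (hΛ : WeightBounds Λ ρ) (m₁ m₂ : ℝ) :
    SGFamily Λ ρ m₁ m₂ (fun _ : T => phaseWeight Λ m₁ m₂) := by
  have hx := hΛ.symBound_rpow (T := T) m₂
  have hξ := hΛ.symBound_rpow (T := T) m₁
  have hx' := hΛ.symBound_dir_rpow (T := T) m₂
  have hξ' := hΛ.symBound_dir_rpow (T := T) m₁
  have d : ∀ s : ℝ, Differentiable ℝ (fun x => Λ x ^ s) := fun s =>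
    (hΛ.contDiff_rpow s).differentiable (by simp)
  have d1 : ∀ s : ℝ, Differentiable ℝ
      (fun z : EuclideanSpace ℝ (Fin n) × EuclideanSpace ℝ (Fin n) => Λ z.1 ^ s) := fun s =>
    (d s).comp differentiable_fst
  have d2 : ∀ s : ℝ, Differentiable ℝ
      (fun z : EuclideanSpace ℝ (Fin n) × EuclideanSpace ℝ (Fin n) => Λ z.2 ^ s) := fun s =>
    (d s).comp differentiable_snd
  have e1 : ∀ j, dirDeriv (posDir j) (_root_.phaseWeight Λ m₁ m₂) = fun z =>
      dirDeriv (EuclideanSpace.single j (1 : ℝ)) (fun x => Λ x ^ m₂) z.1 * Λ z.2 ^ m₁ := by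
    intro j
    unfold _root_.phaseWeight
    rw [dirDeriv_mul (d1 _) (d2 _), dirDeriv_comp_fst (d _), dirDeriv_comp_snd (d _)]
    simp [posDir, dirDeriv]
  have e2 : ∀ j, dirDeriv (freqDir j) (_root_.phaseWeight Λ m₁ m₂) = fun z =>
      Λ z.1 ^ m₂ * dirDeriv (EuclideanSpace.single j (1 : ℝ)) (fun x => Λ x ^ m₁) z.2 := by
    intro j
    unfold _root_.phaseWeight
    rw [dirDeriv_mul (d1 _) (d2 _), dirDeriv_comp_fst (d _), dirDeriv_comp_snd (d _)]
    simp [freqDir, dirDeriv]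
  have e3 : ∀ j, dirDeriv (posDir j) (dirDeriv (freqDir j) (_root_.phaseWeight Λ m₁ m₂)) = fun z =>
      dirDeriv (EuclideanSpace.single j (1 : ℝ)) (fun x => Λ x ^ m₂) z.1 *
        dirDeriv (EuclideanSpace.single j (1 : ℝ)) (fun x => Λ x ^ m₁) z.2 := by
    intro j
    have d3 : Differentiable ℝ (dirDeriv (EuclideanSpace.single j (1 : ℝ)) (fun x => Λ x ^ m₁)) :=
      ((hΛ.contDiff_rpow m₁).dirDeriv _).differentiable (by simp)
    have d4 : Differentiable ℝ (fun z : EuclideanSpace ℝ (Fin n) × EuclideanSpace ℝ (Fin n) =>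
        dirDeriv (EuclideanSpace.single j (1 : ℝ)) (fun x => Λ x ^ m₁) z.2) :=
      d3.comp differentiable_snd
    rw [e2, dirDeriv_mul (d1 _) d4, dirDeriv_comp_fst (d _),
      dirDeriv_comp_snd d3]
    simp [posDir, dirDeriv]
  refine ⟨?_, fun j => ?_, fun j => ?_, fun j => ?_⟩
  · exact (hx.comp_clm (ContinuousLinearMap.fst ℝ _ (EuclideanSpace ℝ (Fin n)))).mul
      (hξ.comp_clm (ContinuousLinearMap.snd ℝ (EuclideanSpace ℝ (Fin n)) _))
  · simp only [e1]
    exact ((hx' j).comp_clm (ContinuousLinearMap.fst ℝ _ (EuclideanSpace ℝ (Fin n)))).mul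
      (hξ.comp_clm (ContinuousLinearMap.snd ℝ (EuclideanSpace ℝ (Fin n)) _))
  · simp only [e2]
    exact (hx.comp_clm (ContinuousLinearMap.fst ℝ _ (EuclideanSpace ℝ (Fin n)))).mul
      ((hξ' j).comp_clm (ContinuousLinearMap.snd ℝ (EuclideanSpace ℝ (Fin n)) _))
  · simp only [e3]
    exact ((hx' j).comp_clm (ContinuousLinearMap.fst ℝ _ (EuclideanSpace ℝ (Fin n)))).mul
      ((hξ' j).comp_clm (ContinuousLinearMap.snd ℝ (EuclideanSpace ℝ (Fin n)) _))

/-- Ellipticity makes f comparable with its weight in both directions, so derivatives of f are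
bounded by f, and powers of f have the expected order for either sign of the exponent. The first and
mixed derivatives of f^s are then products whose orders add up correctly. The case s = 1/2 supplies
the square root in the main argument. -/
theorem rpow_of_elliptic (hΛ : WeightBounds Λ ρ)
    {f : T → EuclideanSpace ℝ (Fin n) × EuclideanSpace ℝ (Fin n) → ℝ}
    (h : SGFamily Λ ρ m₁ m₂ f) {c : ℝ} (hc : 0 < c)
    (hell : ∀ t z, c * _root_.phaseWeight Λ m₁ m₂ z ≤ f t z) (s : ℝ) :
    SGFamily Λ ρ (m₁ * s) (m₂ * s) (fun t z => f t z ^ s) := by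
  have hw := phaseWeight_pos hΛ (n := n)
  have hpos : ∀ t z, 0 < f t z := fun t z => (mul_pos hc (hw _ _ z)).trans_le (hell t z)
  obtain ⟨B, hB, hb⟩ := h.base.norm_le
  have hself : SymBound ⊤ f f := by
    refine h.base.mono (B := 1 / c) (by positivity) fun t z => ?_
    rw [div_mul_eq_mul_div, le_div_iff₀ hc, mul_comm, one_mul]
    exact hell t z
  have hpow : ∀ r : ℝ, SymBound ⊤ (fun _ => _root_.phaseWeight Λ (m₁ * r) (m₂ * r))
      (fun t z => f t z ^ r) := by
    intro r
    rcases le_total 0 r with hr | hr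
    · refine (SymBound.rpow hpos hself r).mono (B := B ^ r) (by positivity) fun t z => ?_
      rw [← phaseWeight_rpow hΛ, ← Real.mul_rpow hB (hw _ _ z).le]
      exact Real.rpow_le_rpow (hpos t z).le ((le_abs_self _).trans (hb t z)) hr
    · refine (SymBound.rpow hpos hself r).mono (B := c ^ r) (by positivity) fun t z => ?_
      rw [← phaseWeight_rpow hΛ, ← Real.mul_rpow hc.le (hw _ _ z).le]
      exact Real.rpow_le_rpow_of_nonpos (mul_pos hc (hw _ _ z)) (hell t z) hr
  have hd : ∀ r t v, dirDeriv v (fun z => f t z ^ r) = fun z =>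
      r * f t z ^ (r - 1) * dirDeriv v (f t) z := fun r t v =>
    dirDeriv_rpow (h.base.differentiable t) (hpos t) r v
  have hmix : ∀ t j, dirDeriv (posDir j) (dirDeriv (freqDir j) (fun z => f t z ^ s)) = fun z =>
      s * (s - 1) * (f t z ^ (s - 1 - 1) * dirDeriv (posDir j) (f t) z *
        dirDeriv (freqDir j) (f t) z) +
      s * (f t z ^ (s - 1) * dirDeriv (posDir j) (dirDeriv (freqDir j) (f t)) z) := by
    intro t j
    rw [hd, dirDeriv_mul (((hpow (s - 1)).differentiable t).const_mul s)
      ((h.freq j).differentiable t)]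
    have : dirDeriv (posDir j) (fun z => s * f t z ^ (s - 1)) = fun z =>
        s * dirDeriv (posDir j) (fun z => f t z ^ (s - 1)) z :=
      dirDeriv_clm_comp ((hpow (s - 1)).differentiable t) (ContinuousLinearMap.mul ℝ ℝ s) _
    rw [this, hd]
    funext z
    ring
  refine ⟨hpow s, fun j => ?_, fun j => ?_, fun j => ?_⟩
  · simp only [hd]
    refine ((((hpow (s - 1)).const_mul s).mul (h.pos j)).congr_weight fun t z => ?_)
    rw [phaseWeight_mul hΛ]
    ring_nf
  · simp only [hd]
    refine ((((hpow (s - 1)).const_mul s).mul (h.freq j)).congr_weight fun t z => ?_)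
    rw [phaseWeight_mul hΛ]
    ring_nf
  · simp only [hmix]
    refine SymBound.add (SymBound.const_mul _ ?_) (SymBound.const_mul _ ?_)
    · refine ((((hpow (s - 1 - 1)).mul (h.pos j)).mul (h.freq j)).congr_weight fun t z => ?_)
      rw [phaseWeight_mul hΛ, phaseWeight_mul hΛ]
      ring_nf
    · refine (((hpow (s - 1)).mul (h.mixed j)).congr_weight fun t z => ?_)
      rw [phaseWeight_mul hΛ]
      ring_nf

end SGFamily

end SGClass

/-! ### The Fourier transform with symmetric normalization -/

section FourierHat

open scoped FourierTransform SchwartzMap LineDeriv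

variable {n : ℕ}

/-- Multiplication by `2π` as an automorphism of `ℝⁿ`. -/
noncomputable def twoPiEquiv (n : ℕ) :
    EuclideanSpace ℝ (Fin n) ≃L[ℝ] EuclideanSpace ℝ (Fin n) :=
  ContinuousLinearEquiv.smulLeft (Units.mk0 (2 * Real.pi) (by positivity))

theorem twoPiEquiv_apply (x : EuclideanSpace ℝ (Fin n)) :
    twoPiEquiv n x = (2 * Real.pi) • x := rfl

theorem twoPiEquiv_symm_apply (x : EuclideanSpace ℝ (Fin n)) :
    (twoPiEquiv n).symm x = (2 * Real.pi)⁻¹ • x := rfl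

/-- The normalizing constant `(2π)^{-n/2}`. -/
noncomputable def fourierConst (n : ℕ) : ℝ := (2 * Real.pi) ^ (-(n : ℝ) / 2)

theorem fourierConst_pos (n : ℕ) : 0 < fourierConst n := by unfold fourierConst; positivity

theorem fourierConst_sq (n : ℕ) : fourierConst n ^ 2 * (2 * Real.pi) ^ n = 1 := by
  unfold fourierConst
  rw [← Real.rpow_natCast, ← Real.rpow_natCast, ← Real.rpow_mul (by positivity),
    ← Real.rpow_add (by positivity)]
  convert Real.rpow_zero _ using 2
  push_cast
  ring

/-- The Fourier transform with the symmetric normalization, on Schwartz functions. -/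
noncomputable def schwartzHat (f : 𝓢(EuclideanSpace ℝ (Fin n), ℂ)) :
    𝓢(EuclideanSpace ℝ (Fin n), ℂ) :=
  (fourierConst n : ℂ) •
    SchwartzMap.compCLMOfContinuousLinearEquiv ℂ (twoPiEquiv n).symm (𝓕 f)

theorem schwartzHat_apply (f : 𝓢(EuclideanSpace ℝ (Fin n), ℂ)) (ξ : EuclideanSpace ℝ (Fin n)) :
    schwartzHat f ξ = fourierConst n * 𝓕 f ((2 * Real.pi)⁻¹ • ξ) := by
  simp [schwartzHat, twoPiEquiv_symm_apply]

theorem schwartzHat_eq (f : 𝓢(EuclideanSpace ℝ (Fin n), ℂ)) :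
    ⇑(schwartzHat f) = fourierHat f := by
  funext ξ
  rw [schwartzHat_apply, SchwartzMap.fourier_coe, Real.fourier_eq']
  unfold fourierHat fourierConst
  congr 1
  refine integral_congr_ae (Filter.Eventually.of_forall fun x => ?_)
  simp only [smul_eq_mul]
  congr 2
  rw [inner_smul_right]
  push_cast
  field_simp

/-- The inverse of `schwartzHat`. -/
noncomputable def schwartzUnhat (f : 𝓢(EuclideanSpace ℝ (Fin n), ℂ)) :
    𝓢(EuclideanSpace ℝ (Fin n), ℂ) :=
  ((fourierConst n)⁻¹ : ℂ) •
    𝓕⁻ (SchwartzMap.compCLMOfContinuousLinearEquiv ℂ (twoPiEquiv n) f)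

theorem schwartzHat_unhat (f : 𝓢(EuclideanSpace ℝ (Fin n), ℂ)) :
    schwartzHat (schwartzUnhat f) = f := by
  ext ξ
  have h := fourierConst_pos n
  have h' : (fourierConst n : ℂ) ≠ 0 := by exact_mod_cast h.ne'
  rw [schwartzHat_apply, schwartzUnhat, FourierTransform.fourier_smul,
    FourierTransform.fourier_fourierInv_eq]
  have h2 : (2 * Real.pi) • ((2 * Real.pi)⁻¹ • ξ) = ξ := smul_inv_smul₀ (by positivity) ξ
  simp only [_root_.smul_apply, SchwartzMap.compCLMOfContinuousLinearEquiv_apply,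
    Function.comp_apply, twoPiEquiv_apply, h2, smul_eq_mul]
  field_simp

theorem integral_schwartzHat_inv (f : 𝓢(EuclideanSpace ℝ (Fin n), ℂ))
    (x : EuclideanSpace ℝ (Fin n)) :
    (fourierConst n : ℂ) * ∫ ξ, Complex.exp (Complex.I * (inner ℝ x ξ : ℝ)) * schwartzHat f ξ =
      f x := by
  have h1 : f x = 𝓕⁻ (𝓕 f) x := by rw [FourierTransform.fourierInv_fourier_eq]
  rw [h1, SchwartzMap.fourierInv_coe, Real.fourierInv_eq']
  have h2 := Measure.integral_comp_inv_smul_of_nonneg volume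
    (fun v : EuclideanSpace ℝ (Fin n) => Complex.exp (↑(2 * Real.pi * inner ℝ v x) * Complex.I) •
      𝓕 f v) (R := 2 * Real.pi) (by positivity)
  have h3 := fourierConst_sq n
  simp only [finrank_euclideanSpace, Fintype.card_fin] at h2
  simp only [schwartzHat_apply]
  have h4 : ∀ ξ : EuclideanSpace ℝ (Fin n), Complex.exp (Complex.I * (inner ℝ x ξ : ℝ)) *
      ((fourierConst n : ℂ) * 𝓕 f ((2 * Real.pi)⁻¹ • ξ)) = (fourierConst n : ℂ) *
      (Complex.exp (↑(2 * Real.pi * inner ℝ ((2 * Real.pi)⁻¹ • ξ) x) * Complex.I) •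
        𝓕 f ((2 * Real.pi)⁻¹ • ξ)) := by
    intro ξ
    rw [inner_smul_left, smul_eq_mul, real_inner_comm x ξ]
    have : 2 * Real.pi * ((starRingEnd ℝ) (2 * Real.pi)⁻¹ * inner ℝ x ξ) =
        inner ℝ x ξ := by
      simp only [conj_trivial]
      field_simp
    rw [this, mul_comm Complex.I]
    ring
  simp only [h4]
  rw [integral_const_mul, h2, ← mul_assoc, Complex.real_smul, ← mul_assoc]
  have h5 : (fourierConst n : ℂ) * fourierConst n * ((2 * Real.pi) ^ n : ℝ) = 1 := by
    rw [← sq]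
    exact_mod_cast h3
  rw [h5, one_mul]

theorem integral_norm_sq_schwartzHat (f : 𝓢(EuclideanSpace ℝ (Fin n), ℂ)) :
    ∫ ξ, ‖schwartzHat f ξ‖ ^ 2 = ∫ x, ‖f x‖ ^ 2 := by
  rw [← SchwartzMap.integral_norm_sq_fourier f]
  have h2 := Measure.integral_comp_inv_smul_of_nonneg volume
    (fun v : EuclideanSpace ℝ (Fin n) => ‖𝓕 f v‖ ^ 2) (R := 2 * Real.pi) (by positivity)
  simp only [finrank_euclideanSpace, Fintype.card_fin] at h2
  have h3 : ∀ ξ, ‖schwartzHat f ξ‖ ^ 2 = fourierConst n ^ 2 * ‖𝓕 f ((2 * Real.pi)⁻¹ • ξ)‖ ^ 2 := by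
    intro ξ
    rw [schwartzHat_apply, norm_mul, Complex.norm_real, mul_pow, Real.norm_eq_abs, sq_abs]
  rw [integral_congr_ae (Filter.Eventually.of_forall h3), integral_const_mul, h2, smul_eq_mul, ← mul_assoc, fourierConst_sq, one_mul]

theorem schwartzHat_translate (f : 𝓢(EuclideanSpace ℝ (Fin n), ℂ))
    (p ξ : EuclideanSpace ℝ (Fin n)) :
    schwartzHat (SchwartzMap.compSubConstCLM ℂ (-p) f) ξ =
      Complex.exp (Complex.I * (inner ℝ p ξ : ℝ)) * schwartzHat f ξ := by
  rw [schwartzHat_eq, schwartzHat_eq]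
  unfold fourierHat
  rw [mul_left_comm, ← integral_const_mul (Complex.exp (Complex.I * (inner ℝ p ξ : ℝ))),
    ← integral_add_right_eq_self
    (fun x => Complex.exp (Complex.I * (inner ℝ p ξ : ℝ)) * (Complex.exp (-(Complex.I *
      (inner ℝ x ξ : ℝ))) * f x)) p]
  congr 1
  refine integral_congr_ae (Filter.Eventually.of_forall fun x => ?_)
  simp only [SchwartzMap.compSubConstCLM_apply, sub_neg_eq_add]
  rw [← mul_assoc, ← Complex.exp_add, inner_add_left]
  congr 2
  push_cast
  ring

theorem schwartzHat_add (f g : 𝓢(EuclideanSpace ℝ (Fin n), ℂ)) :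
    schwartzHat (f + g) = schwartzHat f + schwartzHat g := by
  simp [schwartzHat, FourierTransform.fourier_add]

theorem schwartzHat_smul (c : ℂ) (f : 𝓢(EuclideanSpace ℝ (Fin n), ℂ)) :
    schwartzHat (c • f) = c • schwartzHat f := by
  rw [schwartzHat, FourierTransform.fourier_smul, map_smul, smul_comm]
  rfl

/-- `schwartzHat` as a linear map. -/
noncomputable def schwartzHatLM (n : ℕ) :
    𝓢(EuclideanSpace ℝ (Fin n), ℂ) →ₗ[ℂ] 𝓢(EuclideanSpace ℝ (Fin n), ℂ) where
  toFun := schwartzHat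
  map_add' := schwartzHat_add
  map_smul' := schwartzHat_smul

theorem dirDeriv_schwartzHat (f : 𝓢(EuclideanSpace ℝ (Fin n), ℂ)) (m : EuclideanSpace ℝ (Fin n)) :
    dirDeriv m (schwartzHat f) =
      schwartzHat ((-Complex.I) • SchwartzMap.smulLeftCLM ℂ (inner ℝ · m) f) := by
  funext ξ
  have h : dirDeriv m (schwartzHat f) ξ = ∂_{m} (schwartzHat f) ξ := rfl
  have h1 : ∂_{m} (schwartzHat f) = (fourierConst n : ℂ) • ∂_{m}
      (SchwartzMap.compCLMOfContinuousLinearEquiv ℂ (twoPiEquiv n).symm (𝓕 f)) :=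
    LineDeriv.lineDerivOp_smul m (fourierConst n : ℂ) _
  rw [h, h1, SchwartzMap.lineDerivOp_compCLMOfContinuousLinearEquiv, twoPiEquiv_symm_apply,
    LineDeriv.lineDerivOp_left_smul, SchwartzMap.lineDerivOp_fourier_eq, schwartzHat,
    FourierTransform.fourier_smul, FourierTransform.fourier_smul]
  simp only [map_smul, _root_.smul_apply, smul_eq_mul,
    SchwartzMap.compCLMOfContinuousLinearEquiv_apply, Function.comp_apply, Complex.real_smul]
  push_cast
  have := Real.pi_ne_zero
  have h2 : (Real.pi : ℂ) ≠ 0 := by exact_mod_cast this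
  field_simp

/-- Division by `1 + |y|²` on Schwartz functions. -/
noncomputable def bracketDiv (f : 𝓢(EuclideanSpace ℝ (Fin n), ℂ)) :
    𝓢(EuclideanSpace ℝ (Fin n), ℂ) :=
  SchwartzMap.smulLeftCLM ℂ (fun y => (1 + ‖y‖ ^ 2) ^ (-1 : ℝ)) f

theorem bracketDiv_apply (f : 𝓢(EuclideanSpace ℝ (Fin n), ℂ)) (y : EuclideanSpace ℝ (Fin n)) :
    bracketDiv f y = ((1 + ‖y‖ ^ 2)⁻¹ : ℝ) * f y := by
  rw [bracketDiv, SchwartzMap.smulLeftCLM_apply_apply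
    (Function.hasTemperateGrowth_one_add_norm_sq_rpow _ _), Real.rpow_neg_one, Complex.real_smul]

/-- Multiplication by y_j corresponds to i∂_j on the Fourier side, so f = (1 + |y|²) · f/(1 + |y|²)
becomes 1 - Δ applied to the transform of the quotient. This is how decay of f in y is bought by
frequency derivatives of an amplitude. -/
theorem schwartzHat_eq_sub_laplacian (f : 𝓢(EuclideanSpace ℝ (Fin n), ℂ))
    (ξ : EuclideanSpace ℝ (Fin n)) :
    schwartzHat f ξ = schwartzHat (bracketDiv f) ξ - ∑ j : Fin n,
      dirDeriv (EuclideanSpace.single j (1 : ℝ)) (dirDeriv (EuclideanSpace.single j (1 : ℝ))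
        (schwartzHat (bracketDiv f))) ξ := by
  simp only [dirDeriv_schwartzHat]
  have key : f = bracketDiv f - ∑ j : Fin n, (-Complex.I) •
      SchwartzMap.smulLeftCLM ℂ (inner ℝ · (EuclideanSpace.single j (1 : ℝ)))
        ((-Complex.I) • SchwartzMap.smulLeftCLM ℂ
          (inner ℝ · (EuclideanSpace.single j (1 : ℝ))) (bracketDiv f)) := by
    ext y
    have ht : ∀ (j : Fin n) (g : 𝓢(EuclideanSpace ℝ (Fin n), ℂ)) y, SchwartzMap.smulLeftCLM ℂ
        (inner ℝ · (EuclideanSpace.single j (1 : ℝ))) g y = y j • g y := fun j g y => by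
      rw [SchwartzMap.smulLeftCLM_apply_apply (by fun_prop), EuclideanSpace.inner_single_right]
      simp
    simp only [_root_.sub_apply, _root_.sum_apply, _root_.smul_apply, ht, bracketDiv_apply]
    have h1 : ∀ j : Fin n, -Complex.I • y j • -Complex.I • y j •
        ((((1 + ‖y‖ ^ 2)⁻¹ : ℝ) : ℂ) * f y) =
        ((-(y j ^ 2) : ℝ) : ℂ) * ((((1 + ‖y‖ ^ 2)⁻¹ : ℝ) : ℂ) * f y) := by
      intro j
      simp only [Complex.real_smul, smul_eq_mul]
      push_cast
      linear_combination ((y j : ℂ) ^ 2 * ((1 + (‖y‖ : ℂ) ^ 2)⁻¹ * f y)) * Complex.I_sq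
    simp only [h1]
    rw [← Finset.sum_mul, ← Complex.ofReal_sum, Finset.sum_neg_distrib]
    have h2 : ∑ j, y j ^ 2 = ‖y‖ ^ 2 := by rw [EuclideanSpace.norm_sq_eq]; simp
    rw [h2]
    have h3 : (1 + (‖y‖ : ℂ) ^ 2) ≠ 0 := by
      have : (0 : ℝ) < 1 + ‖y‖ ^ 2 := by positivity
      exact_mod_cast this.ne'
    push_cast
    field_simp
    ring
  have h := congrArg (schwartzHatLM n) key
  rw [map_sub, map_sum] at h
  have h2 := congrArg (fun g : 𝓢(EuclideanSpace ℝ (Fin n), ℂ) => g ξ) h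
  simp only [_root_.sub_apply, _root_.sum_apply] at h2
  exact h2

end FourierHat

/-! ### Plane waves and integration by parts -/

section IntegrationByParts

open scoped SchwartzMap

/-- Euclidean space of dimension `n`. -/
abbrev Eucl (n : ℕ) := EuclideanSpace ℝ (Fin n)

/-- The `j`-th standard basis vector. -/
noncomputable abbrev stdVec {n : ℕ} (j : Fin n) : Eucl n := EuclideanSpace.single j (1 : ℝ)

variable {n : ℕ} {V : Type*} [NormedAddCommGroup V] [NormedSpace ℝ V]

/-- The plane wave `e^{i x·ξ}`. -/
noncomputable def planeWave (x ξ : Eucl n) : ℂ := Complex.exp (Complex.I * (inner ℝ x ξ : ℝ))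

theorem norm_planeWave (x ξ : Eucl n) : ‖planeWave x ξ‖ = 1 := by
  rw [planeWave, mul_comm, Complex.norm_exp_ofReal_mul_I]

theorem planeWave_comm (x ξ : Eucl n) : planeWave x ξ = planeWave ξ x := by
  rw [planeWave, planeWave, real_inner_comm]

theorem planeWave_add_left (x y ξ : Eucl n) :
    planeWave (x + y) ξ = planeWave x ξ * planeWave y ξ := by
  simp only [planeWave, inner_add_left, ← Complex.exp_add]
  push_cast
  ring_nf

theorem planeWave_add_right (x ξ η : Eucl n) :
    planeWave x (ξ + η) = planeWave x ξ * planeWave x η := by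
  simp only [planeWave, inner_add_right, ← Complex.exp_add]
  push_cast
  ring_nf

theorem conj_planeWave (x ξ : Eucl n) : starRingEnd ℂ (planeWave x ξ) = planeWave (-x) ξ := by
  simp [planeWave, ← Complex.exp_conj]

theorem planeWave_sub_right (x ξ η : Eucl n) :
    planeWave x (ξ - η) = planeWave x ξ * planeWave (-x) η := by
  rw [sub_eq_add_neg, planeWave_add_right]
  simp [planeWave]

theorem hasFDerivAt_planeWave (x ξ : Eucl n) :
    HasFDerivAt (planeWave x)
      ((planeWave x ξ * Complex.I) • (Complex.ofRealCLM.comp (innerSL ℝ x))) ξ := by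
  have h1 : HasFDerivAt (fun ξ => ((inner ℝ x ξ : ℝ) : ℂ)) (Complex.ofRealCLM.comp (innerSL ℝ x)) ξ :=
    Complex.ofRealCLM.hasFDerivAt.comp ξ (innerSL ℝ x).hasFDerivAt
  have h2 := (h1.const_mul Complex.I).cexp
  rw [mul_smul]
  exact h2

theorem contDiff_planeWave (x : Eucl n) : ContDiff ℝ ∞ (planeWave x) := by
  unfold planeWave
  have : ContDiff ℝ ∞ (fun ξ : Eucl n => ((inner ℝ x ξ : ℝ) : ℂ)) :=
    Complex.ofRealCLM.contDiff.comp (innerSL ℝ x).contDiff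
  exact (contDiff_const.mul this).cexp

theorem continuous_planeWave_uncurry :
    Continuous (fun z : Eucl n × Eucl n => planeWave z.1 z.2) := by
  unfold planeWave
  fun_prop

theorem dirDeriv_planeWave (x v : Eucl n) :
    dirDeriv v (planeWave x) = fun ξ => Complex.I * (inner ℝ x v : ℝ) * planeWave x ξ := by
  funext ξ
  simp only [dirDeriv, (hasFDerivAt_planeWave x ξ).fderiv]
  simp
  ring

theorem hasTemperateGrowth_planeWave (x : Eucl n) : (planeWave x).HasTemperateGrowth := by
  have key : ∀ k : ℕ, SymBound k (fun (_ : Unit) (_ : Eucl n) => (1 : ℝ)) (fun _ => planeWave x) := by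
    have h0 : ∃ C : ℝ, 0 ≤ C ∧ ∀ (_ : Unit) (z : Eucl n), ‖planeWave x z‖ ≤ C * 1 :=
      ⟨1, zero_le_one, fun _ z => by simp [norm_planeWave]⟩
    intro k
    induction k with
    | zero =>
      refine ⟨fun _ => contDiff_planeWave x, fun k hk => ?_⟩
      obtain rfl : k = 0 := by simpa using hk
      simpa using h0
    | succ k ih =>
      push_cast
      refine SymBound.of_fderiv (fun _ => contDiff_planeWave x) h0 ?_
      have := ih.clm_comp ((ContinuousLinearMap.lsmul ℝ ℂ (E := Eucl n →L[ℝ] ℂ)).flip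
        (Complex.I • (Complex.ofRealCLM.comp (innerSL ℝ x))))
      refine this.congr fun t ξ => ?_
      rw [(hasFDerivAt_planeWave x ξ).fderiv]
      simp [smul_smul]
  refine ⟨contDiff_planeWave x, fun k => ?_⟩
  obtain ⟨C, -, h⟩ := (key k).2 k le_rfl
  exact ⟨0, C, fun z => by simpa using h () z⟩

theorem Function.HasTemperateGrowth.dirDeriv {F : Type*} [NormedAddCommGroup F] [NormedSpace ℝ F]
    {f : V → F} (h : f.HasTemperateGrowth) (v : V) : (dirDeriv v f).HasTemperateGrowth := by
  refine ⟨h.1.dirDeriv v, fun k => ?_⟩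
  obtain ⟨K, C, hC⟩ := h.2 (k + 1)
  refine ⟨K, ‖v‖ * C, fun x => ?_⟩
  refine (norm_iteratedFDeriv_clm_apply_const (f := fderiv ℝ f) (N := ∞)
    (h.1.fderiv_right (m := ∞) (by simp)).contDiffAt (mod_cast le_top)).trans ?_
  rw [norm_iteratedFDeriv_fderiv, mul_assoc]
  gcongr
  exact hC x

theorem SymBound.hasTemperateGrowth {T F : Type*} [NormedAddCommGroup F] [NormedSpace ℝ F]
    {M : T → V → ℝ} {f : T → V → F} (h : SymBound ⊤ M f) (t : T) {C : ℝ} {K : ℕ}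
    (hM : ∀ z, M t z ≤ C * (1 + ‖z‖) ^ K) : (f t).HasTemperateGrowth := by
  refine ⟨h.contDiff t, fun k => ?_⟩
  obtain ⟨C', hC', hb⟩ := h.2 k le_top
  refine ⟨K, C' * C, fun z => (hb t z).trans ?_⟩
  rw [mul_assoc]
  gcongr
  exact hM z

theorem integrable_temperate_mul_schwartz {F : Eucl n → ℂ} (hF : F.HasTemperateGrowth)
    (f : 𝓢(Eucl n, ℂ)) : Integrable (fun x => F x * f x) := by
  have := (SchwartzMap.smulLeftCLM ℂ F f).integrable (μ := volume)
  rw [SchwartzMap.smulLeftCLM_apply hF] at this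
  simpa using this

/-- The derivative of a Schwartz function in a direction. -/
noncomputable def schwartzDir (v : Eucl n) (f : 𝓢(Eucl n, ℂ)) : 𝓢(Eucl n, ℂ) :=
  LineDeriv.lineDerivOp v f

theorem schwartzDir_coe (v : Eucl n) (f : 𝓢(Eucl n, ℂ)) : ⇑(schwartzDir v f) = dirDeriv v f := rfl

theorem integral_temperate_mul_dirDeriv {F : Eucl n → ℂ} (hF : F.HasTemperateGrowth)
    (f : 𝓢(Eucl n, ℂ)) (v : Eucl n) :
    ∫ x, F x * dirDeriv v f x = -∫ x, dirDeriv v F x * f x := by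
  refine integral_mul_fderiv_eq_neg_fderiv_mul_of_integrable (v := v)
    (integrable_temperate_mul_schwartz (hF.dirDeriv v) f)
    (integrable_temperate_mul_schwartz hF (schwartzDir v f))
    (integrable_temperate_mul_schwartz hF f) (fun x _ => ?_) (fun x _ => f.differentiableAt)
  exact (hF.1.differentiable (by simp)) x

/-- The operator `1 - Δ` along a family of directions. -/
noncomputable def oneSubLap (e : Fin n → V) (f : V → ℂ) : V → ℂ :=
  fun z => f z - ∑ j, dirDeriv (e j) (dirDeriv (e j) f) z

theorem integral_temperate_mul_oneSubLap {F : Eucl n → ℂ} (hF : F.HasTemperateGrowth)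
    (f : 𝓢(Eucl n, ℂ)) (e : Fin n → Eucl n) :
    ∫ x, F x * oneSubLap e f x = ∫ x, oneSubLap e F x * f x := by
  have h1 : ∀ j, ∫ x, F x * dirDeriv (e j) (dirDeriv (e j) f) x =
      ∫ x, dirDeriv (e j) (dirDeriv (e j) F) x * f x := by
    intro j
    have := integral_temperate_mul_dirDeriv hF (schwartzDir (e j) f) (e j)
    rw [schwartzDir_coe] at this
    rw [this, integral_temperate_mul_dirDeriv (hF.dirDeriv _), neg_neg]
  have i1 : ∀ j, Integrable (fun x => F x * dirDeriv (e j) (dirDeriv (e j) f) x) := fun j =>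
    integrable_temperate_mul_schwartz hF (schwartzDir (e j) (schwartzDir (e j) f))
  have i2 : ∀ j, Integrable (fun x => dirDeriv (e j) (dirDeriv (e j) F) x * f x) := fun j =>
    integrable_temperate_mul_schwartz ((hF.dirDeriv _).dirDeriv _) f
  have i3 := integrable_temperate_mul_schwartz hF f
  simp only [oneSubLap, mul_sub, sub_mul, Finset.mul_sum, Finset.sum_mul]
  rw [integral_sub i3 (integrable_finsetSum _ fun j _ => i1 j),
    integral_sub i3 (integrable_finsetSum _ fun j _ => i2 j),
    integral_finsetSum _ fun j _ => i1 j, integral_finsetSum _ fun j _ => i2 j]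
  simp only [h1]

/-- The conjugation of `1 - Δ` by an exponential whose logarithmic derivatives are `c`. -/
noncomputable def conjLap (e : Fin n → V) (c : Fin n → V → ℂ) (f : V → ℂ) : V → ℂ :=
  fun z => f z - ∑ j, (dirDeriv (e j) (dirDeriv (e j) f) z + 2 * c j z * dirDeriv (e j) f z +
    c j z ^ 2 * f z)

/-- Moving ∂_j past e^{ix·ξ} turns it into ∂_j + i x_j; squaring and summing gives the conjugated
operator. -/
theorem oneSubLap_planeWave_mul (x : Eucl n) {F : Eucl n → ℂ} (hF : ContDiff ℝ ∞ F) :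
    oneSubLap stdVec (fun ξ => planeWave x ξ * F ξ) =
      fun ξ => planeWave x ξ * conjLap stdVec (fun j _ => Complex.I * x j) F ξ := by
  have hp : Differentiable ℝ (planeWave x) := (contDiff_planeWave x).differentiable (by simp)
  have key : ∀ (j : Fin n) (G : Eucl n → ℂ), ContDiff ℝ ∞ G →
      dirDeriv (stdVec j) (fun ξ => planeWave x ξ * G ξ) =
        fun ξ => planeWave x ξ * (dirDeriv (stdVec j) G ξ + Complex.I * x j * G ξ) := by
    intro j G hG
    rw [dirDeriv_mul hp (hG.differentiable (by simp)), dirDeriv_planeWave]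
    funext ξ
    simp only [EuclideanSpace.inner_single_right]
    simp
    ring
  funext ξ
  simp only [oneSubLap, conjLap]
  rw [mul_sub, Finset.mul_sum]
  congr 1
  refine Finset.sum_congr rfl fun j _ => ?_
  have hc : ContDiff ℝ ∞ (fun ξ => dirDeriv (stdVec j) F ξ + Complex.I * x j * F ξ) :=
    (hF.dirDeriv _).add (contDiff_const.mul hF)
  rw [key j F hF, key j _ hc]
  have h3 : dirDeriv (stdVec j) (fun ξ => dirDeriv (stdVec j) F ξ + Complex.I * x j * F ξ) =
      fun ξ => dirDeriv (stdVec j) (dirDeriv (stdVec j) F) ξ +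
        Complex.I * x j * dirDeriv (stdVec j) F ξ := by
    rw [dirDeriv_add ((hF.dirDeriv _).differentiable (by simp))
      ((contDiff_const.mul hF).differentiable (by simp))]
    have := dirDeriv_clm_comp (hF.differentiable (by simp))
      (ContinuousLinearMap.mul ℝ ℂ (Complex.I * x j)) (stdVec j)
    simp only [ContinuousLinearMap.mul_apply'] at this
    rw [this]
  rw [h3]
  ring

theorem integral_planeWave_mul_oneSubLap (x : Eucl n) {F : Eucl n → ℂ} (hF : F.HasTemperateGrowth)
    (f : 𝓢(Eucl n, ℂ)) :
    ∫ ξ, planeWave x ξ * F ξ * oneSubLap stdVec f ξ =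
      ∫ ξ, planeWave x ξ * conjLap stdVec (fun j _ => Complex.I * x j) F ξ * f ξ := by
  have h := integral_temperate_mul_oneSubLap ((hasTemperateGrowth_planeWave x).mul hF) f stdVec
  rw [show planeWave x * F = fun ξ => planeWave x ξ * F ξ from rfl,
    oneSubLap_planeWave_mul x hF.1] at h
  exact h

theorem schwartzHat_eq_oneSubLap (f : 𝓢(Eucl n, ℂ)) :
    ⇑(schwartzHat f) = oneSubLap stdVec (schwartzHat (bracketDiv f)) := by
  funext ξ
  exact schwartzHat_eq_sub_laplacian f ξ

end IntegrationByParts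

/-! ### Amplitudes decaying in position and their forms -/

section Amplitudes

open scoped SchwartzMap

variable {n : ℕ} {T : Type*}

/-- A family of amplitudes `A(x, ξ, η)` that decays rapidly in `x` along with all derivatives, and
is controlled by the weight `m` in the frequencies. -/
def DecayAmp (m : T → Eucl n × Eucl n → ℝ) (A : T → Eucl n × Eucl n × Eucl n → ℂ) : Prop :=
  ∀ L : ℕ, SymBound ⊤ (fun t z => ((1 + ‖z.1‖) ^ L)⁻¹ * m t z.2) A

/-- The frequency integral `∫∫ e^{i x·(ξ-η)} A(x,ξ,η) f(ξ) \overline{g(η)} dξ dη`. -/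
noncomputable def freqForm (A : Eucl n × Eucl n × Eucl n → ℂ) (f g : Eucl n → ℂ) (x : Eucl n) : ℂ :=
  ∫ q : Eucl n × Eucl n, planeWave x (q.1 - q.2) * A (x, q) * (f q.1 * starRingEnd ℂ (g q.2))

/-- The conjugate amplitude with its two frequencies exchanged. -/
def conjSwap (A : Eucl n × Eucl n × Eucl n → ℂ) (z : Eucl n × Eucl n × Eucl n) : ℂ :=
  starRingEnd ℂ (A (z.1, z.2.2, z.2.1))

theorem symBound_coord {W : Type*} [NormedAddCommGroup W] [NormedSpace ℝ W] (j : Fin n) :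
    SymBound ⊤ (fun (_ : T) (z : Eucl n × W) => 1 + ‖z.1‖) (fun _ z => ((z.1 j : ℝ) : ℂ)) := by
  have h := SymBound.of_fderiv (N := ⊤) (T := T) (M := fun _ (z : Eucl n × W) => 1 + ‖z.1‖)
    (f := fun _ => ⇑(Complex.ofRealCLM.comp ((EuclideanSpace.proj j).comp
      (ContinuousLinearMap.fst ℝ (Eucl n) W)))) (fun _ => ContinuousLinearMap.contDiff _)
    ⟨1, zero_le_one, fun _ z => ?_⟩ ?_
  · exact h
  · have := EuclideanSpace.norm_eq z.1
    simp only [ContinuousLinearMap.comp_apply, Complex.ofRealCLM_apply, Complex.norm_real, one_mul]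
    have h1 : ‖z.1 j‖ ≤ ‖z.1‖ := PiLp.norm_apply_le z.1 j
    calc _ = ‖z.1 j‖ := rfl
      _ ≤ _ := by linarith
  · simp only [ContinuousLinearMap.fderiv]
    exact (SymBound.const _).mono zero_le_one fun _ z => by simp

namespace DecayAmp

variable {m : T → Eucl n × Eucl n → ℝ} {A B : T → Eucl n × Eucl n × Eucl n → ℂ}

theorem contDiff (h : DecayAmp m A) (t : T) : ContDiff ℝ ∞ (A t) := (h 0).contDiff t

theorem add (hA : DecayAmp m A) (hB : DecayAmp m B) : DecayAmp m (fun t z => A t z + B t z) :=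
  fun L => (hA L).add (hB L)

theorem sub (hA : DecayAmp m A) (hB : DecayAmp m B) : DecayAmp m (fun t z => A t z - B t z) :=
  fun L => (hA L).sub (hB L)

theorem const_mul (hA : DecayAmp m A) (c : ℂ) : DecayAmp m (fun t z => c * A t z) :=
  fun L => (hA L).const_mul c

theorem sum {ι : Type*} (s : Finset ι) {A : ι → T → Eucl n × Eucl n × Eucl n → ℂ}
    (h : ∀ i ∈ s, DecayAmp m (A i)) : DecayAmp m (fun t z => ∑ i ∈ s, A i t z) :=
  fun L => SymBound.sum s fun i hi => h i hi L

theorem dir (hA : DecayAmp m A) (v : Eucl n × Eucl n × Eucl n) :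
    DecayAmp m (fun t => dirDeriv v (A t)) := fun L => (hA L).dir v

theorem coord_mul (hA : DecayAmp m A) (j : Fin n) :
    DecayAmp m (fun t z => ((z.1 j : ℝ) : ℂ) * A t z) := by
  intro L
  refine ((symBound_coord j).mul (hA (L + 1))).congr_weight fun t z => ?_
  have : (0 : ℝ) < 1 + ‖z.1‖ := by positivity
  field_simp
  ring

/-- The conjugated Laplacian multiplies by at most two coordinates of x, and rapid decay in x
absorbs them. Hence frequency integrations by parts stay in the class. -/
theorem conjLap (hA : DecayAmp m A) (e : Fin n → Eucl n × Eucl n × Eucl n) :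
    DecayAmp m (fun t => conjLap e (fun j z => Complex.I * ((z.1 j : ℝ) : ℂ)) (A t)) := by
  refine hA.sub (sum _ fun j _ => ?_)
  have h1 := (((hA.dir (e j)).dir (e j)).add
    (((hA.dir (e j)).coord_mul j).const_mul (2 * Complex.I))).sub ((hA.coord_mul j).coord_mul j)
  intro L
  refine (h1 L).congr fun t z => ?_
  linear_combination (((z.1 j : ℝ) : ℂ) ^ 2 * A t z) * Complex.I_sq

theorem oneSubLap (hA : DecayAmp m A) (e : Fin n → Eucl n × Eucl n × Eucl n) :
    DecayAmp m (fun t => oneSubLap e (A t)) :=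
  hA.sub (sum _ fun j _ => (hA.dir (e j)).dir (e j))

theorem conjSwap (hA : DecayAmp m A) (hm : ∀ t q, m t q.swap = m t q) :
    DecayAmp m (fun t => conjSwap (A t)) := by
  intro L
  have h1 := ((hA L).conj).comp_clm ((ContinuousLinearMap.fst ℝ (Eucl n) (Eucl n × Eucl n)).prod
    ((ContinuousLinearEquiv.prodComm ℝ (Eucl n) (Eucl n) : Eucl n × Eucl n →L[ℝ] _).comp
      (ContinuousLinearMap.snd ℝ (Eucl n) (Eucl n × Eucl n))))
  refine (h1.congr fun t z => rfl).congr_weight fun t z => ?_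
  rw [← hm t z.2]
  rfl

end DecayAmp

theorem dirDeriv_slice_left {A : Eucl n × Eucl n × Eucl n → ℂ} (hA : ContDiff ℝ ∞ A)
    (x η : Eucl n) (v : Eucl n) :
    dirDeriv v (fun ξ => A (x, ξ, η)) = fun ξ => dirDeriv (0, v, 0) A (x, ξ, η) := by
  have := dirDeriv_comp_affine (hA.differentiable (by simp))
    ((ContinuousLinearMap.inr ℝ (Eucl n) (Eucl n × Eucl n)).comp
      (ContinuousLinearMap.inl ℝ (Eucl n) (Eucl n))) (x, 0, η) v
  simpa using this

theorem dirDeriv_slice_pos {A : Eucl n × Eucl n × Eucl n → ℂ} (hA : ContDiff ℝ ∞ A)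
    (q : Eucl n × Eucl n) (v : Eucl n) :
    dirDeriv v (fun x => A (x, q)) = fun x => dirDeriv (v, 0) A (x, q) := by
  have := dirDeriv_comp_affine (hA.differentiable (by simp))
    (ContinuousLinearMap.inl ℝ (Eucl n) (Eucl n × Eucl n)) (0, q) v
  simpa using this

/-- The frequency direction `ξ_j`. -/
noncomputable def leftFreqDir (j : Fin n) : Eucl n × Eucl n × Eucl n := (0, stdVec j, 0)

/-- The position direction `x_j`. -/
noncomputable def posDir₃ (j : Fin n) : Eucl n × Eucl n × Eucl n := (stdVec j, 0)

theorem conjLap_slice_left {A : Eucl n × Eucl n × Eucl n → ℂ} (hA : ContDiff ℝ ∞ A)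
    (x ξ η : Eucl n) :
    conjLap stdVec (fun j _ => Complex.I * x j) (fun ξ => A (x, ξ, η)) ξ =
      conjLap leftFreqDir (fun j z => Complex.I * ((z.1 j : ℝ) : ℂ)) A (x, ξ, η) := by
  unfold conjLap
  simp only [dirDeriv_slice_left hA, dirDeriv_slice_left (hA.dirDeriv _), leftFreqDir]

theorem oneSubLap_slice_pos {A : Eucl n × Eucl n × Eucl n → ℂ} (hA : ContDiff ℝ ∞ A)
    (x : Eucl n) (q : Eucl n × Eucl n) :
    oneSubLap stdVec (fun x => A (x, q)) x = oneSubLap posDir₃ A (x, q) := by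
  unfold oneSubLap
  simp only [dirDeriv_slice_pos hA, dirDeriv_slice_pos (hA.dirDeriv _), posDir₃]

/-- The weight `m` has at most polynomial growth. -/
def PolyGrowth (m : Eucl n × Eucl n → ℝ) : Prop :=
  ∃ (C : ℝ) (K : ℕ), ∀ q, m q ≤ C * ((1 + ‖q.1‖) ^ K * (1 + ‖q.2‖) ^ K)

theorem integrable_weight_mul_schwartz (f : 𝓢(Eucl n, ℂ)) (K : ℕ) :
    Integrable (fun x => (1 + ‖x‖) ^ K * ‖f x‖) := by
  have h : ∀ x : Eucl n, (1 + ‖x‖) ^ K * ‖f x‖ =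
      ∑ i ∈ Finset.range (K + 1), (K.choose i : ℝ) * (‖x‖ ^ i * ‖f x‖) := by
    intro x
    rw [add_comm, add_pow, Finset.sum_mul]
    refine Finset.sum_congr rfl fun i _ => ?_
    simp
    ring
  simp only [h]
  exact integrable_finsetSum _ fun i _ => (f.integrable_pow_mul volume i).const_mul _

theorem integrable_freq {a : Eucl n × Eucl n → ℂ} (ha : Continuous a) {m : Eucl n × Eucl n → ℝ}
    (hm : PolyGrowth m) (hb : ∀ q, ‖a q‖ ≤ m q) (f g : 𝓢(Eucl n, ℂ)) :
    Integrable (fun q : Eucl n × Eucl n => a q * (f q.1 * starRingEnd ℂ (g q.2))) := by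
  obtain ⟨C, K, hC⟩ := hm
  have h1 := ((integrable_weight_mul_schwartz f K).mul_prod
    (integrable_weight_mul_schwartz g K)).const_mul C
  refine h1.mono' (Continuous.aestronglyMeasurable ?_) (Filter.Eventually.of_forall fun q => ?_)
  · exact ha.mul ((f.continuous.comp continuous_fst).mul
      (Complex.continuous_conj.comp (g.continuous.comp continuous_snd)))
  · rw [norm_mul, norm_mul, RCLike.norm_conj]
    calc _ ≤ (C * ((1 + ‖q.1‖) ^ K * (1 + ‖q.2‖) ^ K)) * (‖f q.1‖ * ‖g q.2‖) := by
          gcongr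
          exact (hb q).trans (hC q)
      _ = _ := by ring

/-- The exponent n + 1 is the least integer exceeding the dimension; it reappears wherever an
integrable majorant is needed. -/
theorem integrable_one_add_norm_inv (n : ℕ) :
    Integrable (fun x : Eucl n => ((1 + ‖x‖) ^ (n + 1))⁻¹) := by
  have := integrable_one_add_norm (E := Eucl n) (μ := volume) (r := (n + 1 : ℕ)) (by simp)
  refine this.congr (Filter.Eventually.of_forall fun x => ?_)
  simp only
  rw [Real.rpow_neg (by positivity), Real.rpow_natCast]

theorem integrable_freq_pos {A : Eucl n × Eucl n × Eucl n → ℂ} (hA : Continuous A)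
    {m : Eucl n × Eucl n → ℝ} (hm : PolyGrowth m)
    (hb : ∀ z, ‖A z‖ ≤ ((1 + ‖z.1‖) ^ (n + 1))⁻¹ * m z.2) (f g : 𝓢(Eucl n, ℂ)) :
    Integrable (fun z : Eucl n × Eucl n × Eucl n =>
      planeWave z.1 (z.2.1 - z.2.2) * A z * (f z.2.1 * starRingEnd ℂ (g z.2.2))) := by
  obtain ⟨C, K, hC⟩ := hm
  have h1 := (integrable_one_add_norm_inv n).mul_prod
    (((integrable_weight_mul_schwartz f K).mul_prod
    (integrable_weight_mul_schwartz g K)).const_mul C)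
  refine h1.mono' (Continuous.aestronglyMeasurable ?_) (Filter.Eventually.of_forall fun z => ?_)
  · refine (Continuous.mul ?_ hA).mul ((f.continuous.comp (by fun_prop)).mul
      (Complex.continuous_conj.comp (g.continuous.comp (by fun_prop))))
    exact continuous_planeWave_uncurry.comp
      (show Continuous (fun z : Eucl n × Eucl n × Eucl n => (z.1, z.2.1 - z.2.2)) by fun_prop)
  · rw [norm_mul, norm_mul, norm_mul, RCLike.norm_conj, norm_planeWave, one_mul]
    calc _ ≤ (((1 + ‖z.1‖) ^ (n + 1))⁻¹ * (C * ((1 + ‖z.2.1‖) ^ K * (1 + ‖z.2.2‖) ^ K))) *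
          (‖f z.2.1‖ * ‖g z.2.2‖) := by
          gcongr
          exact (hb z).trans (by gcongr; exact hC _)
      _ = _ := by ring

/-- This symmetry transfers every statement about the ξ variable to the η variable. -/
theorem conj_freqForm_conjSwap (A : Eucl n × Eucl n × Eucl n → ℂ) (f g : Eucl n → ℂ) (x : Eucl n) :
    starRingEnd ℂ (freqForm (conjSwap A) g f x) = freqForm A f g x := by
  unfold freqForm
  rw [← integral_conj]
  rw [Measure.volume_eq_prod, ← integral_prod_swap]
  refine integral_congr_ae (Filter.Eventually.of_forall fun q => ?_)
  simp only [map_mul, conj_planeWave, conjSwap, Complex.conj_conj, Prod.fst_swap, Prod.snd_swap]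
  have : planeWave (-x) (q.2 - q.1) = planeWave x (q.1 - q.2) := by
    rw [planeWave, planeWave, inner_neg_left, ← inner_neg_right, neg_sub]
  rw [this]
  ring

end Amplitudes

/-! ### L² bounds for amplitudes localized in position -/

section LocalBound

open scoped SchwartzMap

variable {n : ℕ} {T : Type*}

theorem DecayAmp.norm_le {m : T → Eucl n × Eucl n → ℝ} {A : T → Eucl n × Eucl n × Eucl n → ℂ}
    (h : DecayAmp m A) (L : ℕ) :
    ∃ C : ℝ, 0 ≤ C ∧ ∀ t z, ‖A t z‖ ≤ C * (((1 + ‖z.1‖) ^ L)⁻¹ * m t z.2) := (h L).norm_le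

theorem PolyGrowth.const_mul {m : Eucl n × Eucl n → ℝ} (h : PolyGrowth m) {c : ℝ} (hc : 0 ≤ c) :
    PolyGrowth (fun q => c * m q) := by
  obtain ⟨C, K, hC⟩ := h
  refine ⟨c * C, K, fun q => ?_⟩
  rw [mul_assoc]
  exact mul_le_mul_of_nonneg_left (hC q) hc

theorem DecayAmp.norm_le_zero {m : T → Eucl n × Eucl n → ℝ}
    {A : T → Eucl n × Eucl n × Eucl n → ℂ} (h : DecayAmp m A) :
    ∃ C : ℝ, 0 ≤ C ∧ ∀ t z, ‖A t z‖ ≤ C * m t z.2 := by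
  simpa using h.norm_le 0

theorem DecayAmp.integrable_freq {m : T → Eucl n × Eucl n → ℝ}
    {A : T → Eucl n × Eucl n × Eucl n → ℂ} (h : DecayAmp m A) (hm : ∀ t, PolyGrowth (m t))
    (t : T) (f g : 𝓢(Eucl n, ℂ)) (x : Eucl n) :
    Integrable (fun q : Eucl n × Eucl n =>
      planeWave x (q.1 - q.2) * A t (x, q) * (f q.1 * starRingEnd ℂ (g q.2))) := by
  obtain ⟨C, hC, hb⟩ := h.norm_le_zero
  refine _root_.integrable_freq (a := fun q => planeWave x (q.1 - q.2) * A t (x, q)) ?_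
    ((hm t).const_mul hC) (fun q => ?_) f g
  · refine Continuous.mul ?_ ((h.contDiff t).continuous.comp (by fun_prop))
    exact continuous_planeWave_uncurry.comp
      (show Continuous (fun q : Eucl n × Eucl n => (x, q.1 - q.2)) by fun_prop)
  · rw [norm_mul, norm_planeWave, one_mul]
    exact hb t (x, q)

theorem PolyGrowth.slice_left {m : Eucl n × Eucl n → ℝ} (h : PolyGrowth m) (η : Eucl n) :
    ∃ (C : ℝ) (K : ℕ), ∀ ξ, m (ξ, η) ≤ C * (1 + ‖ξ‖) ^ K := by
  obtain ⟨C, K, hC⟩ := h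
  refine ⟨C * (1 + ‖η‖) ^ K, K, fun ξ => (hC (ξ, η)).trans (le_of_eq ?_)⟩
  ring

theorem DecayAmp.hasTemperateGrowth_slice {m : T → Eucl n × Eucl n → ℝ}
    {A : T → Eucl n × Eucl n × Eucl n → ℂ} (h : DecayAmp m A) (hm : ∀ t, PolyGrowth (m t))
    (t : T) (x η : Eucl n) : (fun ξ => A t (x, ξ, η)).HasTemperateGrowth := by
  have h1 := (h 0).comp_affine (fun _ => (ContinuousLinearMap.inr ℝ (Eucl n) (Eucl n × Eucl n)).comp
      (ContinuousLinearMap.inl ℝ (Eucl n) (Eucl n))) (fun _ => (x, 0, η)) (fun _ => le_rfl)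
  obtain ⟨C, K, hC⟩ := (hm t).slice_left η
  have h2 := h1.hasTemperateGrowth t (C := C) (K := K) fun ξ => by simpa using hC ξ
  simpa using h2

theorem freqForm_schwartzHat_left {m : T → Eucl n × Eucl n → ℝ}
    {A : T → Eucl n × Eucl n × Eucl n → ℂ} (h : DecayAmp m A) (hm : ∀ t, PolyGrowth (m t))
    (t : T) (f g : 𝓢(Eucl n, ℂ)) (x : Eucl n) :
    freqForm (A t) (schwartzHat f) g x =
      freqForm (conjLap leftFreqDir (fun j z => Complex.I * ((z.1 j : ℝ) : ℂ)) (A t))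
        (schwartzHat (bracketDiv f)) g x := by
  unfold freqForm
  rw [Measure.volume_eq_prod, integral_prod_symm _ (h.integrable_freq hm t (schwartzHat f) g x),
    integral_prod_symm _ ((h.conjLap leftFreqDir).integrable_freq hm t
      (schwartzHat (bracketDiv f)) g x)]
  refine integral_congr_ae (Filter.Eventually.of_forall fun η => ?_)
  have h1 := integral_planeWave_mul_oneSubLap x (h.hasTemperateGrowth_slice hm t x η)
    (schwartzHat (bracketDiv f))
  rw [← schwartzHat_eq_oneSubLap] at h1
  have h2 := congrArg (fun w => planeWave (-x) η * starRingEnd ℂ (g η) * w) h1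
  simp only [← integral_const_mul] at h2
  refine (integral_congr_ae (Filter.Eventually.of_forall fun ξ => ?_)).trans
    (h2.trans (integral_congr_ae (Filter.Eventually.of_forall fun ξ => ?_)))
  · simp only [planeWave_sub_right]
    ring
  · simp only [planeWave_sub_right, conjLap_slice_left (h.contDiff t)]
    ring

/-- Each round integrates by parts once in ξ and, after `conjSwap`, once in η. Symmetry of the
weight is what keeps the swapped amplitude in the same class. -/
theorem exists_freqForm_schwartzHat_iterate {m : T → Eucl n × Eucl n → ℝ}
    {A : T → Eucl n × Eucl n × Eucl n → ℂ} (h : DecayAmp m A) (hm : ∀ t, PolyGrowth (m t))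
    (hsymm : ∀ t q, m t q.swap = m t q) (N : ℕ) :
    ∃ B : T → Eucl n × Eucl n × Eucl n → ℂ, DecayAmp m B ∧ ∀ t (f g : 𝓢(Eucl n, ℂ)) x,
      freqForm (A t) (schwartzHat f) (schwartzHat g) x =
        freqForm (B t) (schwartzHat (bracketDiv^[N] f)) (schwartzHat (bracketDiv^[N] g)) x := by
  induction N with
  | zero => exact ⟨A, h, fun _ _ _ _ => rfl⟩
  | succ N ih =>
    obtain ⟨B, hB, hBeq⟩ := ih
    refine ⟨_, (((hB.conjLap leftFreqDir).conjSwap hsymm).conjLap leftFreqDir).conjSwap hsymm,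
      fun t f g x => ?_⟩
    rw [hBeq, freqForm_schwartzHat_left hB hm, ← conj_freqForm_conjSwap,
      freqForm_schwartzHat_left ((hB.conjLap leftFreqDir).conjSwap hsymm) hm,
      Function.iterate_succ_apply', Function.iterate_succ_apply', ← conj_freqForm_conjSwap]
    exact Complex.conj_conj _

theorem DecayAmp.slice_pos {m : T → Eucl n × Eucl n → ℝ}
    {A : T → Eucl n × Eucl n × Eucl n → ℂ} (h : DecayAmp m A) (t : T) (q : Eucl n × Eucl n) :
    ∃ f : 𝓢(Eucl n, ℂ), ∀ x, f x = A t (x, q) := by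
  have h1 := fun L => (h L).comp_affine (fun _ => ContinuousLinearMap.inl ℝ (Eucl n)
    (Eucl n × Eucl n)) (fun _ => (0, q)) (fun _ => le_rfl)
  refine ⟨⟨fun x => A t (x, q), ?_, fun k l => ?_⟩, fun x => rfl⟩
  · simpa using (h1 0).contDiff t
  · obtain ⟨C, hC, hb⟩ := (h1 k).2 l le_top
    refine ⟨C * m t q, fun x => ?_⟩
    have h2 := hb t x
    simp only [ContinuousLinearMap.inl_apply, Prod.mk_add_mk, add_zero, zero_add] at h2
    have h3 : (0 : ℝ) < (1 + ‖x‖) ^ k := by positivity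
    calc _ ≤ (1 + ‖x‖) ^ k * (C * (((1 + ‖x‖) ^ k)⁻¹ * m t q)) := by
          gcongr
          linarith
      _ = _ := by field_simp

theorem oneSubLap_planeWave (ζ : Eucl n) :
    oneSubLap stdVec (planeWave ζ) = fun x => (1 + ‖ζ‖ ^ 2 : ℝ) * planeWave ζ x := by
  have h : ∀ j, dirDeriv (stdVec j) (dirDeriv (stdVec j) (planeWave ζ)) =
      fun x => -((ζ j ^ 2 : ℝ) : ℂ) * planeWave ζ x := by
    intro j
    rw [dirDeriv_planeWave]
    have := dirDeriv_clm_comp ((contDiff_planeWave ζ).differentiable (by simp))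
      (ContinuousLinearMap.mul ℝ ℂ (Complex.I * (inner ℝ ζ (stdVec j) : ℝ))) (stdVec j)
    simp only [ContinuousLinearMap.mul_apply'] at this
    rw [this, dirDeriv_planeWave, EuclideanSpace.inner_single_right]
    funext x
    simp only [one_mul, conj_trivial]
    push_cast
    linear_combination ((ζ j : ℂ) ^ 2 * planeWave ζ x) * Complex.I_sq
  funext x
  simp only [oneSubLap, h]
  rw [← Finset.sum_mul, Finset.sum_neg_distrib, ← Complex.ofReal_sum]
  have h2 : ∑ j, ζ j ^ 2 = ‖ζ‖ ^ 2 := by rw [EuclideanSpace.norm_sq_eq]; simp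
  rw [h2]
  push_cast
  ring

/-- Since 1 - Δ_x multiplies e^{ix·(ξ-η)} by 1 + |ξ-η|², each integration by parts in x gains one
such factor, and the decay of A in x makes the remaining integral converge. -/
theorem DecayAmp.norm_posIntegral_le {m : T → Eucl n × Eucl n → ℝ}
    {A : T → Eucl n × Eucl n × Eucl n → ℂ} (h : DecayAmp m A) (P : ℕ) :
    ∃ C : ℝ, 0 ≤ C ∧ ∀ t q, (1 + ‖q.1 - q.2‖ ^ 2) ^ P *
      ‖∫ x, planeWave x (q.1 - q.2) * A t (x, q)‖ ≤ C * m t q := by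
  induction P generalizing A with
  | zero =>
    obtain ⟨C, hC, hb⟩ := h.norm_le (n + 1)
    refine ⟨C * ∫ x : Eucl n, ((1 + ‖x‖) ^ (n + 1))⁻¹,
      mul_nonneg hC (integral_nonneg fun x => by positivity), fun t q => ?_⟩
    rw [pow_zero, one_mul, mul_right_comm, ← integral_const_mul]
    refine norm_integral_le_of_norm_le ((integrable_one_add_norm_inv n).const_mul _)
      (Filter.Eventually.of_forall fun x => ?_)
    rw [norm_mul, norm_planeWave, one_mul]
    refine (hb t (x, q)).trans (le_of_eq ?_)
    ring
  | succ P ih =>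
    obtain ⟨C, hC, hb⟩ := ih (h.oneSubLap posDir₃)
    refine ⟨C, hC, fun t q => ?_⟩
    refine le_trans (le_of_eq ?_) (hb t q)
    obtain ⟨f, hf⟩ := h.slice_pos t q
    have h1 := integral_temperate_mul_oneSubLap (hasTemperateGrowth_planeWave (q.1 - q.2)) f stdVec
    rw [oneSubLap_planeWave] at h1
    simp only [mul_assoc] at h1
    rw [integral_const_mul] at h1
    have h2 : _root_.oneSubLap stdVec f = fun x => _root_.oneSubLap posDir₃ (A t) (x, q) := by
      rw [show (f : Eucl n → ℂ) = fun x => A t (x, q) from funext hf]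
      funext x
      exact oneSubLap_slice_pos (h.contDiff t) x q
    simp only [h2, hf, planeWave_comm (q.1 - q.2)] at h1
    rw [h1, norm_mul, Complex.norm_real, Real.norm_of_nonneg (by positivity), pow_succ]
    ring

/-- Schur's test for a kernel dominated by an even convolution kernel: |f(ξ) f(η)| is at most half
the sum of squares, and each half integrates to ∫κ times ∫|f|². -/
theorem norm_integral_schur_le {k : Eucl n × Eucl n → ℂ} {κ : Eucl n → ℝ} (hκ : Integrable κ)
    (hκ0 : ∀ z, 0 ≤ κ z) (hκe : ∀ z, κ (-z) = κ z)
    (hk : ∀ q, ‖k q‖ ≤ κ (q.1 - q.2)) (f : 𝓢(Eucl n, ℂ)) :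
    ‖∫ q : Eucl n × Eucl n, k q * (f q.1 * starRingEnd ℂ (f q.2))‖ ≤
      (∫ z, κ z) * ∫ ξ, ‖f ξ‖ ^ 2 := by
  have hf : Integrable (fun ξ => ‖f ξ‖ ^ 2) := by
    simpa using (f.memLp 2).integrable_norm_pow (by norm_num)
  have i2 : Integrable (fun q : Eucl n × Eucl n => ‖f q.2‖ ^ 2 * κ (q.1 - q.2)) := by
    have := hf.convolution_integrand (ContinuousLinearMap.mul ℝ ℝ) hκ
    simp only [ContinuousLinearMap.mul_apply'] at this
    exact this
  have i1 : Integrable (fun q : Eucl n × Eucl n => ‖f q.1‖ ^ 2 * κ (q.1 - q.2)) := by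
    have := i2.swap
    refine this.congr (Filter.Eventually.of_forall fun q => ?_)
    simp only [Function.comp_apply, Prod.fst_swap, Prod.snd_swap]
    rw [← hκe, neg_sub]
  have e2 : ∫ q : Eucl n × Eucl n, ‖f q.2‖ ^ 2 * κ (q.1 - q.2) =
      (∫ z, κ z) * ∫ ξ, ‖f ξ‖ ^ 2 := by
    rw [Measure.volume_eq_prod, integral_prod_symm _ i2]
    simp only [integral_const_mul, integral_sub_right_eq_self κ]
    rw [integral_mul_const, mul_comm]
  have e1 : ∫ q : Eucl n × Eucl n, ‖f q.1‖ ^ 2 * κ (q.1 - q.2) =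
      (∫ z, κ z) * ∫ ξ, ‖f ξ‖ ^ 2 := by
    rw [Measure.volume_eq_prod, integral_prod _ i1]
    simp only [integral_const_mul, integral_sub_left_eq_self κ]
    rw [integral_mul_const, mul_comm]
  calc _ ≤ ∫ q : Eucl n × Eucl n, (1 / 2 : ℝ) * (‖f q.1‖ ^ 2 * κ (q.1 - q.2) +
          ‖f q.2‖ ^ 2 * κ (q.1 - q.2)) := by
        refine norm_integral_le_of_norm_le ((i1.add i2).const_mul _)
          (Filter.Eventually.of_forall fun q => ?_)
        rw [norm_mul, norm_mul, RCLike.norm_conj]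
        calc _ ≤ κ (q.1 - q.2) * ((1 / 2) * (‖f q.1‖ ^ 2 + ‖f q.2‖ ^ 2)) := by
              have := hκ0 (q.1 - q.2)
              refine mul_le_mul (hk q) ?_ (by positivity) this
              nlinarith [sq_nonneg (‖f q.1‖ - ‖f q.2‖)]
          _ = _ := by ring
    _ = _ := by
        rw [integral_const_mul, integral_add i1 i2, e1, e2]
        ring

theorem one_add_norm_pow_le (x : Eucl n) (K : ℕ) :
    (1 + ‖x‖) ^ K ≤ 2 ^ K * (1 + ‖x‖ ^ 2) ^ K := by
  rw [← mul_pow]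
  have : 1 + ‖x‖ ≤ 2 * (1 + ‖x‖ ^ 2) := by nlinarith [sq_nonneg (‖x‖ - 1), sq_nonneg ‖x‖]
  gcongr

theorem polyGrowth_diff (K : ℕ) :
    PolyGrowth (fun q : Eucl n × Eucl n => (1 + ‖q.1 - q.2‖) ^ K) := by
  refine ⟨1, K, fun q => ?_⟩
  rw [one_mul, ← mul_pow]
  have h1 := norm_sub_le q.1 q.2
  refine pow_le_pow_left₀ (by positivity) ?_ K
  nlinarith [norm_nonneg q.1, norm_nonneg q.2]

theorem DecayAmp.norm_integral_freqForm_le {c : T → ℝ} (hc : ∀ t, 0 ≤ c t) {K : ℕ}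
    {A : T → Eucl n × Eucl n × Eucl n → ℂ}
    (h : DecayAmp (fun t q => c t * (1 + ‖q.1 - q.2‖) ^ K) A) :
    ∃ C : ℝ, 0 ≤ C ∧ ∀ t (f : 𝓢(Eucl n, ℂ)),
      ‖∫ x, freqForm (A t) f f x‖ ≤ C * c t * ∫ ξ, ‖f ξ‖ ^ 2 := by
  have hm : ∀ t, PolyGrowth (fun q : Eucl n × Eucl n => c t * (1 + ‖q.1 - q.2‖) ^ K) :=
    fun t => (polyGrowth_diff K).const_mul (hc t)
  set κ : Eucl n → ℝ := fun x => ((1 + ‖x‖) ^ (n + 1))⁻¹ with hκ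
  -- K powers cancel the growth of the amplitude in ξ - η; the other n + 1 leave an integrable
  -- kernel.
  obtain ⟨C, hC, hb⟩ := h.norm_posIntegral_le (K + (n + 1))
  obtain ⟨D, hD, hbd⟩ := h.norm_le (n + 1)
  refine ⟨C * 2 ^ (K + (n + 1)) * ∫ z, κ z,
    mul_nonneg (by positivity) (integral_nonneg fun x => by positivity), fun t f => ?_⟩
  have hi := integrable_freq_pos (h.contDiff t).continuous ((hm t).const_mul hD)
    (fun z => (hbd t z).trans (le_of_eq (by ring))) f f
  have e1 : ∫ x, freqForm (A t) f f x = ∫ q : Eucl n × Eucl n,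
      (∫ x, planeWave x (q.1 - q.2) * A t (x, q)) * (f q.1 * starRingEnd ℂ (f q.2)) := by
    unfold freqForm
    rw [integral_integral_swap hi]
    simp only [integral_mul_const]
  rw [e1]
  refine (norm_integral_schur_le (κ := fun x => C * 2 ^ (K + (n + 1)) * c t * κ x)
    ((integrable_one_add_norm_inv n).const_mul _) (fun z => ?_) (fun z => by simp [hκ])
    (fun q => ?_) f).trans (le_of_eq ?_)
  · have := hc t
    positivity
  · have h1 := hb t q
    have h2 := one_add_norm_pow_le (q.1 - q.2) (K + (n + 1))
    have h3 : (0 : ℝ) < (1 + ‖q.1 - q.2‖) ^ (n + 1) := by positivity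
    have h4 : (0 : ℝ) < (1 + ‖q.1 - q.2‖) ^ K := by positivity
    simp only [hκ]
    rw [← div_eq_mul_inv, le_div_iff₀ h3]
    refine le_of_mul_le_mul_left ?_ h4
    calc _ = (1 + ‖q.1 - q.2‖) ^ (K + (n + 1)) * ‖∫ x, planeWave x (q.1 - q.2) * A t (x, q)‖ := by
          ring
      _ ≤ (2 ^ (K + (n + 1)) * (1 + ‖q.1 - q.2‖ ^ 2) ^ (K + (n + 1))) *
          ‖∫ x, planeWave x (q.1 - q.2) * A t (x, q)‖ := by gcongr
      _ ≤ 2 ^ (K + (n + 1)) * (C * (c t * (1 + ‖q.1 - q.2‖) ^ K)) := by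
          rw [mul_assoc]
          gcongr
      _ = _ := by ring
  · rw [integral_const_mul]
    ring

theorem norm_bracketDiv_iterate (f : 𝓢(Eucl n, ℂ)) (N : ℕ) (y : Eucl n) :
    ‖(bracketDiv^[N] f) y‖ = ((1 + ‖y‖ ^ 2) ^ N)⁻¹ * ‖f y‖ := by
  induction N with
  | zero => simp
  | succ N ih =>
    rw [Function.iterate_succ_apply', bracketDiv_apply, norm_mul, ih, Complex.norm_real,
      Real.norm_of_nonneg (by positivity), pow_succ (1 + ‖y‖ ^ 2) N, mul_inv]
    ring

/-- After N integrations by parts in each frequency variable, the unweighted bound applies to f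
divided by (1 + |y|²)^N, and Plancherel returns to position space. Thus f matters essentially only
near the origin, where the amplitude lives. -/
theorem DecayAmp.norm_integral_freqForm_schwartzHat_le {c : T → ℝ} (hc : ∀ t, 0 ≤ c t) {K : ℕ}
    {A : T → Eucl n × Eucl n × Eucl n → ℂ}
    (h : DecayAmp (fun t q => c t * (1 + ‖q.1 - q.2‖) ^ K) A) (N : ℕ) :
    ∃ C : ℝ, 0 ≤ C ∧ ∀ t (f : 𝓢(Eucl n, ℂ)),
      ‖∫ x, freqForm (A t) (schwartzHat f) (schwartzHat f) x‖ ≤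
        C * c t * ∫ y, (((1 + ‖y‖ ^ 2) ^ N)⁻¹ * ‖f y‖) ^ 2 := by
  obtain ⟨B, hB, hBeq⟩ := exists_freqForm_schwartzHat_iterate h
    (fun t => (polyGrowth_diff K).const_mul (hc t))
    (fun t q => by simp only [Prod.fst_swap, Prod.snd_swap, norm_sub_rev]) N
  obtain ⟨C, hC, hb⟩ := hB.norm_integral_freqForm_le hc
  refine ⟨C, hC, fun t f => ?_⟩
  simp only [hBeq]
  refine (hb t _).trans (le_of_eq ?_)
  rw [integral_norm_sq_schwartzHat]
  simp only [norm_bracketDiv_iterate]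

end LocalBound

/-! ### Global bounds by averaging over translates -/

section GlobalBound

open scoped SchwartzMap

variable {n : ℕ} {T : Type*}

/-- One bump serves two purposes: evenness and nonzero integral for averaging over translates,
nonnegativity and the value 1 at the origin for the dilated cutoffs. -/
theorem exists_even_schwartz (n : ℕ) : ∃ g : 𝓢(Eucl n, ℂ), (∀ x, g (-x) = g x) ∧
    (∀ x, g x = ((g x).re : ℂ)) ∧ (∀ x, 0 ≤ (g x).re) ∧ g 0 = 1 ∧ ∫ x, g x ≠ 0 := by
  let b : ContDiffBump (0 : Eucl n) := ⟨1, 2, by norm_num, by norm_num⟩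
  let f : Eucl n → ℂ := fun x => (b x : ℂ)
  have hs : HasCompactSupport f := b.hasCompactSupport.comp_left (g := ((↑) : ℝ → ℂ)) rfl
  have hc : ContDiff ℝ ∞ f := Complex.ofRealCLM.contDiff.comp b.contDiff
  refine ⟨hs.toSchwartzMap hc, fun x => ?_, fun x => ?_, fun x => ?_, ?_, ?_⟩
  · show f (-x) = f x
    simp only [f, b.neg]
  · show f x = ((f x).re : ℂ)
    simp only [f, Complex.ofReal_re]
  · show 0 ≤ (f x).re
    simpa only [f, Complex.ofReal_re] using b.nonneg
  · show f 0 = 1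
    simp only [f]
    rw [b.one_of_mem_closedBall (by simp [b])]
    simp
  · show ∫ x, f x ≠ 0
    simp only [f, integral_complex_ofReal, ne_eq, Complex.ofReal_eq_zero]
    exact (b.integral_pos (μ := volume)).ne'

theorem SchwartzMap.symBound (g : 𝓢(Eucl n, ℂ)) (L : ℕ) :
    SymBound ⊤ (fun (_ : T) x => ((1 + ‖x‖) ^ L)⁻¹) (fun _ => g) := by
  refine ⟨fun _ => g.smooth', fun k _ => ?_⟩
  refine ⟨2 ^ L * ((Finset.Iic (L, k)).sup fun m => SchwartzMap.seminorm ℝ m.1 m.2) g,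
    by positivity, fun _ x => ?_⟩
  rw [← div_eq_mul_inv, le_div_iff₀ (by positivity), mul_comm]
  exact SchwartzMap.one_add_le_sup_seminorm_apply (𝕜 := ℝ) (m := (L, k)) le_rfl le_rfl g x

/-- Near the point p the weight Λ(x + p)^s is Λ(p)^s up to a power of 1 + |x|, which the Schwartz
factor absorbs. The point p joins the parameter, so later constants do not depend on it. -/
theorem WeightBounds.decayAmp_localize {Λ : Eucl n → ℝ} {ρ : ℝ} (hΛ : WeightBounds Λ ρ) {s : ℝ}
    {K : ℕ} {A : T → Eucl n × Eucl n × Eucl n → ℂ}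
    (h : SymBound ⊤ (fun _ z => Λ z.1 ^ s * (1 + ‖z.2.1 - z.2.2‖) ^ K) A) (g : 𝓢(Eucl n, ℂ)) :
    DecayAmp (fun (τ : T × Eucl n) q => Λ τ.2 ^ s * (1 + ‖q.1 - q.2‖) ^ K)
      (fun τ z => g z.1 * A τ.1 (z.1 + τ.2, z.2)) := by
  intro L
  obtain ⟨C, K', hC, ht⟩ := hΛ.temperate s
  have h1 := (g.symBound (T := T × Eucl n) (L + K')).comp_clm
    (ContinuousLinearMap.fst ℝ (Eucl n) (Eucl n × Eucl n))
  have h2 := (h.reparam (Prod.fst : T × Eucl n → T)).comp_affine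
    (fun _ => ContinuousLinearMap.id ℝ (Eucl n × Eucl n × Eucl n)) (fun τ => (τ.2, 0))
    (fun _ => le_rfl)
  refine ((h1.mul h2).congr fun τ z => ?_).mono hC.le fun τ z => ?_
  · simp only [ContinuousLinearMap.coe_fst', ContinuousLinearMap.coe_id', id_eq]
    congr 2
    ext <;> simp
  · simp only [ContinuousLinearMap.coe_fst', ContinuousLinearMap.coe_id', id_eq, Prod.fst_add,
      Prod.snd_add, add_zero]
    have h3 := ht (z.1 + τ.2) τ.2
    rw [add_sub_cancel_right] at h3
    have h4 : (0 : ℝ) < (1 + ‖z.1‖) ^ K' := by positivity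
    calc _ ≤ ((1 + ‖z.1‖) ^ (L + K'))⁻¹ * ((C * (Λ τ.2 ^ s * (1 + ‖z.1‖) ^ K')) *
          (1 + ‖z.2.1 - z.2.2‖) ^ K) := by gcongr
      _ = _ := by
        rw [pow_add]
        field_simp

/-- Translating w multiplies its transform by e^{ip·ξ}, exactly the factor that shifts the phase
from x to x + p. -/
theorem freqForm_localize (A : Eucl n × Eucl n × Eucl n → ℂ) (g : Eucl n → ℂ)
    (w : 𝓢(Eucl n, ℂ)) (p x : Eucl n) :
    freqForm (fun z => g z.1 * A (z.1 + p, z.2))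
      (schwartzHat (SchwartzMap.compSubConstCLM ℂ (-p) w))
      (schwartzHat (SchwartzMap.compSubConstCLM ℂ (-p) w)) x =
      g x * freqForm A (schwartzHat w) (schwartzHat w) (x + p) := by
  unfold freqForm
  rw [← integral_const_mul]
  refine integral_congr_ae (Filter.Eventually.of_forall fun q => ?_)
  simp only [schwartzHat_translate]
  rw [planeWave_add_left, planeWave_sub_right p, ← conj_planeWave, map_mul]
  simp only [planeWave]
  ring

theorem integral_mul_integral_eq_convolution {g F : Eucl n → ℂ} (hg : Integrable g)
    (hge : ∀ x, g (-x) = g x) (hF : Integrable F) :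
    (∫ x, g x) * ∫ x, F x = ∫ p, ∫ x, g x * F (x + p) := by
  have h := integral_convolution (ContinuousLinearMap.mul ℝ ℂ) hg hF
  rw [ContinuousLinearMap.mul_apply'] at h
  rw [← h]
  refine integral_congr_ae (Filter.Eventually.of_forall fun p => ?_)
  simp only [convolution_def, ContinuousLinearMap.mul_apply']
  rw [← integral_neg_eq_self]
  refine integral_congr_ae (Filter.Eventually.of_forall fun x => ?_)
  simp only [hge, sub_neg_eq_add, add_comm]

theorem bracket_decay_le (K N : ℕ) (z : Eucl n) :
    (((1 + ‖z‖ ^ 2) ^ (K + N))⁻¹) ^ 2 * (1 + ‖z‖) ^ K ≤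
      2 ^ (K + N) * ((1 + ‖z‖) ^ N)⁻¹ := by
  have h1 := one_add_norm_pow_le z (K + N)
  have h2 : (1 : ℝ) ≤ (1 + ‖z‖ ^ 2) ^ (K + N) := one_le_pow₀ (by nlinarith [sq_nonneg ‖z‖])
  have h3 : (0 : ℝ) < (1 + ‖z‖) ^ N := by positivity
  rw [← div_eq_mul_inv, le_div_iff₀ h3, inv_pow, mul_assoc, ← pow_add, inv_mul_le_iff₀ (by positivity)]
  calc _ ≤ _ := h1
    _ = 1 * (2 ^ (K + N) * (1 + ‖z‖ ^ 2) ^ (K + N)) := by ring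
    _ ≤ (1 + ‖z‖ ^ 2) ^ (K + N) * (2 ^ (K + N) * (1 + ‖z‖ ^ 2) ^ (K + N)) := by gcongr
    _ = _ := by ring

theorem WeightBounds.integrable_rpow_mul_norm_sq {Λ : Eucl n → ℝ} {ρ : ℝ}
    (hΛ : WeightBounds Λ ρ) (s : ℝ) (w : 𝓢(Eucl n, ℂ)) :
    Integrable (fun y => Λ y ^ s * ‖w y‖ ^ 2) := by
  have h1 := SchwartzMap.smulLeftCLM_apply_apply (hΛ.hasTemperateGrowth_rpow (s / 2)) w
  have h2 : Integrable (fun y => ‖SchwartzMap.smulLeftCLM ℂ (fun x => Λ x ^ (s / 2)) w y‖ ^ 2) := by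
    simpa using ((SchwartzMap.smulLeftCLM ℂ (fun x => Λ x ^ (s / 2)) w).memLp 2
      (μ := volume)).integrable_norm_pow (by norm_num)
  refine h2.congr (Filter.Eventually.of_forall fun y => ?_)
  simp only [h1, norm_smul, mul_pow, Real.norm_of_nonneg (hΛ.rpow_pos _ _).le]
  rw [← Real.rpow_natCast, ← Real.rpow_mul (hΛ.pos y).le]
  norm_num

/-- The integral of F is recovered, up to ∫g, by averaging ∫ g(x) F(x+p) dx over p. Each piece is
bounded by Λ(p)^s times the mass of w near p, and temperance moves the weight from p to y. What
remains is the integral of a convolution of Λ^s |w|² with an integrable kernel. -/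
theorem WeightBounds.norm_integral_freqForm_le_lift {Λ : Eucl n → ℝ} {ρ : ℝ}
    (hΛ : WeightBounds Λ ρ) {s : ℝ} {K : ℕ} {A : T → Eucl n × Eucl n × Eucl n → ℂ}
    (h : SymBound ⊤ (fun _ z => Λ z.1 ^ s * (1 + ‖z.2.1 - z.2.2‖) ^ K) A) :
    ∃ C : ℝ, 0 ≤ C ∧ ∀ t (w : 𝓢(Eucl n, ℂ)),
      Integrable (freqForm (A t) (schwartzHat w) (schwartzHat w)) →
      ‖∫ x, freqForm (A t) (schwartzHat w) (schwartzHat w) x‖ ≤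
        C * ∫ y, Λ y ^ s * ‖w y‖ ^ 2 := by
  obtain ⟨g, hge, -, -, -, hg0⟩ := exists_even_schwartz n
  obtain ⟨D, K', hD, ht⟩ := hΛ.temperate s
  -- The order K' + (n + 1) pays for the temperance loss (1 + |p-y|)^{K'} and still leaves an
  -- integrable kernel.
  obtain ⟨C, hC, hb⟩ := (hΛ.decayAmp_localize h g).norm_integral_freqForm_schwartzHat_le
    (c := fun τ : T × Eucl n => Λ τ.2 ^ s) (fun τ => (hΛ.rpow_pos s τ.2).le) (K' + (n + 1))
  have hgp : 0 < ‖∫ x, g x‖ := norm_pos_iff.2 hg0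
  set κ : Eucl n → ℝ := fun x => ((1 + ‖x‖) ^ (n + 1))⁻¹ with hκ
  have hκi : Integrable κ := integrable_one_add_norm_inv n
  set B : ℝ := C * D * 2 ^ (K' + (n + 1)) with hB
  refine ⟨‖∫ x, g x‖⁻¹ * (B * ∫ z, κ z), ?_, fun t w hF => ?_⟩
  · have : 0 ≤ ∫ z, κ z := integral_nonneg fun x => by positivity
    positivity
  set H : Eucl n → ℝ := fun y => Λ y ^ s * ‖w y‖ ^ 2 with hH
  have hHi : Integrable H := hΛ.integrable_rpow_mul_norm_sq s w
  set F := freqForm (A t) (schwartzHat w) (schwartzHat w) with hFdef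
  have h1 := integral_mul_integral_eq_convolution g.integrable hge hF
  have h2 := hHi.integrable_convolution (ContinuousLinearMap.mul ℝ ℝ) hκi
  have h3 := integral_convolution (ContinuousLinearMap.mul ℝ ℝ) hHi hκi
  rw [ContinuousLinearMap.mul_apply'] at h3
  have hex := hHi.ae_convolution_exists (ContinuousLinearMap.mul ℝ ℝ) hκi
  have key : ‖∫ p, ∫ x, g x * F (x + p)‖ ≤
      ∫ p, B * MeasureTheory.convolution H κ (ContinuousLinearMap.mul ℝ ℝ) volume p := by
    refine norm_integral_le_of_norm_le (h2.const_mul B) ?_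
    filter_upwards [hex] with p hp
    have h4 := hb (t, p) (SchwartzMap.compSubConstCLM ℂ (-p) w)
    simp only [freqForm_localize (A t) g w p] at h4
    refine h4.trans ?_
    rw [mul_assoc, ← integral_const_mul, hB, mul_assoc, mul_assoc]
    refine mul_le_mul_of_nonneg_left ?_ hC
    rw [convolution_def, ← mul_assoc, ← integral_const_mul,
      ← integral_sub_right_eq_self _ p]
    refine integral_mono_of_nonneg (Filter.Eventually.of_forall fun y => ?_)
      (hp.const_mul _) (Filter.Eventually.of_forall fun y => ?_)
    · have := (hΛ.rpow_pos s p).le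
      positivity
    · simp only [SchwartzMap.compSubConstCLM_apply, sub_neg_eq_add, sub_add_cancel,
        ContinuousLinearMap.mul_apply']
      have h5 := bracket_decay_le K' (n + 1) (y - p)
      have h6 := ht p y
      have h7 := (hΛ.rpow_pos s y).le
      calc Λ p ^ s * (((1 + ‖y - p‖ ^ 2) ^ (K' + (n + 1)))⁻¹ * ‖w y‖) ^ 2
          ≤ (D * (Λ y ^ s * (1 + ‖p - y‖) ^ K')) *
            (((1 + ‖y - p‖ ^ 2) ^ (K' + (n + 1)))⁻¹ * ‖w y‖) ^ 2 := by gcongr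
        _ = D * (Λ y ^ s * ‖w y‖ ^ 2) *
            ((((1 + ‖y - p‖ ^ 2) ^ (K' + (n + 1)))⁻¹) ^ 2 * (1 + ‖y - p‖) ^ K') := by
            rw [norm_sub_rev p y]
            ring
        _ ≤ D * (Λ y ^ s * ‖w y‖ ^ 2) *
            (2 ^ (K' + (n + 1)) * ((1 + ‖y - p‖) ^ (n + 1))⁻¹) := by gcongr
        _ = _ := by
            simp only [hκ, hH]
            rw [norm_sub_rev y p]
            ring
  rw [← h1, norm_mul, integral_const_mul, h3] at key
  calc _ = ‖∫ x, g x‖⁻¹ * (‖∫ x, g x‖ * ‖∫ x, F x‖) := by field_simp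
    _ ≤ ‖∫ x, g x‖⁻¹ * (B * ((∫ y, H y) * ∫ z, κ z)) := by gcongr
    _ = _ := by ring

/-- The operator `Λ(D)^k` on Schwartz functions. -/
noncomputable def weightLift (Λ : Eucl n → ℝ) (k : ℝ) (φ : 𝓢(Eucl n, ℂ)) : 𝓢(Eucl n, ℂ) :=
  schwartzUnhat (SchwartzMap.smulLeftCLM ℂ (fun ξ => Λ ξ ^ k) (schwartzHat φ))

theorem WeightBounds.schwartzHat_weightLift {Λ : Eucl n → ℝ} {ρ : ℝ} (hΛ : WeightBounds Λ ρ)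
    (k : ℝ) (φ : 𝓢(Eucl n, ℂ)) (ξ : Eucl n) :
    schwartzHat (weightLift Λ k φ) ξ = ((Λ ξ ^ k : ℝ) : ℂ) * schwartzHat φ ξ := by
  rw [weightLift, schwartzHat_unhat,
    SchwartzMap.smulLeftCLM_apply_apply (hΛ.hasTemperateGrowth_rpow k), Complex.real_smul]

/-- The symbol is a product with x on the left, so its operator is Λ(D)^{k₁} followed by
multiplication by Λ(x)^{k₂}; no commutator arises. -/
theorem WeightBounds.sobolevNorm_sq {Λ : Eucl n → ℝ} {ρ : ℝ} (hΛ : WeightBounds Λ ρ)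
    (k₁ k₂ : ℝ) (φ : 𝓢(Eucl n, ℂ)) :
    sobolevNorm Λ k₁ k₂ 2 φ ^ 2 = ∫ y, Λ y ^ (2 * k₂) * ‖weightLift Λ k₁ φ y‖ ^ 2 := by
  have h1 : pseudoDiffOp (besselSymbol Λ (-k₁) (-k₂)) φ =
      SchwartzMap.smulLeftCLM ℂ (fun x => Λ x ^ k₂) (weightLift Λ k₁ φ) := by
    funext x
    rw [SchwartzMap.smulLeftCLM_apply_apply (hΛ.hasTemperateGrowth_rpow k₂), Complex.real_smul,
      ← integral_schwartzHat_inv (weightLift Λ k₁ φ) x, mul_left_comm, ← integral_const_mul]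
    unfold pseudoDiffOp fourierConst besselSymbol
    congr 1
    refine integral_congr_ae (Filter.Eventually.of_forall fun ξ => ?_)
    simp only [hΛ.schwartzHat_weightLift, schwartzHat_eq, neg_neg]
    push_cast
    ring
  rw [sobolevNorm, h1, MemLp.eLpNorm_eq_integral_rpow_norm (by norm_num) (by norm_num)
    ((SchwartzMap.smulLeftCLM ℂ (fun x => Λ x ^ k₂) (weightLift Λ k₁ φ)).memLp 2 volume), ENNReal.toReal_ofReal (by positivity)]
  rw [← Real.rpow_natCast, ← Real.rpow_mul (integral_nonneg fun x => by positivity)]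
  norm_num
  refine integral_congr_ae (Filter.Eventually.of_forall fun y => ?_)
  simp only
  rw [SchwartzMap.smulLeftCLM_apply_apply (hΛ.hasTemperateGrowth_rpow k₂), norm_smul, mul_pow,
    Real.norm_of_nonneg (hΛ.rpow_pos _ _).le, ← Real.rpow_natCast (Λ y ^ k₂),
    ← Real.rpow_mul (hΛ.pos y).le, mul_comm k₂]
  norm_num

/-- The amplitude weight `Λ(x)^{2k₂} Λ(ξ)^{k₁} Λ(η)^{k₁} ⟨ξ-η⟩^K`. -/
noncomputable def ampWeight (Λ : Eucl n → ℝ) (k₁ k₂ : ℝ) (K : ℕ)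
    (z : Eucl n × Eucl n × Eucl n) : ℝ :=
  Λ z.1 ^ (2 * k₂) * (Λ z.2.1 ^ k₁ * Λ z.2.2 ^ k₁) * (1 + ‖z.2.1 - z.2.2‖) ^ K

/-- Dividing the amplitude by Λ(ξ)^{k₁} Λ(η)^{k₁} and multiplying both transforms by Λ^{k₁} leaves
the form unchanged and reduces to the case without frequency weights, for the lifted function
Λ(D)^{k₁} φ. -/
theorem WeightBounds.norm_integral_freqForm_le {Λ : Eucl n → ℝ} {ρ : ℝ}
    (hΛ : WeightBounds Λ ρ) {k₁ k₂ : ℝ} {K : ℕ} {A : T → Eucl n × Eucl n × Eucl n → ℂ}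
    (h : SymBound ⊤ (fun _ => ampWeight Λ k₁ k₂ K) A) :
    ∃ C : ℝ, 0 ≤ C ∧ ∀ t (φ : 𝓢(Eucl n, ℂ)),
      Integrable (freqForm (A t) (schwartzHat φ) (schwartzHat φ)) →
      ‖∫ x, freqForm (A t) (schwartzHat φ) (schwartzHat φ) x‖ ≤
        C * sobolevNorm Λ k₁ k₂ 2 φ ^ 2 := by
  have hl := ((hΛ.symBound_rpow (T := T) (-k₁)).ofReal).comp_clm
    ((ContinuousLinearMap.fst ℝ (Eucl n) (Eucl n)).comp
      (ContinuousLinearMap.snd ℝ (Eucl n) (Eucl n × Eucl n)))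
  have hr := ((hΛ.symBound_rpow (T := T) (-k₁)).ofReal).comp_clm
    ((ContinuousLinearMap.snd ℝ (Eucl n) (Eucl n)).comp
      (ContinuousLinearMap.snd ℝ (Eucl n) (Eucl n × Eucl n)))
  have hcancel : ∀ ξ, Λ ξ ^ (-k₁) * Λ ξ ^ k₁ = 1 := fun ξ => by
    rw [← Real.rpow_add (hΛ.pos ξ), neg_add_cancel, Real.rpow_zero]
  have h1 := ((h.mul hl).mul hr).congr_weight
    (M' := fun _ z => Λ z.1 ^ (2 * k₂) * (1 + ‖z.2.1 - z.2.2‖) ^ K) fun t z => by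
      simp only [ampWeight, ContinuousLinearMap.comp_apply, ContinuousLinearMap.coe_fst',
        ContinuousLinearMap.coe_snd']
      linear_combination (-(Λ z.1 ^ (2 * k₂) * (1 + ‖z.2.1 - z.2.2‖) ^ K)) *
        (Λ z.2.2 ^ (-k₁) * Λ z.2.2 ^ k₁ * hcancel z.2.1 + hcancel z.2.2)
  obtain ⟨C, hC, hb⟩ := hΛ.norm_integral_freqForm_le_lift h1
  refine ⟨C, hC, fun t φ hi => ?_⟩
  have e : freqForm (fun z => A t z * ((Λ z.2.1 ^ (-k₁) : ℝ) : ℂ) * ((Λ z.2.2 ^ (-k₁) : ℝ) : ℂ))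
      (schwartzHat (weightLift Λ k₁ φ)) (schwartzHat (weightLift Λ k₁ φ)) =
      freqForm (A t) (schwartzHat φ) (schwartzHat φ) := by
    funext x
    unfold freqForm
    refine integral_congr_ae (Filter.Eventually.of_forall fun q => ?_)
    simp only [hΛ.schwartzHat_weightLift, map_mul, Complex.conj_ofReal]
    have h2 : ((Λ q.1 ^ (-k₁) : ℝ) : ℂ) * ((Λ q.1 ^ k₁ : ℝ) : ℂ) = 1 := mod_cast hcancel q.1
    have h3 : ((Λ q.2 ^ (-k₁) : ℝ) : ℂ) * ((Λ q.2 ^ k₁ : ℝ) : ℂ) = 1 := mod_cast hcancel q.2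
    linear_combination (planeWave x (q.1 - q.2) * A t (x, q) * (schwartzHat φ q.1 *
      starRingEnd ℂ (schwartzHat φ q.2))) *
      (((Λ q.2 ^ (-k₁) : ℝ) : ℂ) * ((Λ q.2 ^ k₁ : ℝ) : ℂ) * h2 + h3)
  have h4 := hb t (weightLift Λ k₁ φ)
  simp only [ContinuousLinearMap.comp_apply, ContinuousLinearMap.coe_fst',
    ContinuousLinearMap.coe_snd'] at h4
  rw [e, ← hΛ.sobolevNorm_sq] at h4
  exact h4 hi

end GlobalBound

/-! ### Differentiating a form along a family of amplitudes -/

section Deformation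

open scoped SchwartzMap

variable {n : ℕ} {T : Type*} {m : T → Eucl n × Eucl n → ℝ} {A : T → Eucl n × Eucl n × Eucl n → ℂ}

theorem DecayAmp.integrable_phase (h : DecayAmp m A) (hm : ∀ t, PolyGrowth (m t)) (t : T)
    (f g : 𝓢(Eucl n, ℂ)) :
    Integrable (fun z : Eucl n × Eucl n × Eucl n =>
      planeWave z.1 (z.2.1 - z.2.2) * A t z * (f z.2.1 * starRingEnd ℂ (g z.2.2))) := by
  obtain ⟨C, hC, hb⟩ := h.norm_le (n + 1)
  exact integrable_freq_pos (h.contDiff t).continuous ((hm t).const_mul hC)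
    (fun z => (hb t z).trans (le_of_eq (by ring))) f g

theorem DecayAmp.integrable_freqForm (h : DecayAmp m A) (hm : ∀ t, PolyGrowth (m t)) (t : T)
    (f g : 𝓢(Eucl n, ℂ)) : Integrable (freqForm (A t) f g) :=
  (h.integrable_phase hm t f g).integral_prod_left

theorem DecayAmp.integral_freqForm (h : DecayAmp m A) (hm : ∀ t, PolyGrowth (m t)) (t : T)
    (f g : 𝓢(Eucl n, ℂ)) :
    ∫ x, freqForm (A t) f g x = ∫ z : Eucl n × Eucl n × Eucl n,
      planeWave z.1 (z.2.1 - z.2.2) * A t z * (f z.2.1 * starRingEnd ℂ (g z.2.2)) :=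
  integral_integral (h.integrable_phase hm t f g)

theorem DecayAmp.integral_freqForm_swap (h : DecayAmp m A) (hm : ∀ t, PolyGrowth (m t)) (t : T)
    (f g : 𝓢(Eucl n, ℂ)) :
    ∫ x, freqForm (A t) f g x = ∫ q : Eucl n × Eucl n,
      (∫ x, planeWave x (q.1 - q.2) * A t (x, q)) * (f q.1 * starRingEnd ℂ (g q.2)) := by
  unfold freqForm
  rw [integral_integral_swap (h.integrable_phase hm t f g)]
  simp only [integral_mul_const]

/-- On e^{ix·(ξ-η)} the factor η_j - ξ_j is i∂_{x_j}; integration by parts moves the derivative to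
the amplitude. -/
theorem DecayAmp.integral_planeWave_mul_dirDeriv (h : DecayAmp m A) (t : T) (q : Eucl n × Eucl n)
    (j : Fin n) :
    ∫ x, planeWave x (q.1 - q.2) * (((q.2 j - q.1 j : ℝ) : ℂ) * A t (x, q)) =
      -Complex.I * ∫ x, planeWave x (q.1 - q.2) * dirDeriv (posDir₃ j) (A t) (x, q) := by
  obtain ⟨f, hf⟩ := h.slice_pos t q
  have h1 := integral_temperate_mul_dirDeriv (hasTemperateGrowth_planeWave (q.1 - q.2)) f
    (stdVec j)
  have h2 : dirDeriv (stdVec j) f = fun x => dirDeriv (posDir₃ j) (A t) (x, q) := by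
    rw [show (f : Eucl n → ℂ) = fun x => A t (x, q) from funext hf]
    exact dirDeriv_slice_pos (h.contDiff t) q _
  have h3 : inner ℝ (q.1 - q.2) (stdVec j) = q.1 j - q.2 j := by
    rw [EuclideanSpace.inner_single_right]
    simp
  simp only [h2, hf, dirDeriv_planeWave, h3, planeWave_comm (q.1 - q.2)] at h1
  rw [h1, ← integral_neg, ← integral_const_mul]
  refine integral_congr_ae (Filter.Eventually.of_forall fun x => ?_)
  simp only
  push_cast
  linear_combination (((q.2 j : ℂ) - q.1 j) * planeWave x (q.1 - q.2) * A t (x, q)) *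
    Complex.I_sq

theorem norm_coord_sub_le (ξ η : Eucl n) (j : Fin n) : ‖((η j - ξ j : ℝ) : ℂ)‖ ≤ ‖ξ - η‖ := by
  rw [Complex.norm_real, norm_sub_rev]
  exact PiLp.norm_apply_le (ξ - η) j

theorem PolyGrowth.mul_diff {m : Eucl n × Eucl n → ℝ} (h : PolyGrowth m) (hm0 : ∀ q, 0 ≤ m q) :
    PolyGrowth (fun q => ‖q.1 - q.2‖ * m q) := by
  obtain ⟨C, K, hC⟩ := h
  refine ⟨C, K + 1, fun q => ?_⟩
  have h1 : ‖q.1 - q.2‖ ≤ (1 + ‖q.1‖) * (1 + ‖q.2‖) := by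
    nlinarith [norm_sub_le q.1 q.2, norm_nonneg q.1, norm_nonneg q.2]
  calc _ ≤ ((1 + ‖q.1‖) * (1 + ‖q.2‖)) * (C * ((1 + ‖q.1‖) ^ K * (1 + ‖q.2‖) ^ K)) :=
        mul_le_mul h1 (hC q) (hm0 q) (by positivity)
    _ = _ := by ring

/-- Differentiation under the integral is dominated because the factors η_j - ξ_j cost only
polynomial growth in the frequencies. Each factor is then exchanged for an x-derivative of B_j,
which is where the gain in x comes from. -/
theorem hasDerivAt_integral_freqForm {m : Eucl n × Eucl n → ℝ} (hm : PolyGrowth m)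
    (hm0 : ∀ q, 0 ≤ m q) {S : Set ℝ} (hS : IsOpen S) {A : ℝ → Eucl n × Eucl n × Eucl n → ℂ}
    {B : Fin n → ℝ → Eucl n × Eucl n × Eucl n → ℂ}
    (hA : DecayAmp (fun _ => m) (fun t : S => A t))
    (hB : ∀ j, DecayAmp (fun _ => m) (fun t : S => B j t))
    (hd : ∀ t ∈ S, ∀ z : Eucl n × Eucl n × Eucl n, HasDerivAt (fun s => A s z)
      (∑ j, ((z.2.2 j - z.2.1 j : ℝ) : ℂ) * B j t z) t)
    (f : 𝓢(Eucl n, ℂ)) {t : ℝ} (ht : t ∈ S) :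
    HasDerivAt (fun s => ∫ x, freqForm (A s) f f x)
      (-Complex.I * ∑ j, ∫ x, freqForm (dirDeriv (posDir₃ j) (B j t)) f f x) t := by
  set F : ℝ → Eucl n × Eucl n × Eucl n → ℂ := fun s z =>
    planeWave z.1 (z.2.1 - z.2.2) * A s z * (f z.2.1 * starRingEnd ℂ (f z.2.2)) with hF
  set A' : ℝ → Eucl n × Eucl n × Eucl n → ℂ := fun s z =>
    ∑ j, ((z.2.2 j - z.2.1 j : ℝ) : ℂ) * B j s z with hA'
  set F' : ℝ → Eucl n × Eucl n × Eucl n → ℂ := fun s z =>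
    planeWave z.1 (z.2.1 - z.2.2) * A' s z * (f z.2.1 * starRingEnd ℂ (f z.2.2)) with hF'
  have hint : ∀ s ∈ S, Integrable (F s) := fun s hs => hA.integrable_phase (fun _ => hm) ⟨s, hs⟩ f f
  choose D hD hDb using fun j => (hB j).norm_le (n + 1)
  have hA'b : ∀ s ∈ S, ∀ z, ‖A' s z‖ ≤
      ((1 + ‖z.1‖) ^ (n + 1))⁻¹ * ((∑ j, D j) * (‖z.2.1 - z.2.2‖ * m z.2)) := by
    intro s hs z
    calc _ ≤ ∑ j, ‖z.2.1 - z.2.2‖ * (D j * (((1 + ‖z.1‖) ^ (n + 1))⁻¹ * m z.2)) := by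
          refine norm_sum_le_of_le _ fun j _ => ?_
          rw [norm_mul]
          exact mul_le_mul (norm_coord_sub_le _ _ j) (hDb j ⟨s, hs⟩ z) (norm_nonneg _)
            (norm_nonneg _)
      _ = _ := by
          simp only [Finset.sum_mul, Finset.mul_sum]
          exact Finset.sum_congr rfl fun j _ => by ring
  have hm' : PolyGrowth (fun q => (∑ j, D j) * (‖q.1 - q.2‖ * m q)) :=
    (hm.mul_diff hm0).const_mul (Finset.sum_nonneg fun j _ => hD j)
  have hcont' : ∀ s ∈ S, Continuous (A' s) := fun s hs => by
    refine continuous_finsetSum _ fun j _ => Continuous.mul ?_ ((hB j).contDiff ⟨s, hs⟩).continuous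
    exact Complex.continuous_ofReal.comp (by fun_prop)
  have hF'i : ∀ s ∈ S, Integrable (F' s) := fun s hs =>
    integrable_freq_pos (hcont' s hs) hm' (hA'b s hs) f f
  obtain ⟨C, K, hCK⟩ := hm'
  set M : Eucl n × Eucl n × Eucl n → ℝ := fun z => ((1 + ‖z.1‖) ^ (n + 1))⁻¹ *
    (C * ((1 + ‖z.2.1‖) ^ K * (1 + ‖z.2.2‖) ^ K)) with hM
  have hMA : ∀ s ∈ S, ∀ z, ‖A' s z‖ ≤ M z := fun s hs z => (hA'b s hs z).trans
    (mul_le_mul_of_nonneg_left (hCK z.2) (by positivity))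
  have hMc : Continuous M := by
    refine Continuous.mul (Continuous.inv₀ (by fun_prop) fun z => by positivity) (by fun_prop)
  have hM0 : ∀ z, 0 ≤ M z := fun z => (norm_nonneg _).trans (hMA t ht z)
  have hbd := (integrable_freq_pos (A := fun z => (M z : ℂ)) (by fun_prop)
    (m := fun q => C * ((1 + ‖q.1‖) ^ K * (1 + ‖q.2‖) ^ K)) ⟨C, K, fun q => le_rfl⟩
    (fun z => by rw [Complex.norm_real, Real.norm_of_nonneg (hM0 z)]) f f).norm
  have key := hasDerivAt_integral_of_dominated_loc_of_deriv_le (μ := volume) (F := F) (F' := F')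
    (x₀ := t) (hS.mem_nhds ht)
    ((hS.mem_nhds ht |> fun h => Filter.mem_of_superset h fun s hs =>
      (hint s hs).aestronglyMeasurable))
    (hint t ht) (hF'i t ht).aestronglyMeasurable
    (Filter.Eventually.of_forall fun z s hs => by
      simp only [hF', norm_mul, norm_planeWave, Complex.norm_real, one_mul]
      exact mul_le_mul_of_nonneg_right ((hMA s hs z).trans (le_abs_self _)) (by positivity)) hbd
    (Filter.Eventually.of_forall fun z s hs =>
      ((hd s hs z).const_mul _).mul_const _)
  have e : ∫ z, F' t z = -Complex.I * ∑ j, ∫ x, freqForm (dirDeriv (posDir₃ j) (B j t)) f f x := by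
    have hBi : ∀ j, Integrable (fun z : Eucl n × Eucl n × Eucl n =>
        planeWave z.1 (z.2.1 - z.2.2) * (((z.2.2 j - z.2.1 j : ℝ) : ℂ) * B j t z) *
          (f z.2.1 * starRingEnd ℂ (f z.2.2))) := by
      intro j
      refine integrable_freq_pos (Continuous.mul
        (Complex.continuous_ofReal.comp (by fun_prop)) ((hB j).contDiff ⟨t, ht⟩).continuous)
        ((hm.mul_diff hm0).const_mul (hD j)) (fun z => ?_) f f
      refine (norm_mul_le _ _).trans ?_
      refine (mul_le_mul (norm_coord_sub_le _ _ j) (hDb j ⟨t, ht⟩ z) (norm_nonneg _)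
            (norm_nonneg _)).trans (le_of_eq (by ring))
    have e1 : ∀ z, F' t z = ∑ j,
        planeWave z.1 (z.2.1 - z.2.2) * (((z.2.2 j - z.2.1 j : ℝ) : ℂ) * B j t z) *
          (f z.2.1 * starRingEnd ℂ (f z.2.2)) := fun z => by
      simp only [hF', hA', Finset.mul_sum, Finset.sum_mul]
    simp only [e1]
    rw [integral_finsetSum _ fun j _ => hBi j, Finset.mul_sum]
    refine Finset.sum_congr rfl fun j _ => ?_
    have e2 := ((hB j).dir (posDir₃ j)).integral_freqForm_swap (fun _ => hm) ⟨t, ht⟩ f f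
    have e3 := fun q => (hB j).integral_planeWave_mul_dirDeriv ⟨t, ht⟩ q j
    simp only at e2 e3
    rw [e2, Measure.volume_eq_prod, integral_prod_symm _ (hBi j), ← integral_const_mul]
    refine integral_congr_ae (Filter.Eventually.of_forall fun q => ?_)
    simp only
    rw [integral_mul_const, e3]
    ring
  rw [← e]
  refine key.2.congr_of_eventuallyEq (Filter.mem_of_superset (hS.mem_nhds ht) fun s hs => ?_)
  exact hA.integral_freqForm (fun _ => hm) ⟨s, hs⟩ f f

end Deformation

/-! ### The family joining the symbol of a product to a product of operators -/

section SymbolDeformation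

open scoped SchwartzMap

variable {n : ℕ} {T : Type*}

/-- The amplitude `g(x) c(x, ξ) d(x, ξ + t (η - ξ))`. -/
noncomputable def deformAmp (g : Eucl n → ℂ) (c d : Eucl n × Eucl n → ℂ) (t : ℝ)
    (z : Eucl n × Eucl n × Eucl n) : ℂ :=
  g z.1 * (c (z.1, z.2.1) * d (z.1, z.2.1 + t • (z.2.2 - z.2.1)))

/-- The linear map `(x, ξ, η) ↦ (x, ξ + t (η - ξ))`. -/
noncomputable def phaseShear (t : ℝ) : Eucl n × Eucl n × Eucl n →L[ℝ] Eucl n × Eucl n :=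
  (ContinuousLinearMap.fst ℝ _ _).prod
    ((ContinuousLinearMap.fst ℝ _ _).comp (ContinuousLinearMap.snd ℝ _ _) +
      t • ((ContinuousLinearMap.snd ℝ _ _).comp (ContinuousLinearMap.snd ℝ _ _) -
        (ContinuousLinearMap.fst ℝ _ _).comp (ContinuousLinearMap.snd ℝ _ _)))

theorem phaseShear_apply (t : ℝ) (z : Eucl n × Eucl n × Eucl n) :
    phaseShear t z = (z.1, z.2.1 + t • (z.2.2 - z.2.1)) := rfl

theorem norm_phaseShear_le {t : ℝ} (ht : |t| ≤ 2) :
    ‖(phaseShear t : Eucl n × Eucl n × Eucl n →L[ℝ] Eucl n × Eucl n)‖ ≤ 5 := by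
  refine ContinuousLinearMap.opNorm_le_bound _ (by norm_num) fun z => ?_
  rw [phaseShear_apply]
  have h1 : ‖z.1‖ ≤ ‖z‖ := norm_fst_le z
  have h2 : ‖z.2.1‖ ≤ ‖z‖ := (norm_fst_le z.2).trans (norm_snd_le z)
  have h3 : ‖z.2.2‖ ≤ ‖z‖ := (norm_snd_le z.2).trans (norm_snd_le z)
  have h4 := norm_nonneg z
  refine max_le (by linarith) ?_
  calc ‖z.2.1 + t • (z.2.2 - z.2.1)‖ ≤ ‖z.2.1‖ + |t| * (‖z.2.2‖ + ‖z.2.1‖) := by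
        refine (norm_add_le _ _).trans ?_
        rw [norm_smul, Real.norm_eq_abs]
        gcongr
        exact norm_sub_le _ _
    _ ≤ ‖z‖ + 2 * (‖z‖ + ‖z‖) := by gcongr
    _ = 5 * ‖z‖ := by ring

/-- The intermediate frequency ξ + t(η-ξ) lies within 2|ξ-η| of ξ, so temperance replaces it by ξ
and then half of the total order at ξ by η, at the price of powers of 1 + |ξ-η|. -/
theorem WeightBounds.deform_weight_le {Λ : Eucl n → ℝ} {ρ : ℝ} (hΛ : WeightBounds Λ ρ)
    {p₁ p₂ q₁ q₂ r k₁ k₂ : ℝ} (h₁ : p₁ + q₁ = 2 * k₁) (h₂ : p₂ + q₂ + r = 2 * k₂) :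
    ∃ (C : ℝ) (K : ℕ), 0 < C ∧ ∀ t : ℝ, |t| ≤ 2 → ∀ z : Eucl n × Eucl n × Eucl n,
      Λ z.1 ^ r * (phaseWeight Λ p₁ p₂ (phaseShear 0 z) * phaseWeight Λ q₁ q₂ (phaseShear t z)) ≤
        C * ampWeight Λ k₁ k₂ K z := by
  obtain ⟨C, K, hC, hb⟩ := hΛ.temperate q₁
  obtain ⟨C', K', hC', hb'⟩ := hΛ.temperate k₁
  refine ⟨C * C' * 2 ^ K, K + K', by positivity, fun t ht z => ?_⟩
  simp only [phaseShear_apply, phaseWeight, zero_smul, add_zero, ampWeight]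
  set ξ := z.2.1
  set η := z.2.2
  have h3 : 1 + ‖ξ + t • (η - ξ) - ξ‖ ≤ 2 * (1 + ‖ξ - η‖) := by
    rw [add_sub_cancel_left, norm_smul, Real.norm_eq_abs, norm_sub_rev]
    nlinarith [norm_nonneg (ξ - η)]
  have h4 := hb (ξ + t • (η - ξ)) ξ
  have h5 := hb' ξ η
  have e1 : Λ ξ ^ p₁ * Λ ξ ^ q₁ = Λ ξ ^ k₁ * Λ ξ ^ k₁ := by
    rw [← Real.rpow_add (hΛ.pos _), ← Real.rpow_add (hΛ.pos _), h₁, two_mul]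
  have e2 : Λ z.1 ^ p₂ * Λ z.1 ^ q₂ * Λ z.1 ^ r = Λ z.1 ^ (2 * k₂) := by
    rw [← Real.rpow_add (hΛ.pos _), ← Real.rpow_add (hΛ.pos _), h₂]
  have i1 := hΛ.rpow_pos p₂ z.1
  have i2 := hΛ.rpow_pos q₂ z.1
  have i3 := hΛ.rpow_pos r z.1
  have i4 := hΛ.rpow_pos p₁ ξ
  have i5 := hΛ.rpow_pos q₁ ξ
  have i6 := hΛ.rpow_pos k₁ ξ
  have i7 := hΛ.rpow_pos (2 * k₂) z.1
  calc _ = (Λ z.1 ^ p₂ * Λ z.1 ^ q₂ * Λ z.1 ^ r) * (Λ ξ ^ p₁ * Λ (ξ + t • (η - ξ)) ^ q₁) := by ring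
    _ ≤ (Λ z.1 ^ p₂ * Λ z.1 ^ q₂ * Λ z.1 ^ r) *
        (Λ ξ ^ p₁ * (C * (Λ ξ ^ q₁ * (2 * (1 + ‖ξ - η‖)) ^ K))) := by
        gcongr
        refine h4.trans ?_
        gcongr
    _ = Λ z.1 ^ (2 * k₂) * (C * (2 * (1 + ‖ξ - η‖)) ^ K) * (Λ ξ ^ k₁ * Λ ξ ^ k₁) := by
        rw [← e1, ← e2]
        ring
    _ ≤ Λ z.1 ^ (2 * k₂) * (C * (2 * (1 + ‖ξ - η‖)) ^ K) *
        (Λ ξ ^ k₁ * (C' * (Λ η ^ k₁ * (1 + ‖ξ - η‖) ^ K'))) := by gcongr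
    _ = _ := by
        rw [mul_pow, pow_add]
        ring

variable {Λ : Eucl n → ℝ} {ρ p₁ p₂ q₁ q₂ r k₁ k₂ : ℝ} {c d : Eucl n × Eucl n → ℂ}

theorem WeightBounds.symBound_deformAmp (hΛ : WeightBounds Λ ρ) {g : T → Eucl n → ℂ}
    (hg : SymBound ⊤ (fun _ x => Λ x ^ r) g)
    (hc : SymBound ⊤ (fun _ : Unit => phaseWeight Λ p₁ p₂) (fun _ => c))
    (hd : SymBound ⊤ (fun _ : Unit => phaseWeight Λ q₁ q₂) (fun _ => d))
    {τ : T → ℝ} (hτ : ∀ t, |τ t| ≤ 2) (h₁ : p₁ + q₁ = 2 * k₁) (h₂ : p₂ + q₂ + r = 2 * k₂) :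
    ∃ K : ℕ, SymBound ⊤ (fun _ => ampWeight Λ k₁ k₂ K) (fun t => deformAmp (g t) c d (τ t)) := by
  obtain ⟨C, K, hC, hb⟩ := hΛ.deform_weight_le h₁ h₂
  have e1 := hg.comp_clm (ContinuousLinearMap.fst ℝ (Eucl n) (Eucl n × Eucl n))
  have e2 := (hc.reparam (fun _ : T => ())).comp_clm (phaseShear 0)
  have e3 := (hd.reparam (fun _ : T => ())).comp_affine (fun t => phaseShear (τ t)) (fun _ => 0)
    (fun t => norm_phaseShear_le (hτ t))
  refine ⟨K, ((e1.mul (e2.mul e3)).mono hC.le fun t z => ?_).congr fun t z => ?_⟩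
  · simpa using hb (τ t) (hτ t) z
  · simp [deformAmp, phaseShear_apply]

theorem dirDeriv_pos_deformAmp {g : Eucl n → ℂ} (hg : ContDiff ℝ ∞ g) (hc : ContDiff ℝ ∞ c)
    (hd : ContDiff ℝ ∞ d) (t : ℝ) (j : Fin n) :
    dirDeriv (posDir₃ j) (deformAmp g c d t) = fun z =>
      deformAmp (dirDeriv (stdVec j) g) c d t z + (deformAmp g (dirDeriv (posDir j) c) d t z +
        deformAmp g c (dirDeriv (posDir j) d) t z) := by
  have hg' := hg.differentiable (by simp)
  have hc' := hc.differentiable (by simp)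
  have hd' := hd.differentiable (by simp)
  have e0 := dirDeriv_comp_fst (W := Eucl n × Eucl n) hg' (posDir₃ j)
  have e1 := dirDeriv_comp_affine hc' (phaseShear 0) 0 (posDir₃ j)
  have e2 := dirDeriv_comp_affine hd' (phaseShear t) 0 (posDir₃ j)
  have s1 : ∀ t : ℝ, phaseShear t (posDir₃ j) = posDir j := fun t => by
    simp [phaseShear_apply, posDir₃, posDir]
  simp only [add_zero, s1] at e1 e2
  have f1 : Differentiable ℝ (fun z : Eucl n × Eucl n × Eucl n => c (phaseShear 0 z)) :=
    hc'.comp (phaseShear 0).differentiable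
  have f2 : Differentiable ℝ (fun z : Eucl n × Eucl n × Eucl n => d (phaseShear t z)) :=
    hd'.comp (phaseShear t).differentiable
  have f0 : Differentiable ℝ (fun z : Eucl n × Eucl n × Eucl n => g z.1) :=
    hg'.comp differentiable_fst
  have e3 : deformAmp g c d t = fun z => g z.1 * (c (phaseShear 0 z) * d (phaseShear t z)) := by
    funext z
    simp [deformAmp, phaseShear_apply]
  have f3 : Differentiable ℝ (fun z : Eucl n × Eucl n × Eucl n =>
    c (phaseShear 0 z) * d (phaseShear t z)) := f1.mul f2
  rw [e3, dirDeriv_mul f0 f3, e0, dirDeriv_mul f1 f2, e1, e2]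
  funext z
  simp only [deformAmp, phaseShear_apply, zero_smul, add_zero, posDir₃]
  ring

theorem hasDerivAt_deformAmp (g : Eucl n → ℂ) (hd : ContDiff ℝ ∞ d) (t : ℝ)
    (z : Eucl n × Eucl n × Eucl n) :
    HasDerivAt (fun s => deformAmp g c d s z) (∑ j, ((z.2.2 j - z.2.1 j : ℝ) : ℂ) *
      deformAmp g c (dirDeriv (freqDir j) d) t z) t := by
  have h1 : HasDerivAt (fun s : ℝ => (z.1, z.2.1 + s • (z.2.2 - z.2.1))) (0, z.2.2 - z.2.1) t := by
    refine (hasDerivAt_const t z.1).prodMk ?_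
    simpa using ((hasDerivAt_id t).smul_const (z.2.2 - z.2.1)).const_add z.2.1
  have h2 := ((hd.differentiable (by simp)) (z.1, z.2.1 + t • (z.2.2 - z.2.1))).hasFDerivAt
  have h3 := ((h2.comp_hasDerivAt t h1).const_mul (c (z.1, z.2.1))).const_mul (g z.1)
  refine h3.congr_deriv ?_
  have h4 : ((0, z.2.2 - z.2.1) : Eucl n × Eucl n) =
      ∑ j, (z.2.2 j - z.2.1 j) • freqDir j := by
    have := (EuclideanSpace.basisFun (Fin n) ℝ).sum_repr (z.2.2 - z.2.1)
    simp only [EuclideanSpace.basisFun_repr, EuclideanSpace.basisFun_apply] at this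
    refine Prod.ext ?_ ?_
    · simp [freqDir, Prod.fst_sum]
    · simp only [freqDir, Prod.snd_sum, Prod.smul_snd]
      exact this.symm
  rw [h4, map_sum]
  simp only [map_smul, Complex.real_smul, deformAmp, dirDeriv, Finset.mul_sum]
  exact Finset.sum_congr rfl fun j _ => by ring

/-- The dilated Schwartz function `x ↦ χ(ε x)`. -/
noncomputable def dilate (χ : 𝓢(Eucl n, ℂ)) {ε : ℝ} (hε : ε ≠ 0) : 𝓢(Eucl n, ℂ) :=
  SchwartzMap.compCLMOfContinuousLinearEquiv ℂ
    (ContinuousLinearEquiv.smulLeft (Units.mk0 ε hε)) χ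

theorem dilate_apply (χ : 𝓢(Eucl n, ℂ)) {ε : ℝ} (hε : ε ≠ 0) (x : Eucl n) :
    dilate χ hε x = χ (ε • x) := rfl

theorem symBound_dilate (Λ : Eucl n → ℝ) (χ : 𝓢(Eucl n, ℂ)) :
    SymBound ⊤ (fun (_ : Set.Ioc (0 : ℝ) 1) x => Λ x ^ (0 : ℝ)) (fun ε => dilate χ ε.2.1.ne') := by
  have h := (χ.symBound (T := Set.Ioc (0 : ℝ) 1) 0).comp_affine
    (fun ε => (ε : ℝ) • ContinuousLinearMap.id ℝ (Eucl n)) (fun _ => 0) (B := 1) fun ε => by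
      rw [norm_smul, Real.norm_of_nonneg ε.2.1.le]
      exact mul_le_one₀ ε.2.2 (norm_nonneg _) ContinuousLinearMap.norm_id_le
  refine (h.congr fun ε x => ?_).congr_weight fun ε x => by simp
  simp [dilate_apply]

theorem SymBound.param_mul {V : Type*} [NormedAddCommGroup V] [NormedSpace ℝ V] {N : ℕ∞}
    {M : T → V → ℝ} {f : T → V → ℂ} (h : SymBound N M f) (c : T → ℂ) :
    SymBound N (fun t z => ‖c t‖ * M t z) (fun t z => c t * f t z) := by
  refine ⟨fun t => contDiff_const.mul (h.1 t), fun k hk => ?_⟩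
  obtain ⟨C, hC, hb⟩ := h.2 k hk
  refine ⟨C, hC, fun t z => ?_⟩
  have := iteratedFDeriv_const_smul_apply (a := c t) (x := z) (i := k)
    ((h.1 t).contDiffAt.of_le (mod_cast le_top))
  change ‖iteratedFDeriv ℝ k (c t • f t) z‖ ≤ _
  rw [this, norm_smul, mul_left_comm]
  exact mul_le_mul_of_nonneg_left (hb t z) (norm_nonneg _)

/-- The derivative is bounded by a multiple of ε/(1 + ε|x|) ≤ 1/(1 + |x|), hence of Λ(x)^{-ρ}
because Λ^ρ grows at most linearly. So an x-derivative falling on the cutoff gains as much as one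
falling on a symbol, uniformly in ε. -/
theorem symBound_dirDeriv_dilate (hΛ : WeightBounds Λ ρ) (χ : 𝓢(Eucl n, ℂ)) (v : Eucl n) :
    SymBound ⊤ (fun (_ : Set.Ioc (0 : ℝ) 1) x => Λ x ^ (-ρ))
      (fun ε => dirDeriv v (dilate χ ε.2.1.ne')) := by
  obtain ⟨C, hC, hb⟩ := hΛ.growth_rho
  have h := ((schwartzDir v χ).symBound (T := Set.Ioc (0 : ℝ) 1) 1).comp_affine
    (fun ε => (ε : ℝ) • ContinuousLinearMap.id ℝ (Eucl n)) (fun _ => 0) (B := 1) fun ε => by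
      rw [norm_smul, Real.norm_of_nonneg ε.2.1.le]
      exact mul_le_one₀ ε.2.2 (norm_nonneg _) ContinuousLinearMap.norm_id_le
  refine ((h.param_mul (fun ε => ((ε : ℝ) : ℂ))).congr fun ε x => ?_).mono hC.le fun ε x => ?_
  · have e := dirDeriv_comp_affine (χ.smooth'.differentiable (by simp))
      ((ε : ℝ) • ContinuousLinearMap.id ℝ (Eucl n)) 0 v
    have e' : (dilate χ ε.2.1.ne' : Eucl n → ℂ) =
        fun z => χ (((ε : ℝ) • ContinuousLinearMap.id ℝ (Eucl n)) z + 0) := by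
      funext z
      simp [dilate_apply]
    rw [e']
    refine (congrFun e x).trans ?_
    simp only [add_zero, _root_.smul_apply, ContinuousLinearMap.coe_id', id_eq,
      schwartzDir_coe, dirDeriv, map_smul, Complex.real_smul]
    rfl
  · have h1 := hb x
    have h2 := hΛ.rpow_pos ρ x
    have hε := ε.2.1
    have h3 : (ε : ℝ) * (1 + ‖x‖) ≤ 1 + ε * ‖x‖ := by nlinarith [ε.2.2]
    simp only [Complex.norm_real, Real.norm_of_nonneg hε.le, pow_one, add_zero,
      _root_.smul_apply, ContinuousLinearMap.coe_id', id_eq, norm_smul]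
    rw [Real.rpow_neg (hΛ.pos x).le, ← div_eq_mul_inv, ← div_eq_mul_inv,
      div_le_div_iff₀ (by positivity) h2]
    calc (ε : ℝ) * Λ x ^ ρ ≤ ε * (C * (1 + ‖x‖)) := by gcongr
      _ = C * (ε * (1 + ‖x‖)) := by ring
      _ ≤ _ := by gcongr

theorem WeightBounds.decayAmp_of_ampWeight (hΛ : WeightBounds Λ ρ) {K : ℕ}
    {A : T → Eucl n × Eucl n × Eucl n → ℂ} (h : SymBound ⊤ (fun _ => ampWeight Λ k₁ k₂ K) A)
    (g : 𝓢(Eucl n, ℂ)) :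
    DecayAmp (fun _ q => Λ q.1 ^ k₁ * Λ q.2 ^ k₁ * (1 + ‖q.1 - q.2‖) ^ K)
      (fun t z => g z.1 * A t z) := by
  intro L
  obtain ⟨C, K', hC, hb⟩ := hΛ.growth (2 * k₂)
  have h1 := (g.symBound (T := T) (L + K')).comp_clm
    (ContinuousLinearMap.fst ℝ (Eucl n) (Eucl n × Eucl n))
  refine (h1.mul h).mono hC.le fun t z => ?_
  simp only [ContinuousLinearMap.coe_fst', ampWeight]
  have i1 := hΛ.rpow_pos k₁ z.2.1
  have i2 := hΛ.rpow_pos k₁ z.2.2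
  have h4 : (0 : ℝ) < (1 + ‖z.1‖) ^ K' := by positivity
  calc _ ≤ ((1 + ‖z.1‖) ^ (L + K'))⁻¹ * ((C * (1 + ‖z.1‖) ^ K') *
        (Λ z.2.1 ^ k₁ * Λ z.2.2 ^ k₁) * (1 + ‖z.2.1 - z.2.2‖) ^ K) := by
        gcongr
        exact hb _
    _ = _ := by
        rw [pow_add]
        field_simp

theorem WeightBounds.polyGrowth_freq (hΛ : WeightBounds Λ ρ) (k : ℝ) (K : ℕ) :
    PolyGrowth (fun q : Eucl n × Eucl n => Λ q.1 ^ k * Λ q.2 ^ k * (1 + ‖q.1 - q.2‖) ^ K) := by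
  obtain ⟨C, L, hC, hb⟩ := hΛ.growth k
  obtain ⟨D, J, hD⟩ := polyGrowth_diff (n := n) K
  refine ⟨C * C * D, L + J, fun q => ?_⟩
  have i1 := hΛ.rpow_pos k q.1
  have i2 := hΛ.rpow_pos k q.2
  calc _ ≤ (C * (1 + ‖q.1‖) ^ L) * (C * (1 + ‖q.2‖) ^ L) *
        (D * ((1 + ‖q.1‖) ^ J * (1 + ‖q.2‖) ^ J)) := by
        refine mul_le_mul (mul_le_mul (hb _) (hb _) i2.le (by positivity)) (hD q)
          (by positivity) (by positivity)
    _ = _ := by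
        rw [pow_add, pow_add]
        ring

theorem deformAmp_eq_mul (g : Eucl n → ℂ) (c d : Eucl n × Eucl n → ℂ) (t : ℝ) :
    deformAmp g c d t = fun z => g z.1 * deformAmp (fun _ => 1) c d t z := by
  funext z
  simp [deformAmp]

/-- This serves only to justify convergence and differentiation for a fixed cutoff; its bounds need
not be uniform in ε. The parameter interval is an open neighbourhood of [0, 1]. -/
theorem WeightBounds.decayAmp_deformAmp (hΛ : WeightBounds Λ ρ)
    (hc : SymBound ⊤ (fun _ : Unit => phaseWeight Λ p₁ p₂) (fun _ => c))
    (hd : SymBound ⊤ (fun _ : Unit => phaseWeight Λ q₁ q₂) (fun _ => d)) :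
    ∃ m : Eucl n × Eucl n → ℝ, PolyGrowth m ∧ (∀ q, 0 ≤ m q) ∧ ∀ g : 𝓢(Eucl n, ℂ),
      DecayAmp (fun _ => m) (fun t : Set.Ioo (-1 : ℝ) 2 => deformAmp g c d t) := by
  have h1 : SymBound ⊤ (fun (_ : Set.Ioo (-1 : ℝ) 2) x => Λ x ^ (0 : ℝ))
      (fun _ _ => (1 : ℂ)) := (SymBound.const (1 : ℂ)).congr_weight fun t x => Real.rpow_zero _
  obtain ⟨K, hK⟩ := hΛ.symBound_deformAmp h1 hc hd (τ := Subtype.val)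
    (fun t => abs_le.2 ⟨by linarith [t.2.1], t.2.2.le⟩) (k₁ := (p₁ + q₁) / 2)
    (k₂ := (p₂ + q₂ + 0) / 2) (by ring) (by ring)
  refine ⟨_, hΛ.polyGrowth_freq ((p₁ + q₁) / 2) K, fun q => ?_, fun g => ?_⟩
  · have i1 := hΛ.rpow_pos ((p₁ + q₁) / 2) q.1
    have i2 := hΛ.rpow_pos ((p₁ + q₁) / 2) q.2
    positivity
  · have h2 := hΛ.decayAmp_of_ampWeight hK g
    intro L
    exact (h2 L).congr fun t z => congrFun (deformAmp_eq_mul g c d t) z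

end SymbolDeformation

/-! ### The cost of exchanging composition and multiplication of symbols -/

section FrequencyExchange

open scoped SchwartzMap

variable {n : ℕ} {T : Type*} {Λ : Eucl n → ℝ} {ρ p₁ p₂ q₁ q₂ k₁ k₂ : ℝ}
  {c d : Eucl n × Eucl n → ℂ}

theorem PolyGrowth.add {m m' : Eucl n × Eucl n → ℝ} (h : PolyGrowth m) (h' : PolyGrowth m') :
    PolyGrowth (fun q => m q + m' q) := by
  obtain ⟨C, K, hC⟩ := h
  obtain ⟨C', K', hC'⟩ := h'
  refine ⟨|C| + |C'|, K + K', fun q => ?_⟩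
  have i1 : (1 : ℝ) ≤ 1 + ‖q.1‖ := by linarith [norm_nonneg q.1]
  have i2 : (1 : ℝ) ≤ 1 + ‖q.2‖ := by linarith [norm_nonneg q.2]
  have e1 : m q ≤ |C| * ((1 + ‖q.1‖) ^ (K + K') * (1 + ‖q.2‖) ^ (K + K')) := by
    refine (hC q).trans (mul_le_mul (le_abs_self C) ?_ (by positivity) (abs_nonneg _))
    gcongr <;> first | assumption | omega
  have e2 : m' q ≤ |C'| * ((1 + ‖q.1‖) ^ (K + K') * (1 + ‖q.2‖) ^ (K + K')) := by
    refine (hC' q).trans (mul_le_mul (le_abs_self C') ?_ (by positivity) (abs_nonneg _))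
    gcongr <;> first | assumption | omega
  calc _ ≤ _ := add_le_add e1 e2
    _ = _ := by ring

theorem PolyGrowth.sum {ι : Type*} (s : Finset ι) {m : ι → Eucl n × Eucl n → ℝ}
    (h : ∀ i, PolyGrowth (m i)) : PolyGrowth (fun q => ∑ i ∈ s, m i q) := by
  classical
  induction s using Finset.induction_on with
  | empty => exact ⟨0, 0, fun q => by simp⟩
  | insert i s hi ih =>
    simp only [Finset.sum_insert hi]
    exact (h i).add ih

theorem DecayAmp.mono {m m' : T → Eucl n × Eucl n → ℝ} {A : T → Eucl n × Eucl n × Eucl n → ℂ}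
    (h : DecayAmp m A) (hm : ∀ t q, m t q ≤ m' t q) : DecayAmp m' A := fun L =>
  (h L).mono zero_le_one fun t z => by
    rw [one_mul]
    exact mul_le_mul_of_nonneg_left (hm t z.2) (by positivity)

theorem WeightBounds.ampWeight_mono (hΛ : WeightBounds Λ ρ) (k₁ k₂ : ℝ) {K K' : ℕ} (h : K ≤ K')
    (z : Eucl n × Eucl n × Eucl n) : ampWeight Λ k₁ k₂ K z ≤ 1 * ampWeight Λ k₁ k₂ K' z := by
  have i1 := hΛ.rpow_pos k₁ z.2.1
  have i2 := hΛ.rpow_pos k₁ z.2.2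
  have i3 := hΛ.rpow_pos (2 * k₂) z.1
  have i4 : (1 : ℝ) ≤ 1 + ‖z.2.1 - z.2.2‖ := by linarith [norm_nonneg (z.2.1 - z.2.2)]
  unfold ampWeight
  rw [one_mul]
  gcongr

/-- The x-derivative falls on the cutoff, on c, or on ∂_{ξ_j} d. In each case the total order drops
by ρ in x and ρ in ξ, that is, by ρ/2 for each of the two factors of the quadratic form. -/
theorem WeightBounds.exists_symBound_pos_deformAmp (hΛ : WeightBounds Λ ρ) (χ : 𝓢(Eucl n, ℂ))
    (hc : SGFamily Λ ρ p₁ p₂ (fun _ : Unit => c)) (hd : SGFamily Λ ρ q₁ q₂ (fun _ : Unit => d))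
    (h₁ : p₁ + q₁ = 2 * k₁) (h₂ : p₂ + q₂ = 2 * k₂) (j : Fin n) :
    ∃ K : ℕ, SymBound ⊤ (fun _ => ampWeight Λ (k₁ - ρ / 2) (k₂ - ρ / 2) K)
      (fun τ : Set.Ioc (0 : ℝ) 1 × Set.Ioo (-1 : ℝ) 2 => dirDeriv (posDir₃ j)
        (deformAmp (dilate χ τ.1.2.1.ne') c (dirDeriv (freqDir j) d) τ.2)) := by
  have g0 := (symBound_dilate Λ χ).reparam
    (Prod.fst : Set.Ioc (0 : ℝ) 1 × Set.Ioo (-1 : ℝ) 2 → _)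
  have g1 := (symBound_dirDeriv_dilate hΛ χ (stdVec j)).reparam
    (Prod.fst : Set.Ioc (0 : ℝ) 1 × Set.Ioo (-1 : ℝ) 2 → _)
  have hτ : ∀ τ : Set.Ioc (0 : ℝ) 1 × Set.Ioo (-1 : ℝ) 2, |(τ.2 : ℝ)| ≤ 2 :=
    fun τ => abs_le.2 ⟨by linarith [τ.2.2.1], τ.2.2.2.le⟩
  obtain ⟨K₁, a1⟩ := hΛ.symBound_deformAmp g1 hc.base (hd.freq j) hτ (k₁ := k₁ - ρ / 2)
    (k₂ := k₂ - ρ / 2) (by linarith) (by linarith)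
  obtain ⟨K₂, a2⟩ := hΛ.symBound_deformAmp g0 (hc.pos j) (hd.freq j) hτ (k₁ := k₁ - ρ / 2)
    (k₂ := k₂ - ρ / 2) (by linarith) (by linarith)
  obtain ⟨K₃, a3⟩ := hΛ.symBound_deformAmp g0 hc.base (hd.mixed j) hτ (k₁ := k₁ - ρ / 2)
    (k₂ := k₂ - ρ / 2) (by linarith) (by linarith)
  have b1 := a1.mono zero_le_one fun t z => hΛ.ampWeight_mono _ _ (K' := K₁ + K₂ + K₃) (by omega) z
  have b2 := a2.mono zero_le_one fun t z => hΛ.ampWeight_mono _ _ (K' := K₁ + K₂ + K₃) (by omega) z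
  have b3 := a3.mono zero_le_one fun t z => hΛ.ampWeight_mono _ _ (K' := K₁ + K₂ + K₃) (by omega) z
  refine ⟨K₁ + K₂ + K₃, (b1.add (b2.add b3)).congr fun τ z => ?_⟩
  exact congrFun (dirDeriv_pos_deformAmp (dilate χ τ.1.2.1.ne').smooth' (hc.base.contDiff ())
    ((hd.freq j).contDiff ()) τ.2 j) z

/-- The mean value inequality on [0, 1]: the t-derivative is a sum of forms whose amplitudes have
the lowered order, uniformly in t and in the cutoff scale. -/
theorem WeightBounds.norm_integral_deformAmp_sub_le (hΛ : WeightBounds Λ ρ) (χ : 𝓢(Eucl n, ℂ))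
    (hc : SGFamily Λ ρ p₁ p₂ (fun _ : Unit => c)) (hd : SGFamily Λ ρ q₁ q₂ (fun _ : Unit => d))
    (h₁ : p₁ + q₁ = 2 * k₁) (h₂ : p₂ + q₂ = 2 * k₂) :
    ∃ C : ℝ, 0 ≤ C ∧ ∀ (ε : Set.Ioc (0 : ℝ) 1) (φ : 𝓢(Eucl n, ℂ)),
      ‖(∫ x, freqForm (deformAmp (dilate χ ε.2.1.ne') c d 1) (schwartzHat φ) (schwartzHat φ) x) -
        ∫ x, freqForm (deformAmp (dilate χ ε.2.1.ne') c d 0) (schwartzHat φ) (schwartzHat φ) x‖ ≤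
      C * sobolevNorm Λ (k₁ - ρ / 2) (k₂ - ρ / 2) 2 φ ^ 2 := by
  choose K hK using fun j => hΛ.exists_symBound_pos_deformAmp χ hc hd h₁ h₂ j
  choose C hC hCb using fun j => hΛ.norm_integral_freqForm_le (hK j)
  refine ⟨∑ j, C j, Finset.sum_nonneg fun j _ => hC j, fun ε φ => ?_⟩
  have hd' := fun j => hΛ.decayAmp_deformAmp hc.base (hd.freq j)
  obtain ⟨m₀, hm₀, hm₀p, hA⟩ := hΛ.decayAmp_deformAmp hc.base hd.base
  choose m' hm' hm'p hB using hd'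
  set m : Eucl n × Eucl n → ℝ := fun q => m₀ q + ∑ j, m' j q with hm
  have hmp : PolyGrowth m := hm₀.add (PolyGrowth.sum _ hm')
  have hsum : ∀ q, 0 ≤ ∑ j, m' j q := fun q => Finset.sum_nonneg fun j _ => hm'p j q
  have hA1 := (hA (dilate χ ε.2.1.ne')).mono (m' := fun _ => m) fun _ q => by
    linarith [hsum q]
  have hB1 := fun j => (hB j (dilate χ ε.2.1.ne')).mono (m' := fun _ => m) fun _ q => by
    have := Finset.single_le_sum (f := fun j => m' j q) (fun j _ => hm'p j q) (Finset.mem_univ j)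
    linarith [hm₀p q]
  have hder := fun t (ht : t ∈ Set.Ioo (-1 : ℝ) 2) => hasDerivAt_integral_freqForm hmp
    (fun q => add_nonneg (hm₀p q) (hsum q)) isOpen_Ioo hA1 hB1
    (fun s _ z => hasDerivAt_deformAmp (dilate χ ε.2.1.ne') (hd.base.contDiff ()) s z)
    (schwartzHat φ) ht
  refine norm_image_sub_le_of_norm_deriv_le_segment_01' (f := fun t =>
    ∫ x, freqForm (deformAmp (dilate χ ε.2.1.ne') c d t) (schwartzHat φ) (schwartzHat φ) x)
    (fun t ht => (hder t ⟨by linarith [ht.1], by linarith [ht.2]⟩).hasDerivWithinAt)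
    fun t ht => ?_
  have ht' : t ∈ Set.Ioo (-1 : ℝ) 2 := ⟨by linarith [ht.1], by linarith [ht.2]⟩
  rw [norm_mul, norm_neg, Complex.norm_I, one_mul, Finset.sum_mul]
  refine norm_sum_le_of_le _ fun j _ => hCb j (ε, ⟨t, ht'⟩) φ ?_
  exact ((hB1 j).dir (posDir₃ j)).integrable_freqForm (fun _ => hmp) ⟨t, ht'⟩ _ _

end FrequencyExchange

/-! ### Gårding's inequality with loss ρ/2 in both orders -/

section Garding

open scoped SchwartzMap

variable {n : ℕ} {Λ : Eucl n → ℝ} {ρ m₁ m₂ k₁ k₂ : ℝ}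

/-- The unnormalized operator `∫ e^{i x·ξ} c(x, ξ) φ̂(ξ) dξ`. -/
noncomputable def symbolInt (c : Eucl n × Eucl n → ℂ) (φ : 𝓢(Eucl n, ℂ)) (x : Eucl n) : ℂ :=
  ∫ ξ, planeWave x ξ * c (x, ξ) * schwartzHat φ ξ

theorem pseudoDiffOp_eq_symbolInt (σ : Eucl n → Eucl n → ℂ) (φ : 𝓢(Eucl n, ℂ)) (x : Eucl n) :
    pseudoDiffOp σ φ x = fourierConst n * symbolInt (Function.uncurry σ) φ x := by
  unfold pseudoDiffOp symbolInt fourierConst planeWave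
  rw [schwartzHat_eq]
  rfl

theorem symbolInt_one (φ : 𝓢(Eucl n, ℂ)) (x : Eucl n) :
    fourierConst n * symbolInt (fun _ => 1) φ x = φ x := by
  rw [← integral_schwartzHat_inv φ x]
  unfold symbolInt planeWave
  simp only [mul_one]

/-- At t = 1 the second symbol depends on η alone, so the double frequency integral factors. -/
theorem freqForm_deformAmp_one (g : Eucl n → ℂ) (c d : Eucl n × Eucl n → ℂ) (φ : 𝓢(Eucl n, ℂ))
    (x : Eucl n) :
    freqForm (deformAmp g c d 1) (schwartzHat φ) (schwartzHat φ) x =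
      g x * (symbolInt c φ x *
        starRingEnd ℂ (symbolInt (fun z => starRingEnd ℂ (d z)) φ x)) := by
  unfold freqForm symbolInt
  rw [← integral_conj, ← integral_prod_mul, ← integral_const_mul, Measure.volume_eq_prod]
  refine integral_congr_ae (Filter.Eventually.of_forall fun q => ?_)
  simp only [deformAmp, one_smul, add_sub_cancel, planeWave_sub_right, map_mul, conj_planeWave,
    Complex.conj_conj]
  ring

/-- The quadratic form of the symbol `s`, cut off in position by `g`. -/
noncomputable def cutForm (g : Eucl n → ℂ) (s : Eucl n × Eucl n → ℂ) (φ : 𝓢(Eucl n, ℂ)) : ℂ :=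
  ∫ x, freqForm (fun z => g z.1 * s (z.1, z.2.1)) (schwartzHat φ) (schwartzHat φ) x

theorem cutForm_mul (g : Eucl n → ℂ) (c d : Eucl n × Eucl n → ℂ) (φ : 𝓢(Eucl n, ℂ)) :
    cutForm g (fun z => c z * d z) φ =
      ∫ x, freqForm (deformAmp g c d 0) (schwartzHat φ) (schwartzHat φ) x := by
  unfold cutForm deformAmp
  simp only [zero_smul, add_zero]

theorem cutForm_eq (g : Eucl n → ℂ) (s : Eucl n × Eucl n → ℂ) (φ : 𝓢(Eucl n, ℂ)) :
    cutForm g s φ = ∫ x, g x * (symbolInt s φ x * starRingEnd ℂ (symbolInt (fun _ => 1) φ x)) := by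
  unfold cutForm
  refine integral_congr_ae (Filter.Eventually.of_forall fun x => ?_)
  have h := freqForm_deformAmp_one g s (fun _ => 1) φ x
  simp only [map_one] at h
  refine Eq.trans ?_ h
  unfold deformAmp
  simp only [mul_one]

theorem WeightBounds.sgFamily_one (hΛ : WeightBounds Λ ρ) :
    SGFamily Λ ρ 0 0 (fun (_ : Unit) (_ : Eucl n × Eucl n) => (1 : ℂ)) := by
  have h := (SGFamily.phaseWeight (T := Unit) hΛ 0 0).clm_comp Complex.ofRealCLM
  have e : (fun (_ : Unit) z => Complex.ofRealCLM (phaseWeight Λ 0 0 z)) =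
      fun (_ : Unit) (_ : Eucl n × Eucl n) => (1 : ℂ) := by
    funext t z
    simp [phaseWeight]
  rwa [e] at h

theorem WeightBounds.integrable_cutForm (hΛ : WeightBounds Λ ρ) (g : 𝓢(Eucl n, ℂ))
    {s : Eucl n × Eucl n → ℂ} (hs : SGFamily Λ ρ k₁ k₂ (fun _ : Unit => s)) (φ : 𝓢(Eucl n, ℂ)) :
    Integrable (fun z : Eucl n × Eucl n × Eucl n => planeWave z.1 (z.2.1 - z.2.2) *
      (g z.1 * s (z.1, z.2.1)) * (schwartzHat φ z.2.1 * starRingEnd ℂ (schwartzHat φ z.2.2))) ∧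
    cutForm g s φ = ∫ z : Eucl n × Eucl n × Eucl n, planeWave z.1 (z.2.1 - z.2.2) *
      (g z.1 * s (z.1, z.2.1)) * (schwartzHat φ z.2.1 * starRingEnd ℂ (schwartzHat φ z.2.2)) := by
  obtain ⟨m, hm, -, h⟩ := hΛ.decayAmp_deformAmp hs.base hΛ.sgFamily_one.base
  have h0 : (0 : ℝ) ∈ Set.Ioo (-1 : ℝ) 2 := by norm_num
  have h1 := (h g).integrable_phase (fun _ => hm) ⟨0, h0⟩ (schwartzHat φ) (schwartzHat φ)
  have h2 := (h g).integral_freqForm (fun _ => hm) ⟨0, h0⟩ (schwartzHat φ) (schwartzHat φ)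
  simp only [deformAmp, mul_one] at h1 h2
  refine ⟨h1, Eq.trans ?_ h2⟩
  rw [← cutForm_mul]
  simp only [mul_one]

theorem WeightBounds.integrable_freqForm_deformAmp_zero (hΛ : WeightBounds Λ ρ)
    (g : 𝓢(Eucl n, ℂ)) {s : Eucl n × Eucl n → ℂ}
    (hs : SGFamily Λ ρ k₁ k₂ (fun _ : Unit => s)) (φ : 𝓢(Eucl n, ℂ)) :
    Integrable (freqForm (deformAmp g s (fun _ => 1) 0) (schwartzHat φ) (schwartzHat φ)) := by
  obtain ⟨m, hm, -, h⟩ := hΛ.decayAmp_deformAmp hs.base hΛ.sgFamily_one.base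
  exact (h g).integrable_freqForm (fun _ => hm) ⟨0, by norm_num⟩ _ _

theorem WeightBounds.cutForm_add (hΛ : WeightBounds Λ ρ) (g : 𝓢(Eucl n, ℂ))
    {s s' : Eucl n × Eucl n → ℂ} {k₁' k₂' : ℝ} (hs : SGFamily Λ ρ k₁ k₂ (fun _ : Unit => s))
    (hs' : SGFamily Λ ρ k₁' k₂' (fun _ : Unit => s')) (φ : 𝓢(Eucl n, ℂ)) :
    cutForm g (fun z => s z + s' z) φ = cutForm g s φ + cutForm g s' φ := by
  obtain ⟨i1, e1⟩ := hΛ.integrable_cutForm g hs φ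
  obtain ⟨i2, e2⟩ := hΛ.integrable_cutForm g hs' φ
  rw [e1, e2, ← integral_add i1 i2]
  have i3 := i1.add i2
  have e3 := integral_integral (f := fun x (q : Eucl n × Eucl n) => planeWave x (q.1 - q.2) *
      (g x * (s (x, q.1) + s' (x, q.1))) * (schwartzHat φ q.1 * starRingEnd ℂ (schwartzHat φ q.2)))
      (μ := volume) (ν := volume) (i3.congr (Filter.Eventually.of_forall fun z => by
        simp only [Pi.add_apply, Function.uncurry]
        ring))
  refine e3.trans (integral_congr_ae (Filter.Eventually.of_forall fun z => ?_))
  simp only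
  ring

theorem cutForm_const_mul (g : Eucl n → ℂ) (c : ℂ) (s : Eucl n × Eucl n → ℂ) (φ : 𝓢(Eucl n, ℂ)) :
    cutForm g (fun z => c * s z) φ = c * cutForm g s φ := by
  unfold cutForm freqForm
  simp only [← integral_const_mul]
  refine integral_congr_ae (Filter.Eventually.of_forall fun x => ?_)
  refine integral_congr_ae (Filter.Eventually.of_forall fun q => ?_)
  simp only
  ring

theorem re_integral_cutoff_mul_normSq_nonneg {g : Eucl n → ℂ} (hg : ∀ x, g x = ((g x).re : ℂ))
    (hg0 : ∀ x, 0 ≤ (g x).re) (P : Eucl n → ℂ) :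
    0 ≤ (∫ x, g x * (P x * starRingEnd ℂ (P x))).re := by
  have e : ∀ x, g x * (P x * starRingEnd ℂ (P x)) = (((g x).re * Complex.normSq (P x) : ℝ) : ℂ) := by
    intro x
    rw [Complex.mul_conj, Complex.ofReal_mul, ← hg x]
  simp only [e]
  rw [integral_complex_ofReal, Complex.ofReal_re]
  exact integral_nonneg fun x => mul_nonneg (hg0 x) (Complex.normSq_nonneg _)

/-- Dominated convergence: χ is bounded and χ(x/(k+1)) tends to χ(0) = 1. -/
theorem tendsto_integral_dilate (χ : 𝓢(Eucl n, ℂ)) (h0 : χ 0 = 1) {F : Eucl n → ℂ}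
    (hF : Integrable F) :
    Filter.Tendsto (fun k : ℕ => ∫ x, dilate χ (Nat.one_div_pos_of_nat (α := ℝ) (n := k)).ne' x * F x)
      Filter.atTop (nhds (∫ x, F x)) := by
  obtain ⟨B, hB, hb⟩ := (χ.symBound (T := Unit) 0).norm_le
  refine tendsto_integral_of_dominated_convergence (fun x => B * ‖F x‖) (fun k => ?_)
    (hF.norm.const_mul B) (fun k => Filter.Eventually.of_forall fun x => ?_)
    (Filter.Eventually.of_forall fun x => ?_)
  · exact (SchwartzMap.continuous _).aestronglyMeasurable.mul hF.aestronglyMeasurable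
  · rw [norm_mul, dilate_apply]
    have := hb () ((1 / ((k : ℝ) + 1)) • x)
    simp only [pow_zero, inv_one, mul_one] at this
    gcongr
  · have h1 : Filter.Tendsto (fun k : ℕ => χ ((1 / ((k : ℝ) + 1)) • x)) Filter.atTop
        (nhds (χ ((0 : ℝ) • x))) :=
      (χ.continuous.tendsto _).comp (tendsto_one_div_add_atTop_nhds_zero_nat.smul_const x)
    rw [zero_smul, h0] at h1
    simpa only [one_mul, dilate_apply] using h1.mul_const (F x)

theorem WeightBounds.integrable_symbolInt_mul (hΛ : WeightBounds Λ ρ)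
    {s : Eucl n × Eucl n → ℂ} (hs : SGFamily Λ ρ k₁ k₂ (fun _ : Unit => s))
    (φ ψ : 𝓢(Eucl n, ℂ)) :
    Integrable (fun x => symbolInt s φ x * starRingEnd ℂ (ψ x)) := by
  obtain ⟨C, hC, hb⟩ := hs.base.norm_le
  have hcont := hs.base.continuous ()
  have hmeas : AEStronglyMeasurable (symbolInt s φ) volume := by
    refine (StronglyMeasurable.integral_prod_right' (f := fun z : Eucl n × Eucl n =>
      planeWave z.1 z.2 * s z * schwartzHat φ z.2) ?_).aestronglyMeasurable
    exact ((continuous_planeWave_uncurry.mul hcont).mul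
      ((schwartzHat φ).continuous.comp continuous_snd)).stronglyMeasurable
  have hφ : Integrable (fun ξ => Λ ξ ^ k₁ * ‖schwartzHat φ ξ‖) := by
    have := (SchwartzMap.smulLeftCLM ℂ (fun ξ => Λ ξ ^ k₁) (schwartzHat φ)).integrable
      (μ := volume) |>.norm
    refine this.congr (Filter.Eventually.of_forall fun ξ => ?_)
    simp only
    rw [SchwartzMap.smulLeftCLM_apply_apply (hΛ.hasTemperateGrowth_rpow k₁), norm_smul,
      Real.norm_of_nonneg (hΛ.rpow_pos _ _).le]
  have hψ : Integrable (fun x => Λ x ^ k₂ * ‖ψ x‖) := by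
    have := (SchwartzMap.smulLeftCLM ℂ (fun ξ => Λ ξ ^ k₂) ψ).integrable (μ := volume) |>.norm
    refine this.congr (Filter.Eventually.of_forall fun ξ => ?_)
    simp only
    rw [SchwartzMap.smulLeftCLM_apply_apply (hΛ.hasTemperateGrowth_rpow k₂), norm_smul,
      Real.norm_of_nonneg (hΛ.rpow_pos _ _).le]
  refine (hψ.const_mul (C * ∫ ξ, Λ ξ ^ k₁ * ‖schwartzHat φ ξ‖)).mono'
    (hmeas.mul (Complex.continuous_conj.comp ψ.continuous).aestronglyMeasurable)
    (Filter.Eventually.of_forall fun x => ?_)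
  have h1 : ‖symbolInt s φ x‖ ≤ (C * Λ x ^ k₂) * ∫ ξ, Λ ξ ^ k₁ * ‖schwartzHat φ ξ‖ := by
    rw [← integral_const_mul]
    refine norm_integral_le_of_norm_le (hφ.const_mul _) (Filter.Eventually.of_forall fun ξ => ?_)
    rw [norm_mul, norm_mul, norm_planeWave, one_mul]
    calc _ ≤ (C * phaseWeight Λ k₁ k₂ (x, ξ)) * ‖schwartzHat φ ξ‖ := by
          gcongr
          exact hb () _
      _ = _ := by
          simp only [phaseWeight]
          ring
  rw [norm_mul, RCLike.norm_conj]
  calc _ ≤ ((C * Λ x ^ k₂) * ∫ ξ, Λ ξ ^ k₁ * ‖schwartzHat φ ξ‖) * ‖ψ x‖ := by gcongr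
    _ = _ := by ring

/-- Where ellipticity may fail, both |x| and |ξ| are at most |R|. There ω² = Λ(x)^ρ Λ(ξ)^ρ θ is at
most a constant times θ, so a large multiple of the lower-order weight repairs the lower bound. -/
theorem WeightBounds.exists_elliptic_shift (hΛ : WeightBounds Λ ρ) {σ : Eucl n × Eucl n → ℂ}
    (hσ : SGFamily Λ ρ (2 * m₁) (2 * m₂) (fun _ : Unit => σ)) {c R : ℝ} (hc : 0 < c)
    (hell : ∀ z : Eucl n × Eucl n, R ^ 2 ≤ ‖z.1‖ ^ 2 + ‖z.2‖ ^ 2 →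
      2 * c * phaseWeight Λ (2 * m₁) (2 * m₂) z ≤ (σ z).re) :
    ∃ κ : ℝ, ∀ z, c * phaseWeight Λ (2 * m₁) (2 * m₂) z ≤
      (σ z).re + (-c * phaseWeight Λ (2 * m₁) (2 * m₂) z +
        κ * phaseWeight Λ (2 * m₁ - ρ) (2 * m₂ - ρ) z) := by
  obtain ⟨D, hD, hb⟩ := hσ.base.norm_le
  obtain ⟨G, hG, hg⟩ := hΛ.growth_rho
  -- D compensates for the most negative value of Re σ relative to the weight, and 2c for the two
  -- terms c ω²; the square bounds Λ(x)^ρ Λ(ξ)^ρ in the exceptional region.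
  refine ⟨(D + 2 * c) * (G * (1 + |R|)) ^ 2, fun z => ?_⟩
  have hω := phaseWeight_pos hΛ (2 * m₁) (2 * m₂) z
  have hθ := phaseWeight_pos hΛ (2 * m₁ - ρ) (2 * m₂ - ρ) z
  by_cases hz : R ^ 2 ≤ ‖z.1‖ ^ 2 + ‖z.2‖ ^ 2
  · have h1 := hell z hz
    have h2 : 0 ≤ (D + 2 * c) * (G * (1 + |R|)) ^ 2 * phaseWeight Λ (2 * m₁ - ρ) (2 * m₂ - ρ) z := by
      positivity
    linarith
  · push Not at hz
    have b1 : ‖z.1‖ ≤ |R| := abs_le_of_sq_le_sq (by rw [sq_abs]; nlinarith [sq_nonneg ‖z.2‖])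
      (abs_nonneg R) |> (le_abs_self _).trans
    have b2 : ‖z.2‖ ≤ |R| := abs_le_of_sq_le_sq (by rw [sq_abs]; nlinarith [sq_nonneg ‖z.1‖])
      (abs_nonneg R) |> (le_abs_self _).trans
    have h1 : phaseWeight Λ (2 * m₁) (2 * m₂) z ≤
        (G * (1 + |R|)) ^ 2 * phaseWeight Λ (2 * m₁ - ρ) (2 * m₂ - ρ) z := by
      have e : phaseWeight Λ (2 * m₁) (2 * m₂) z =
          Λ z.1 ^ ρ * Λ z.2 ^ ρ * phaseWeight Λ (2 * m₁ - ρ) (2 * m₂ - ρ) z := by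
        have := phaseWeight_mul hΛ ρ ρ (2 * m₁ - ρ) (2 * m₂ - ρ) z
        rw [add_sub_cancel, add_sub_cancel] at this
        rw [← this]
        rfl
      rw [e, sq]
      have i1 := hΛ.rpow_pos ρ z.1
      have i2 := hΛ.rpow_pos ρ z.2
      gcongr
      · exact (hg _).trans (by gcongr)
      · exact (hg _).trans (by gcongr)
    have h2 : -(D * phaseWeight Λ (2 * m₁) (2 * m₂) z) ≤ (σ z).re :=
      (abs_le.1 ((Complex.abs_re_le_norm _).trans (hb () z))).1
    have h3 := mul_le_mul_of_nonneg_left h1 (show 0 ≤ D + 2 * c by positivity)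
    linarith

theorem symbolInt_phaseWeight (hΛ : WeightBounds Λ ρ) (m₁ m₂ : ℝ) (φ : 𝓢(Eucl n, ℂ)) (x : Eucl n) :
    fourierConst n * symbolInt (fun z => (phaseWeight Λ m₁ m₂ z : ℂ)) φ x =
      ((Λ x ^ m₂ : ℝ) : ℂ) * weightLift Λ m₁ φ x := by
  rw [← integral_schwartzHat_inv (weightLift Λ m₁ φ) x, mul_left_comm, ← integral_const_mul]
  unfold symbolInt planeWave phaseWeight
  congr 1
  refine integral_congr_ae (Filter.Eventually.of_forall fun ξ => ?_)
  simp only [hΛ.schwartzHat_weightLift]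
  push_cast
  ring

theorem WeightBounds.norm_cutForm_le (hΛ : WeightBounds Λ ρ) (χ : 𝓢(Eucl n, ℂ))
    {s : Eucl n × Eucl n → ℂ}
    (hs : SGFamily Λ ρ (2 * k₁) (2 * k₂) (fun _ : Unit => s)) :
    ∃ C : ℝ, 0 ≤ C ∧ ∀ (ε : Set.Ioc (0 : ℝ) 1) (φ : 𝓢(Eucl n, ℂ)),
      ‖cutForm (dilate χ ε.2.1.ne') s φ‖ ≤ C * sobolevNorm Λ k₁ k₂ 2 φ ^ 2 := by
  obtain ⟨K, hK⟩ := hΛ.symBound_deformAmp (symBound_dilate Λ χ) hs.base hΛ.sgFamily_one.base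
    (τ := fun _ => 0) (fun _ => by norm_num) (k₁ := k₁) (k₂ := k₂) (by ring) (by ring)
  obtain ⟨C, hC, hb⟩ := hΛ.norm_integral_freqForm_le hK
  refine ⟨C, hC, fun ε φ => ?_⟩
  have h1 := hb ε φ (hΛ.integrable_freqForm_deformAmp_zero _ hs φ)
  rw [← cutForm_mul] at h1
  simpa only [mul_one] using h1

theorem re_integral_conj_swap {g : Eucl n → ℂ} (hg : ∀ x, g x = ((g x).re : ℂ))
    (P Q : Eucl n → ℂ) : (∫ x, g x * (P x * starRingEnd ℂ (Q x))).re =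
      (∫ x, g x * (Q x * starRingEnd ℂ (P x))).re := by
  rw [← Complex.conj_re, ← integral_conj]
  congr 1
  refine integral_congr_ae (Filter.Eventually.of_forall fun x => ?_)
  have : starRingEnd ℂ (g x) = g x := by rw [hg x, Complex.conj_ofReal]
  simp only [map_mul, Complex.conj_conj, this]
  ring

/-- With b = f^{1/2}, the cut-off integral of |T_b φ|² is nonnegative and agrees up to lower order
with the form of b² = Re σ - c ω² + κ θ. Writing Re σ as half of σ plus its conjugate, and
exchanging the remaining forms in the same way, isolates the real part of the form of σ. -/
theorem WeightBounds.garding_cutoff (hΛ : WeightBounds Λ ρ) {χ : 𝓢(Eucl n, ℂ)}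
    (hχr : ∀ x, χ x = ((χ x).re : ℂ)) (hχ0 : ∀ x, 0 ≤ (χ x).re) {σ : Eucl n × Eucl n → ℂ}
    (hσ : SGFamily Λ ρ (2 * m₁) (2 * m₂) (fun _ : Unit => σ)) {c R : ℝ}
    (hc : 0 < c) (hell : ∀ z : Eucl n × Eucl n, R ^ 2 ≤ ‖z.1‖ ^ 2 + ‖z.2‖ ^ 2 →
      2 * c * phaseWeight Λ (2 * m₁) (2 * m₂) z ≤ (σ z).re) :
    ∃ C : ℝ, 0 ≤ C ∧ ∀ (ε : Set.Ioc (0 : ℝ) 1) (φ : 𝓢(Eucl n, ℂ)),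
      c * (∫ x, dilate χ ε.2.1.ne' x * (symbolInt (fun z => (phaseWeight Λ m₁ m₂ z : ℂ)) φ x *
          starRingEnd ℂ (symbolInt (fun z => (phaseWeight Λ m₁ m₂ z : ℂ)) φ x))).re -
        C * sobolevNorm Λ (m₁ - ρ / 2) (m₂ - ρ / 2) 2 φ ^ 2 ≤
      (cutForm (dilate χ ε.2.1.ne') σ φ).re := by
  obtain ⟨κ, hκ⟩ := hΛ.exists_elliptic_shift hσ hc hell
  have hρ := hΛ.rho_pos
  have hω2 := SGFamily.phaseWeight (T := Unit) hΛ (2 * m₁) (2 * m₂)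
  have hθ := SGFamily.phaseWeight (T := Unit) hΛ (2 * m₁ - ρ) (2 * m₂ - ρ)
  have hf := (hσ.clm_comp Complex.reCLM).add ((hω2.clm_comp (ContinuousLinearMap.mul ℝ ℝ (-c))).add
    ((hθ.mono hΛ (by linarith : _ ≤ 2 * m₁) (by linarith : _ ≤ 2 * m₂)).clm_comp
      (ContinuousLinearMap.mul ℝ ℝ κ)))
  simp only [ContinuousLinearMap.mul_apply', Complex.reCLM_apply] at hf
  set f : Eucl n × Eucl n → ℝ := fun z => (σ z).re +
    (-c * phaseWeight Λ (2 * m₁) (2 * m₂) z + κ * phaseWeight Λ (2 * m₁ - ρ) (2 * m₂ - ρ) z) with hfdef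
  have hfpos : ∀ z, 0 < f z := fun z =>
    (mul_pos hc (phaseWeight_pos hΛ _ _ z)).trans_le (hκ z)
  have hb := (hf.rpow_of_elliptic hΛ hc (fun _ z => hκ z) (1 / 2)).clm_comp Complex.ofRealCLM
  have hω := (SGFamily.phaseWeight (T := Unit) hΛ m₁ m₂).clm_comp Complex.ofRealCLM
  have hω2c := hω2.clm_comp Complex.ofRealCLM
  have hθc := hθ.clm_comp Complex.ofRealCLM
  have hconj := hσ.clm_comp (Complex.conjCLE : ℂ →L[ℝ] ℂ)
  obtain ⟨C₁, hC₁, k1⟩ := hΛ.norm_integral_deformAmp_sub_le χ hb hb (k₁ := m₁) (k₂ := m₂)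
    (by ring) (by ring)
  obtain ⟨C₂, hC₂, k2⟩ := hΛ.norm_integral_deformAmp_sub_le χ hω hω (k₁ := m₁) (k₂ := m₂)
    (by ring) (by ring)
  -- With first symbol 1 and second symbol conj σ, the endpoint t = 1 is the conjugate of the form
  -- of σ and t = 0 is the form of conj σ. The adjoint thus needs no separate argument.
  obtain ⟨C₃, hC₃, k3⟩ := hΛ.norm_integral_deformAmp_sub_le χ hΛ.sgFamily_one hconj (k₁ := m₁)
    (k₂ := m₂) (by ring) (by ring)
  have hθ' : SGFamily Λ ρ (2 * (m₁ - ρ / 2)) (2 * (m₂ - ρ / 2)) (fun (_ : Unit) z =>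
      Complex.ofRealCLM (phaseWeight Λ (2 * m₁ - ρ) (2 * m₂ - ρ) z)) := by
    have e1 : 2 * (m₁ - ρ / 2) = 2 * m₁ - ρ := by ring
    have e2 : 2 * (m₂ - ρ / 2) = 2 * m₂ - ρ := by ring
    rwa [e1, e2]
  obtain ⟨C₄, hC₄, k4⟩ := hΛ.norm_cutForm_le χ hθ'
  refine ⟨C₁ + c * C₂ + C₃ / 2 + |κ| * C₄, by positivity, fun ε φ => ?_⟩
  set g := dilate χ ε.2.1.ne' with hg
  have hgr : ∀ x, g x = ((g x).re : ℂ) := fun x => hχr _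
  have hg0 : ∀ x, 0 ≤ (g x).re := fun x => hχ0 _
  have k1 := k1 ε φ
  have k2 := k2 ε φ
  have k3 := k3 ε φ
  have k4 := k4 ε φ
  rw [← hg] at k1 k2 k3 k4
  set S := sobolevNorm Λ (m₁ - ρ / 2) (m₂ - ρ / 2) 2 φ ^ 2
  simp only [freqForm_deformAmp_one, ← cutForm_mul, Complex.ofRealCLM_apply, Complex.conj_ofReal,
    one_mul, ContinuousLinearEquiv.coe_coe, Complex.conjCLE_apply, Complex.conj_conj] at k1 k2 k3 k4
  have hb0 := re_integral_cutoff_mul_normSq_nonneg hgr hg0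
    (symbolInt (fun z => ((f z ^ (1 / 2 : ℝ) : ℝ) : ℂ)) φ)
  have hdecomp : cutForm g (fun z => ((f z ^ (1 / 2 : ℝ) : ℝ) : ℂ) * ((f z ^ (1 / 2 : ℝ) : ℝ) : ℂ)) φ =
      ((1 / 2 : ℂ) * cutForm g σ φ + (1 / 2 : ℂ) * cutForm g (fun z => starRingEnd ℂ (σ z)) φ) +
      (((-c : ℝ) : ℂ) * cutForm g (fun z => (phaseWeight Λ m₁ m₂ z : ℂ) * (phaseWeight Λ m₁ m₂ z : ℂ)) φ +
        (κ : ℂ) * cutForm g (fun z => (phaseWeight Λ (2 * m₁ - ρ) (2 * m₂ - ρ) z : ℂ)) φ) := by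
    have s1 := hσ.clm_comp (ContinuousLinearMap.mul ℝ ℂ (1 / 2))
    have s2 := hconj.clm_comp (ContinuousLinearMap.mul ℝ ℂ (1 / 2))
    have s3 := hω2c.clm_comp (ContinuousLinearMap.mul ℝ ℂ ((-c : ℝ) : ℂ))
    have s4 := hθc.clm_comp (ContinuousLinearMap.mul ℝ ℂ (κ : ℂ))
    have s4' := (hθc.mono hΛ (by linarith : _ ≤ 2 * m₁) (by linarith : _ ≤ 2 * m₂)).clm_comp
      (ContinuousLinearMap.mul ℝ ℂ (κ : ℂ))
    have e1 := hΛ.cutForm_add g (s1.add s2) (s3.add s4') φ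
    rw [hΛ.cutForm_add g s1 s2, hΛ.cutForm_add g s3 s4] at e1
    simp only [ContinuousLinearMap.mul_apply', Complex.ofRealCLM_apply,
      ContinuousLinearEquiv.coe_coe, Complex.conjCLE_apply, cutForm_const_mul] at e1
    have e2 : (fun z => (phaseWeight Λ m₁ m₂ z : ℂ) * (phaseWeight Λ m₁ m₂ z : ℂ)) =
        fun z => (phaseWeight Λ (2 * m₁) (2 * m₂) z : ℂ) := by
      funext z
      rw [← Complex.ofReal_mul, phaseWeight_mul hΛ, two_mul, two_mul]
    rw [e2, ← e1]
    -- Two symbols are compared pointwise here: f^{1/2} · f^{1/2} = f, with Re σ as half of σ + conj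
    -- σ.
    congr 1
    funext z
    rw [← Complex.ofReal_mul, ← Real.rpow_add (hfpos z)]
    norm_num
    simp only [hfdef]
    rw [← mul_add, Complex.add_conj]
    push_cast
    ring
  rw [hdecomp] at k1
  have e3 := re_integral_conj_swap hgr (symbolInt (fun _ => 1) φ) (symbolInt σ φ)
  rw [← cutForm_eq] at e3
  have r1 := (abs_le.1 ((Complex.abs_re_le_norm _).trans k1)).2
  have r2 := (abs_le.1 ((Complex.abs_re_le_norm _).trans k2)).2
  have r3 := (abs_le.1 ((Complex.abs_re_le_norm _).trans k3)).1
  have r4 := mul_le_mul_of_nonneg_left ((Complex.abs_re_le_norm _).trans k4) (abs_nonneg κ)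
  rw [← abs_mul] at r4
  have r4 := (abs_le.1 r4).2
  have hhalf : ((1 : ℂ) / 2) = ((1 / 2 : ℝ) : ℂ) := by norm_num
  rw [hhalf] at r1
  simp only [Complex.sub_re, Complex.add_re, Complex.re_ofReal_mul] at r1 r2 r3
  rw [e3] at r3
  have r2' := mul_le_mul_of_nonneg_left r2 hc.le
  linarith

/-- The cut-off inequality is taken at ε = 1/(k+1) with constants independent of k. Both integrands
are integrable without the cutoff, so the limit gives the pairing and the Sobolev norm. The factor
`fourierConst n ^ 2` converts from unnormalized operators. -/
theorem WeightBounds.garding_half (hΛ : WeightBounds Λ ρ) {σ : Eucl n → Eucl n → ℂ}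
    (hσ : SGFamily Λ ρ (2 * m₁) (2 * m₂) (fun _ : Unit => Function.uncurry σ)) {c R : ℝ}
    (hc : 0 < c) (hell : ∀ z : Eucl n × Eucl n, R ^ 2 ≤ ‖z.1‖ ^ 2 + ‖z.2‖ ^ 2 →
      2 * c * phaseWeight Λ (2 * m₁) (2 * m₂) z ≤ (Function.uncurry σ z).re) :
    ∃ C : ℝ, 0 ≤ C ∧ ∀ φ : 𝓢(Eucl n, ℂ), c * sobolevNorm Λ m₁ m₂ 2 φ ^ 2 -
      C * sobolevNorm Λ (m₁ - ρ / 2) (m₂ - ρ / 2) 2 φ ^ 2 ≤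
        (pairing (pseudoDiffOp σ φ) φ).re := by
  obtain ⟨χ, -, hχr, hχ0, hχ1, -⟩ := exists_even_schwartz n
  obtain ⟨C, hC, hb⟩ := hΛ.garding_cutoff hχr hχ0 hσ hc hell
  have ha := fourierConst_pos n
  refine ⟨fourierConst n ^ 2 * C, by positivity, fun φ => ?_⟩
  have e1 : ∀ g : Eucl n → ℂ, (fourierConst n : ℂ) ^ 2 * cutForm g (Function.uncurry σ) φ =
      ∫ x, g x * (pseudoDiffOp σ φ x * starRingEnd ℂ (φ x)) := by
    intro g
    rw [cutForm_eq, ← integral_const_mul]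
    refine integral_congr_ae (Filter.Eventually.of_forall fun x => ?_)
    simp only
    rw [pseudoDiffOp_eq_symbolInt, ← symbolInt_one φ x, map_mul, Complex.conj_ofReal]
    ring
  have e2 : ∀ g : Eucl n → ℂ, (fourierConst n : ℂ) ^ 2 *
      ∫ x, g x * (symbolInt (fun z => (phaseWeight Λ m₁ m₂ z : ℂ)) φ x *
        starRingEnd ℂ (symbolInt (fun z => (phaseWeight Λ m₁ m₂ z : ℂ)) φ x)) =
      ∫ x, g x * ((Λ x ^ (2 * m₂) * ‖weightLift Λ m₁ φ x‖ ^ 2 : ℝ) : ℂ) := by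
    intro g
    rw [← integral_const_mul]
    refine integral_congr_ae (Filter.Eventually.of_forall fun x => ?_)
    simp only
    have h := symbolInt_phaseWeight hΛ m₁ m₂ φ x
    have h' := congrArg (starRingEnd ℂ) h
    rw [map_mul, map_mul, Complex.conj_ofReal, Complex.conj_ofReal] at h'
    have h3 : (((Λ x ^ (2 * m₂) * ‖weightLift Λ m₁ φ x‖ ^ 2 : ℝ)) : ℂ) =
        (((Λ x ^ m₂ : ℝ) : ℂ) * weightLift Λ m₁ φ x) *
          (((Λ x ^ m₂ : ℝ) : ℂ) * starRingEnd ℂ (weightLift Λ m₁ φ x)) := by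
      rw [mul_mul_mul_comm, Complex.mul_conj, Complex.normSq_eq_norm_sq, two_mul,
        Real.rpow_add (hΛ.pos x)]
      push_cast
      ring
    rw [h3, ← h, ← h']
    ring
  have i1 : Integrable (fun x => pseudoDiffOp σ φ x * starRingEnd ℂ (φ x)) := by
    refine ((hΛ.integrable_symbolInt_mul hσ φ φ).const_mul (fourierConst n : ℂ)).congr
      (Filter.Eventually.of_forall fun x => ?_)
    simp only [pseudoDiffOp_eq_symbolInt]
    ring
  have i2 : Integrable (fun x => ((Λ x ^ (2 * m₂) * ‖weightLift Λ m₁ φ x‖ ^ 2 : ℝ) : ℂ)) :=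
    (hΛ.integrable_rpow_mul_norm_sq (2 * m₂) (weightLift Λ m₁ φ)).ofReal
  have t1 := (Complex.continuous_re.tendsto _).comp (tendsto_integral_dilate χ hχ1 i1)
  have t2 := (Complex.continuous_re.tendsto _).comp (tendsto_integral_dilate χ hχ1 i2)
  rw [integral_complex_ofReal, Complex.ofReal_re, ← hΛ.sobolevNorm_sq] at t2
  refine le_of_tendsto_of_tendsto' ((t2.const_mul c).sub_const _) t1 fun k => ?_
  have hk : 1 / ((k : ℝ) + 1) ∈ Set.Ioc (0 : ℝ) 1 :=
    ⟨Nat.one_div_pos_of_nat, by rw [div_le_one (by positivity)]; linarith [k.cast_nonneg (α := ℝ)]⟩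
  have h1 := mul_le_mul_of_nonneg_left (hb ⟨_, hk⟩ φ) (sq_nonneg (fourierConst n))
  simp only [Function.comp_apply]
  rw [← e1, ← e2, ← Complex.ofReal_pow, Complex.re_ofReal_mul, Complex.re_ofReal_mul]
  refine le_trans (le_of_eq ?_) h1
  ring

end Garding

/-! ### Changing the orders of the error norm -/

section Interpolation

open scoped SchwartzMap

variable {n : ℕ} {Λ : Eucl n → ℝ} {ρ : ℝ}

theorem freqForm_deformAmp_phaseWeight (hΛ : WeightBounds Λ ρ) (t₁ t₂ : ℝ) (φ : 𝓢(Eucl n, ℂ))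
    (x : Eucl n) :
    freqForm (deformAmp (fun x => ((Λ x ^ (2 * t₂) : ℝ) : ℂ)) (fun z => (phaseWeight Λ t₁ 0 z : ℂ))
      (fun z => (phaseWeight Λ t₁ 0 z : ℂ)) 1) (schwartzHat φ) (schwartzHat φ) x =
      (((fourierConst n)⁻¹ ^ 2 * (Λ x ^ (2 * t₂) * ‖weightLift Λ t₁ φ x‖ ^ 2) : ℝ) : ℂ) := by
  have ha : (fourierConst n : ℂ) ≠ 0 := mod_cast (fourierConst_pos n).ne'
  have h := symbolInt_phaseWeight hΛ t₁ 0 φ x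
  rw [Real.rpow_zero, Complex.ofReal_one, one_mul] at h
  have h' : symbolInt (fun z => (phaseWeight Λ t₁ 0 z : ℂ)) φ x =
      ((fourierConst n)⁻¹ : ℝ) * weightLift Λ t₁ φ x := by
    rw [← h]
    push_cast
    field_simp
  rw [freqForm_deformAmp_one]
  simp only [Complex.conj_ofReal]
  rw [h', Complex.mul_conj, Complex.normSq_eq_norm_sq, norm_mul, Complex.norm_real,
    Real.norm_of_nonneg (inv_nonneg.2 (fourierConst_pos n).le)]
  push_cast
  ring

/-- The squared norm is itself a form with amplitude Λ(x)^{2t₂} Λ(ξ)^{t₁} Λ(η)^{t₁}, which is also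
admissible for the larger order t₁'. The general form bound is needed because Λ(x) does not commute
with Λ(D). -/
theorem WeightBounds.sobolevNorm_sq_mono (hΛ : WeightBounds Λ ρ) {t₁ t₁' : ℝ} (h : t₁ ≤ t₁')
    (t₂ : ℝ) : ∃ C : ℝ, 0 ≤ C ∧ ∀ φ : 𝓢(Eucl n, ℂ),
      sobolevNorm Λ t₁ t₂ 2 φ ^ 2 ≤ C * sobolevNorm Λ t₁' t₂ 2 φ ^ 2 := by
  have hc := (((SGFamily.phaseWeight (T := Unit) hΛ t₁ 0).mono hΛ h le_rfl).clm_comp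
    Complex.ofRealCLM).base
  obtain ⟨K, hK⟩ := hΛ.symBound_deformAmp (hΛ.symBound_rpow (T := Unit) (2 * t₂)).ofReal hc hc
    (τ := fun _ => 1) (fun _ => by norm_num) (k₁ := t₁') (k₂ := t₂) (by ring) (by ring)
  obtain ⟨C, hC, hb⟩ := hΛ.norm_integral_freqForm_le hK
  have ha := fourierConst_pos n
  refine ⟨fourierConst n ^ 2 * C, by positivity, fun φ => ?_⟩
  have hb := hb () φ
  simp only [Complex.ofRealCLM_apply] at hb
  have hi : Integrable (fun x => (fourierConst n)⁻¹ ^ 2 *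
    (Λ x ^ (2 * t₂) * ‖weightLift Λ t₁ φ x‖ ^ 2)) :=
    (hΛ.integrable_rpow_mul_norm_sq (2 * t₂) (weightLift Λ t₁ φ)).const_mul _
  have e : freqForm (deformAmp (fun x => ((Λ x ^ (2 * t₂) : ℝ) : ℂ))
      (fun z => (phaseWeight Λ t₁ 0 z : ℂ)) (fun z => (phaseWeight Λ t₁ 0 z : ℂ)) 1)
      (schwartzHat φ) (schwartzHat φ) = fun x =>
      (((fourierConst n)⁻¹ ^ 2 * (Λ x ^ (2 * t₂) * ‖weightLift Λ t₁ φ x‖ ^ 2) : ℝ) : ℂ) :=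
    funext (freqForm_deformAmp_phaseWeight hΛ t₁ t₂ φ)
  rw [e] at hb
  have h1 := hb hi.ofReal
  rw [integral_complex_ofReal, integral_const_mul, ← hΛ.sobolevNorm_sq, Complex.norm_real,
    Real.norm_of_nonneg (by positivity)] at h1
  calc _ = fourierConst n ^ 2 * ((fourierConst n)⁻¹ ^ 2 * sobolevNorm Λ t₁ t₂ 2 φ ^ 2) := by
        field_simp
    _ ≤ fourierConst n ^ 2 * (C * sobolevNorm Λ t₁' t₂ 2 φ ^ 2) := by gcongr
    _ = _ := by ring

/-- Where Λ^ρ ≥ 1/ε, lowering 2m by ρ gains a factor ε. Elsewhere Λ is bounded in terms of ε, so the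
power is controlled by any lower one. -/
theorem WeightBounds.rpow_le_add (hΛ : WeightBounds Λ ρ) (m : ℝ) {s : ℝ} (hs : ρ / 2 ≤ s) {ε : ℝ}
    (hε : 0 < ε) : ∃ C : ℝ, 0 ≤ C ∧ ∀ x,
      Λ x ^ (2 * (m - ρ / 2)) ≤ ε * Λ x ^ (2 * m) + C * Λ x ^ (2 * (m - s)) := by
  have hρ := hΛ.rho_pos
  refine ⟨(1 / ε) ^ ((2 * s - ρ) / ρ), by positivity, fun x => ?_⟩
  have h0 := hΛ.pos x
  have e1 : Λ x ^ (2 * (m - ρ / 2)) = Λ x ^ (2 * m) * (Λ x ^ ρ)⁻¹ := by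
    rw [← Real.rpow_neg h0.le, ← Real.rpow_add h0]
    ring_nf
  have e2 : Λ x ^ (2 * (m - ρ / 2)) = (Λ x ^ ρ) ^ ((2 * s - ρ) / ρ) * Λ x ^ (2 * (m - s)) := by
    rw [← Real.rpow_mul h0.le, ← Real.rpow_add h0]
    congr 1
    field_simp
    ring
  have i1 := hΛ.rpow_pos ρ x
  have i2 := hΛ.rpow_pos (2 * m) x
  have i3 := hΛ.rpow_pos (2 * (m - s)) x
  rcases le_total (1 / ε) (Λ x ^ ρ) with h | h
  · have : (Λ x ^ ρ)⁻¹ ≤ ε := by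
      rw [inv_le_comm₀ i1 hε]
      simpa using h
    have h3 : 0 ≤ (1 / ε) ^ ((2 * s - ρ) / ρ) * Λ x ^ (2 * (m - s)) := by positivity
    rw [e1]
    nlinarith
  · have h4 : (Λ x ^ ρ) ^ ((2 * s - ρ) / ρ) ≤ (1 / ε) ^ ((2 * s - ρ) / ρ) :=
      Real.rpow_le_rpow i1.le h (div_nonneg (by linarith) hρ.le)
    have h3 : 0 ≤ ε * Λ x ^ (2 * m) := by positivity
    rw [e2]
    nlinarith

theorem WeightBounds.sobolevNorm_sq_le_add (hΛ : WeightBounds Λ ρ) (m : ℝ) {s : ℝ}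
    (hs : ρ / 2 ≤ s) {ε : ℝ} (hε : 0 < ε) : ∃ C : ℝ, 0 ≤ C ∧ ∀ (t : ℝ) (φ : 𝓢(Eucl n, ℂ)),
      sobolevNorm Λ t (m - ρ / 2) 2 φ ^ 2 ≤
        ε * sobolevNorm Λ t m 2 φ ^ 2 + C * sobolevNorm Λ t (m - s) 2 φ ^ 2 := by
  obtain ⟨C, hC, hb⟩ := hΛ.rpow_le_add m hs hε
  refine ⟨C, hC, fun t φ => ?_⟩
  have hi := fun k => hΛ.integrable_rpow_mul_norm_sq k (weightLift Λ t φ)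
  rw [hΛ.sobolevNorm_sq, hΛ.sobolevNorm_sq, hΛ.sobolevNorm_sq, ← integral_const_mul,
    ← integral_const_mul, ← integral_add ((hi _).const_mul _) ((hi _).const_mul _)]
  refine integral_mono (hi _) (((hi _).const_mul _).add ((hi _).const_mul _)) fun x => ?_
  calc _ ≤ (ε * Λ x ^ (2 * m) + C * Λ x ^ (2 * (m - s))) * ‖weightLift Λ t φ x‖ ^ 2 :=
        mul_le_mul_of_nonneg_right (hb x) (sq_nonneg _)
    _ = _ := by ring

theorem IsSGSymbolM.isSGSymbolS {m₁ m₂ : ℝ} {σ : Eucl n → Eucl n → ℂ}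
    (h : IsSGSymbolM Λ ρ m₁ m₂ σ) : IsSGSymbolS Λ ρ m₁ m₂ σ := by
  have h0 := h.mem_S 0 (by simp)
  simpa [multiPow, multiDeriv_eq_multiDirDeriv, multiDirDeriv_zero] using h0

end Interpolation

/-! ### Conclusion for all admissible orders of the error -/

theorem mainTheorem5 (n : ℕ) (Λ : EuclideanSpace ℝ (Fin n) → ℝ) (μ ρ : ℝ)
    (hΛ : IsWeight Λ μ) (hρ : 0 < ρ) (hρμ : ρ ≤ 1 / μ) (m₁ m₂ : ℝ)
    (σ : EuclideanSpace ℝ (Fin n) → EuclideanSpace ℝ (Fin n) → ℂ)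
    (hσ : IsSGSymbolM Λ ρ (2 * m₁) (2 * m₂) σ)
    (hell : IsStronglySGElliptic Λ (2 * m₁) (2 * m₂) σ) :
    ∃ C' : ℝ, 0 < C' ∧
      ∀ s₁ s₂ : ℝ, s₁ ≤ ρ / 2 → ρ / 2 ≤ s₂ →
        ∃ C : ℝ, 0 < C ∧ ∀ φ : SchwartzMap (EuclideanSpace ℝ (Fin n)) ℂ,
          C' * sobolevNorm Λ m₁ m₂ 2 φ ^ 2 - C * sobolevNorm Λ (m₁ - s₁) (m₂ - s₂) 2 φ ^ 2
            ≤ (pairing (pseudoDiffOp σ φ) φ).re := by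
  have hW := hΛ.weightBounds hρ hρμ
  have hS : SGFamily Λ ρ (2 * m₁) (2 * m₂) (fun _ : Unit => Function.uncurry σ) :=
    hσ.isSGSymbolS.sgEstimates.sgFamily hW
  obtain ⟨c, R, hc, -, hcR⟩ := hell
  obtain ⟨G, hG, hgar⟩ := hW.garding_half hS (c := c / 2) (R := R) (by positivity) fun z hz => by
    have := hcR z.1 z.2 hz
    unfold phaseWeight
    rw [mul_div_cancel₀ _ (two_ne_zero), ← mul_assoc]
    exact this
  obtain ⟨D, hD, hmono⟩ := hW.sobolevNorm_sq_mono (by linarith : m₁ - ρ / 2 ≤ m₁) m₂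
  -- The half-loss inequality has leading constant c/2. Absorbing a quarter leaves c/4, chosen
  -- before s₁ and s₂ and hence independent of them.
  refine ⟨c / 4, by positivity, fun s₁ s₂ hs₁ hs₂ => ?_⟩
  -- The position order is split first, at frequency order m₁ - ρ/2; both resulting norms then have
  -- their frequency order raised. The value of ε makes G ε D at most c/4, with 1 added to avoid a
  -- zero denominator.
  obtain ⟨E, hE, hehr⟩ := hW.sobolevNorm_sq_le_add m₂ hs₂ (ε := c / 4 / (G * D + 1)) (by positivity)
  obtain ⟨D', hD', hmono'⟩ := hW.sobolevNorm_sq_mono (by linarith : m₁ - ρ / 2 ≤ m₁ - s₁) (m₂ - s₂)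
  -- The added 1 only secures strict positivity.
  refine ⟨G * (E * D') + 1, by positivity, fun φ => le_trans ?_ (hgar φ)⟩
  set N := sobolevNorm Λ m₁ m₂ 2 φ ^ 2
  set L := sobolevNorm Λ (m₁ - s₁) (m₂ - s₂) 2 φ ^ 2
  have hN : 0 ≤ N := sq_nonneg _
  have hL : 0 ≤ L := sq_nonneg _
  have h1 : sobolevNorm Λ (m₁ - ρ / 2) (m₂ - ρ / 2) 2 φ ^ 2 ≤
      c / 4 / (G * D + 1) * (D * N) + E * (D' * L) := by
    refine (hehr _ φ).trans ?_
    gcongr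
    · exact hmono φ
    · exact hmono' φ
  have h2 : G * (c / 4 / (G * D + 1) * (D * N)) ≤ c / 4 * N := by
    have h3 : G * D / (G * D + 1) ≤ 1 := by
      rw [div_le_one (by positivity)]
      linarith
    calc _ = G * D / (G * D + 1) * (c / 4 * N) := by
          field_simp
      _ ≤ 1 * (c / 4 * N) := by gcongr
      _ = _ := one_mul _
  have h4 := mul_le_mul_of_nonneg_left h1 hG
  rw [mul_add] at h4
  linarith
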